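/- **Setting.** Let $p\ge 1$ be odd and consider a sharp regression-discontinuity design with cutoff $\mathsf x$: $y_i(1),y_i(0)$ are the potential outcomes, $x_i$ the forcing variable, $d_i=\mathbb I_{\{x_i\ge \mathsf x\}}$, $y_i=y_i(0)+(y_i(1)-y_i(0))d_i$, $g_+(x)=E[y_i(1)\mid x_i=x]$, $g_-(x)=E[y_i(0)\mid x_i=x]$, $\sigma_+^2(x)=\mathrm{Var}[y_i(1)\mid x_i=x]$, $\sigma_-^2(x)=\mathrm{Var}[y_i(0)\mid x_i=x]$, $\tau=g_+(\mathsf x)-g_-(\mathsf x)$. Assume that $(y_i,x_i,d_i)$ are i.i.d., that $x_i$ has bounded support $\mathbb S_x$ and a density $f$ continuous on $\mathbb S_x$, that $\sup_{x\in\mathbb S_x}E[y_i^4\mid x_i=x]<\infty$, and that on an open neighborhood of $\mathsf x$: $f>0$, $\sigma_\pm^2$ are continuous, and $g_\pm^{(p+1)}$ are Hölder continuous with some exponent $\eta>0$. Assume $\sigma_+^2(\mathsf x)+\sigma_-^2(\mathsf x)>0$. The kernels $K^{+}$ and $K^{-}$ used to the right and to the left of the cutoff may differ; each has support $(-1,1)$,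 on which it is symmetric, positive and Lipschitz. The common bandwidth $h=h_n>0$ satisfies $h+(nh)^{-1}\log n\to0$ and $nh^{2p+3}\to\kappa\in[0,\infty)$. **Statistics.** Put $r_q(u)=(1,u,\dots,u^q)'$, let $\iota_j$ be the vector whose entry with index $j$ (counting from $0$) is $1$ and whose other entries are $0$, and let $K_{+,i}(x)=K^{+}(\tfrac{x_i-x}{h})\mathbb I_{\{x_i\ge\mathsf x\}}$, $K_{-,i}(x)=K^{-}(\tfrac{x_i-x}{h})\mathbb I_{\{x_i<\mathsf x\}}$. For each side $s\in\{+,-\}$ let $$\Gamma_{s,q}(x)=\tfrac1{nh}\sum_i K_{s,i}(x)\,r_q(\tfrac{x_i-x}{h})r_q(\tfrac{x_i-x}{h})',\qquad w_{s,i}(x)=\iota_0'\Gamma_{s,p}(x)^{-1}r_p(\tfrac{x_i-x}{h})K_{s,i}(x),$$ $$\hat g_{s,n}(x)=\tfrac1{nh}\sum_i w_{s,i}(x)y_i,\quad C_{s,n}(x)=\tfrac1{nh}\sum_i w_{s,i}(x)\big(\tfrac{x_i-x}{h}\big)^{p+1},\quad Q_{s,n}=\frac{C_{s,n}(\mathsf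 x)}{\frac1{nh}\sum_i w_{s,i}(\mathsf x)C_{s,n}(x_i)},$$ and let $T_n=\sqrt{nh}\,\big(\hat g_{+,n}(\mathsf x)-\hat g_{-,n}(\mathsf x)-\tau\big)$. *New (modified local polynomial bootstrap) bias estimator.* Let $\hat g_{s,n}^*$ be $\hat g_{s,n}$ computed from $(y_i^*,x_i)$, where $y_i^*=\hat g_{+,n}(x_i)\mathbb I_{\{x_i\ge\mathsf x\}}+\hat g_{-,n}(x_i)\mathbb I_{\{x_i<\mathsf x\}}+\tilde\varepsilon_ie_i^*$, with $\tilde\varepsilon_i$ any residuals computed from the data and $e_i^*$ i.i.d. multipliers, independent of the data, with mean $0$ and variance $1$. Let $T_{s,n}^*=\sqrt{nh}\,(\hat g_{s,n}^*(\mathsf x)-\hat g_{s,n}(\mathsf x))$ and $\hat B_{\mathsf{rd},n}=E^*[Q_{+,n}T_{+,n}^*-Q_{-,n}T_{-,n}^*]$, where $E^*$ is the expectation over the multipliers with the data held fixed. *Existing RBC bias estimator.* Let $\hat B_{\mathsf{RBC\text{-}rd},n}=\hat B_{\mathsf{RBC},+,n}-\hat B_{\mathsf{RBC},-,n}$ with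 $\hat B_{\mathsf{RBC},s,n}=\sqrt{nh^{2p+3}}\;\hat g_{s,n}^{(p+1)}(\mathsf x)\,C_{s,n}(\mathsf x)/(p+1)!$, where $$\hat g_{s,n}^{(p+1)}(\mathsf x)=(p+1)!\,h^{-(p+1)}\,\tfrac1{nh}\sum_i\iota_{p+1}'\Gamma_{s,p+1}(\mathsf x)^{-1}r_{p+1}(\tfrac{x_i-\mathsf x}{h})K_{s,i}(\mathsf x)\,y_i$$ is the derivative estimator from a local polynomial regression of order $p+1$ with the same kernel and bandwidth. **Kernel constants.** For a kernel $K$ let $\mathsf w_{\mathsf{bnd}}(u,s)=\iota_0'\big(\int_{-s}^1r_p(v)r_p(v)'K(v)\,dv\big)^{-1}r_p(u)K(u)$, $\mathsf w(u)=\mathsf w_{\mathsf{bnd}}(u,0)$, $$C=\int_0^\infty\mathsf w(u)u^{p+1}du,\qquad C_{\mathsf{LP}}=\int_0^1\mathsf w_{\mathsf{bnd}}(s,0)\int_{-s}^1\mathsf w_{\mathsf{bnd}}(u,s)u^{p+1}\,du\,ds,\qquad Q=C/C_{\mathsf{LP}},$$ $$\mathsf w_{\mathsf{conv},\mathsf{bnd}}(u)=\int_0^\infty\mathsf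 w_{\mathsf{bnd}}(r,0)\,\mathsf w_{\mathsf{bnd}}(u-r,r)\,dr,$$ $$\mathcal K_{\mathsf{rd}}=\int_0^\infty\big((1+Q)\mathsf w(u)-Q\,\mathsf w_{\mathsf{conv},\mathsf{bnd}}(u)\big)^2du,$$ $$\mathcal K_{\mathsf{RBC}}=\int_0^\infty\Big(\mathsf w(u)-C\,\iota_{p+1}'\Big(\int_0^\infty r_{p+1}r_{p+1}'K\Big)^{-1}r_{p+1}(u)K(u)\Big)^2du,$$ and let $\mathcal K_{+,\cdot}$, $\mathcal K_{-,\cdot}$ be these constants for $K^{+}$, $K^{-}$. Assume $C_{\mathsf{LP}}\ne0$ for both kernels, so that $Q$ is defined. **Claim.** There are $v^2_{\mathsf{rd}}>0$ and $v^2_{\mathsf{RBC\text{-}rd}}>0$ (the asymptotic variances of the new and of the existing RBC procedure) such that $T_n-\hat B_{\mathsf{rd},n}\to N(0,v^2_{\mathsf{rd}})$ and $T_n-\hat B_{\mathsf{RBC\text{-}rd},n}\to N(0,v^2_{\mathsf{RBC\text{-}rd}})$ in distribution, and $$\frac{v^2_{\mathsf{rd}}}{v^2_{\mathsf{RBC\text{-}rd}}}=\frac{\sigma_+^2(\mathsf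 x)\mathcal K_{+,\mathsf{rd}}+\sigma_-^2(\mathsf x)\mathcal K_{-,\mathsf{rd}}}{\sigma_+^2(\mathsf x)\mathcal K_{+,\mathsf{RBC}}+\sigma_-^2(\mathsf x)\mathcal K_{-,\mathsf{RBC}}}.$$ -/

import Mathlib

open MeasureTheory ProbabilityTheory Filter Topology
open scoped NNReal ENNReal

noncomputable section

namespace RDD

/-! ### Local polynomial regression in a fixed sample -/

/-- The vector of powers `r_p(u) = (1, u, …, u ^ p)`. -/
def powers (p : ℕ) (u : ℝ) : Fin (p + 1) → ℝ := fun a => u ^ (a : ℕ)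

/-- The ingredients of a one-sided local polynomial regression that do not involve the outcomes:
kernel `K`, the side of the cutoff whose observations are used, bandwidth `h`, sample size `n`
and regressors `x_i` (only `i < n` matters). -/
structure Design where
  kernel : ℝ → ℝ
  side : Set ℝ
  bandwidth : ℝ
  size : ℕ
  regressor : ℕ → ℝ

namespace Design

variable (D : Design)

/-- `n h`. -/
def effSize : ℝ := (D.size : ℝ) * D.bandwidth

/-- `(x_i - x) / h`. -/
def scaled (x : ℝ) (i : ℕ) : ℝ := (D.regressor i - x) / D.bandwidth

/-- The one-sided kernel weight `K((x_i - x) / h) 1{x_i ∈ side}`. -/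
def kernelAt (x : ℝ) (i : ℕ) : ℝ :=
  D.side.indicator (fun t => D.kernel ((t - x) / D.bandwidth)) (D.regressor i)

/-- The matrix `Γ_q(x) = Z_q(x)' W(x) Z_q(x) / n`, with entries
`(nh)⁻¹ ∑ K((x_i - x) / h) 1{x_i ∈ side} ((x_i - x) / h) ^ (a + b)`. -/
def gram (q : ℕ) (x : ℝ) : Matrix (Fin (q + 1)) (Fin (q + 1)) ℝ :=
  Matrix.of fun a b => D.effSize⁻¹ *
    ∑ i ∈ Finset.range D.size, D.kernelAt x i * D.scaled x i ^ ((a : ℕ) + (b : ℕ))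

/-- `ι_j' Γ_q(x)⁻¹ r_q((x_i - x) / h) K((x_i - x) / h) 1{x_i ∈ side}`; for `j = 0` these are the
weights `w_i(x)` of the local polynomial estimator of order `q`. -/
def weight (q : ℕ) (j : Fin (q + 1)) (x : ℝ) (i : ℕ) : ℝ :=
  (Matrix.mulVec (D.gram q x)⁻¹ (powers q (D.scaled x i))) j * D.kernelAt x i

/-- The `j`-th entry of `β̂_{q,n}(x) = H_q (Z_q' W Z_q)⁻¹ Z_q' W y`, the coefficient vector of
kernel-weighted least squares of `y_i` on `1, x_i - x, …, (x_i - x) ^ q`. -/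
def coef (q : ℕ) (j : Fin (q + 1)) (x : ℝ) (y : ℕ → ℝ) : ℝ :=
  (D.bandwidth ^ (j : ℕ))⁻¹ *
    (D.effSize⁻¹ * ∑ i ∈ Finset.range D.size, D.weight q j x i * y i)

/-- The local polynomial estimator `ĝ_n(x) = (nh)⁻¹ ∑ w_i(x) y_i` of order `p`. -/
def fit (p : ℕ) (x : ℝ) (y : ℕ → ℝ) : ℝ := D.coef p 0 x y

/-- `C_n(x) = ι_0' (Z_p' W Z_p)⁻¹ Z_p' W Z_{p+1} ι_{p+1}
= (nh)⁻¹ ∑ w_i(x) ((x_i - x) / h) ^ (p + 1)`. -/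
def biasConst (p : ℕ) (x : ℝ) : ℝ :=
  D.effSize⁻¹ * ∑ i ∈ Finset.range D.size, D.weight p 0 x i * D.scaled x i ^ (p + 1)

/-- `C_{LP,n}(x) = (nh)⁻¹ ∑ w_i(x) C_n(x_i)`. -/
def smoothedBiasConst (p : ℕ) (x : ℝ) : ℝ :=
  D.effSize⁻¹ * ∑ i ∈ Finset.range D.size, D.weight p 0 x i * D.biasConst p (D.regressor i)

/-- The scaling factor `Q_n = C_n / C_{LP,n}`. -/
def scaling (p : ℕ) (x : ℝ) : ℝ := D.biasConst p x / D.smoothedBiasConst p x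

/-- The estimator `ĝ_n^{(p+1)}(x) = (p+1)! ι_{p+1}' β̂_{p+1,n}(x)` of the derivative of order
`p + 1`, from a local polynomial regression of order `p + 1`. -/
def derivEst (p : ℕ) (x : ℝ) (y : ℕ → ℝ) : ℝ :=
  ((p + 1).factorial : ℝ) * D.coef (p + 1) (Fin.last (p + 1)) x y

/-- The robust-bias-correction bias estimator
`B̂_{RBC,n} = √(n h^{2p+3}) ĝ_n^{(p+1)}(x) C_n / (p+1)!`. -/
def rbcBias (p : ℕ) (x : ℝ) (y : ℕ → ℝ) : ℝ :=
  Real.sqrt ((D.size : ℝ) * D.bandwidth ^ (2 * p + 3)) * D.derivEst p x y *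
    (D.biasConst p x / ((p + 1).factorial : ℝ))

/-- The one-sided bootstrap statistic `√(nh) (ĝ*_n(x) - ĝ_n(x))`, where `ĝ*_n` is computed from
the bootstrap outcomes `ystar` and the original regressors. -/
def bootStat (p : ℕ) (x : ℝ) (y ystar : ℕ → ℝ) : ℝ :=
  Real.sqrt D.effSize * (D.fit p x ystar - D.fit p x y)

end Design

/-! ### The regression-discontinuity statistics -/

/-- Treatment indicator `d = 1{x ≥ x₀}`. -/
def treat (x₀ x : ℝ) : ℝ := (Set.Ici x₀).indicator (fun _ => 1) x

/-- Observed outcome `y = y(0) + (y(1) - y(0)) d`. -/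
def observed {Ω : Type*} (x₀ : ℝ) (x y1 y0 : ℕ → Ω → ℝ) (i : ℕ) (ω : Ω) : ℝ :=
  y0 i ω + (y1 i ω - y0 i ω) * treat x₀ (x i ω)

/-- Regression to the right of the cutoff: kernel `K₊(·) = K(·) 1{x_i ≥ x₀}`. -/
def rightDesign (K : ℝ → ℝ) (x₀ h : ℝ) (n : ℕ) (xs : ℕ → ℝ) : Design :=
  ⟨K, Set.Ici x₀, h, n, xs⟩

/-- Regression to the left of the cutoff: kernel `K₋(·) = K(·) 1{x_i < x₀}`. -/
def leftDesign (K : ℝ → ℝ) (x₀ h : ℝ) (n : ℕ) (xs : ℕ → ℝ) : Design :=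
  ⟨K, Set.Iio x₀, h, n, xs⟩

/-- `T_n = √(nh) (τ̂_n(x₀) - τ)` with `τ̂_n(x₀) = ĝ_{+,n}(x₀) - ĝ_{-,n}(x₀)`. -/
def stat (p : ℕ) (Kr Kl : ℝ → ℝ) (x₀ h τ : ℝ) (n : ℕ) (xs y : ℕ → ℝ) : ℝ :=
  Real.sqrt ((n : ℝ) * h) *
    (((rightDesign Kr x₀ h n xs).fit p x₀ y - (leftDesign Kl x₀ h n xs).fit p x₀ y) - τ)

/-- Bootstrap outcomes
`y*_i = ĝ_{+,n}(x_i) 1{x_i ≥ x₀} + ĝ_{-,n}(x_i) 1{x_i < x₀} + ε̃_i e*_i`. -/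
def bootOutcome (p : ℕ) (Kr Kl : ℝ → ℝ) (x₀ h : ℝ) (n : ℕ) (xs y resid e : ℕ → ℝ)
    (i : ℕ) : ℝ :=
  (Set.Ici x₀).indicator (fun t => (rightDesign Kr x₀ h n xs).fit p t y) (xs i) +
    (Set.Iio x₀).indicator (fun t => (leftDesign Kl x₀ h n xs).fit p t y) (xs i) +
    resid i * e i

/-- The modified bootstrap statistic `T*_{rd,n} = Q_{+,n} T*_{+,n} - Q_{-,n} T*_{-,n}`. -/
def bootStat (p : ℕ) (Kr Kl : ℝ → ℝ) (x₀ h : ℝ) (n : ℕ) (xs y resid e : ℕ → ℝ) : ℝ :=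
  (rightDesign Kr x₀ h n xs).scaling p x₀ *
      (rightDesign Kr x₀ h n xs).bootStat p x₀ y (bootOutcome p Kr Kl x₀ h n xs y resid e) -
    (leftDesign Kl x₀ h n xs).scaling p x₀ *
      (leftDesign Kl x₀ h n xs).bootStat p x₀ y (bootOutcome p Kr Kl x₀ h n xs y resid e)

/-- The bootstrap bias `B̂_{rd,n} = E*[T*_{rd,n}]`: the data are held fixed and the expectation is
over the bootstrap multipliers `e`. -/
def bootBias {Ω' : Type*} [MeasurableSpace Ω'] (P' : Measure Ω') (e : ℕ → Ω' → ℝ)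
    (p : ℕ) (Kr Kl : ℝ → ℝ) (x₀ h : ℝ) (n : ℕ) (xs y resid : ℕ → ℝ) : ℝ :=
  ∫ ω', bootStat p Kr Kl x₀ h n xs y resid (fun i => e i ω') ∂P'

/-- The bias estimator of the existing robust-bias-corrected interval for the discontinuity. -/
def rbcBias (p : ℕ) (Kr Kl : ℝ → ℝ) (x₀ h : ℝ) (n : ℕ) (xs y : ℕ → ℝ) : ℝ :=
  (rightDesign Kr x₀ h n xs).rbcBias p x₀ y - (leftDesign Kl x₀ h n xs).rbcBias p x₀ y

/-- `T_n → N(0, v)` in distribution: `v` is the asymptotic variance of the statistic `T_n`. -/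
def HasAsymptoticVariance {Ω : Type*} [MeasurableSpace Ω] (P : Measure Ω)
    [IsProbabilityMeasure P] (T : ℕ → Ω → ℝ) (v : ℝ≥0) : Prop :=
  TendstoInDistribution T atTop (id : ℝ → ℝ) (fun _ => P) (gaussianReal 0 v)

/-! ### Equivalent kernels at a boundary point and the variance constants -/

/-- The matrix `∫_{-s}^1 r_q(v) r_q(v)' K(v) dv`. -/
def moments (K : ℝ → ℝ) (q : ℕ) (s : ℝ) : Matrix (Fin (q + 1)) (Fin (q + 1)) ℝ :=
  Matrix.of fun a b => ∫ v in (-s)..1, v ^ ((a : ℕ) + (b : ℕ)) * K v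

/-- `ι_j' (∫_{-s}^1 r_q(v) r_q(v)' K(v) dv)⁻¹ r_q(u) K(u)`. -/
def eqKernelRow (K : ℝ → ℝ) (q : ℕ) (j : Fin (q + 1)) (u s : ℝ) : ℝ :=
  (Matrix.mulVec (moments K q s)⁻¹ (powers q u)) j * K u

/-- `w_bnd(u, s)`. -/
def wBnd (K : ℝ → ℝ) (p : ℕ) (u s : ℝ) : ℝ := eqKernelRow K p 0 u s

/-- The boundary equivalent kernel `w(u) = w_bnd(u, 0)`; as `K` vanishes off `(-1, 1)`, the
integral over `[0, 1]` in its definition is the one over `[0, ∞)`. -/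
def wEq (K : ℝ → ℝ) (p : ℕ) (u : ℝ) : ℝ := wBnd K p u 0

/-- `C = ∫_0^∞ w(u) u^{p+1} du`. -/
def constC (K : ℝ → ℝ) (p : ℕ) : ℝ := ∫ u in Set.Ici (0 : ℝ), wEq K p u * u ^ (p + 1)

/-- `C_LP = ∫_0^1 w_bnd(s, 0) ∫_{-s}^1 w_bnd(u, s) u^{p+1} du ds`. -/
def constCLP (K : ℝ → ℝ) (p : ℕ) : ℝ :=
  ∫ s in (0 : ℝ)..1, wBnd K p s 0 * ∫ u in (-s)..1, wBnd K p u s * u ^ (p + 1)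

/-- `Q = C / C_LP`. -/
def constQ (K : ℝ → ℝ) (p : ℕ) : ℝ := constC K p / constCLP K p

/-- `w_{conv,bnd}(u) = ∫_0^∞ w_bnd(r, 0) w_bnd(u - r, r) dr`. -/
def wConv (K : ℝ → ℝ) (p : ℕ) (u : ℝ) : ℝ :=
  ∫ r in Set.Ici (0 : ℝ), wBnd K p r 0 * wBnd K p (u - r) r

/-- `w_mPLP(u) = w(u) - Q (w_{conv,bnd}(u) - w(u))`. -/
def wMPLP (K : ℝ → ℝ) (p : ℕ) (u : ℝ) : ℝ :=
  wEq K p u - constQ K p * (wConv K p u - wEq K p u)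

/-- `w_RBC(u) = w(u) - C ι_{p+1}' (∫_0^∞ r_{p+1} r_{p+1}' K)⁻¹ r_{p+1}(u) K(u)`. -/
def wRBC (K : ℝ → ℝ) (p : ℕ) (u : ℝ) : ℝ :=
  wEq K p u - constC K p * eqKernelRow K (p + 1) (Fin.last (p + 1)) u 0

/-- `𝒦_mPLP` at a boundary point. -/
def KmPLP (K : ℝ → ℝ) (p : ℕ) : ℝ := ∫ u in Set.Ici (0 : ℝ), wMPLP K p u ^ 2

/-- `𝒦_RBC` at a boundary point. -/
def KRBC (K : ℝ → ℝ) (p : ℕ) : ℝ := ∫ u in Set.Ici (0 : ℝ), wRBC K p u ^ 2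

/-! ### Assumptions -/

/-- The kernel has support `(-1, 1)`, on which it is symmetric, positive and Lipschitz. -/
structure IsKernel (K : ℝ → ℝ) : Prop where
  eq_zero : ∀ u, u ∉ Set.Ioo (-1 : ℝ) 1 → K u = 0
  symm : ∀ u, K (-u) = K u
  pos : ∀ u ∈ Set.Ioo (-1 : ℝ) 1, 0 < K u
  lipschitz : ∃ L : ℝ≥0, LipschitzOnWith L K (Set.Ioo (-1) 1)

/-- The bandwidth satisfies `h + (nh)⁻¹ log n → 0` and `n h^{2p+3} → κ ∈ [0, ∞)`. -/
structure IsBandwidth (p : ℕ) (h : ℕ → ℝ) : Prop where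
  pos : ∀ n, 0 < h n
  tendsto : Tendsto (fun n : ℕ => h n + ((n : ℝ) * h n)⁻¹ * Real.log n) atTop (𝓝 0)
  rate : ∃ κ : ℝ, 0 ≤ κ ∧ Tendsto (fun n : ℕ => (n : ℝ) * h n ^ (2 * p + 3)) atTop (𝓝 κ)

/-- `g(t) = E[Y | X = t]` and `s(t) = Var[Y | X = t]` (for almost every `t`, as always for
conditional moments). -/
structure HasCondMoments {Ω : Type*} [MeasurableSpace Ω] (P : Measure Ω) [IsFiniteMeasure P]
    (Y X : Ω → ℝ) (g s : ℝ → ℝ) : Prop where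
  memLp : ∀ᵐ t ∂(P.map X), MemLp (id : ℝ → ℝ) 2 (condDistrib Y X P t)
  mean : ∀ᵐ t ∂(P.map X), ∫ y, y ∂(condDistrib Y X P t) = g t
  var : ∀ᵐ t ∂(P.map X), variance (id : ℝ → ℝ) (condDistrib Y X P t) = s t

/-- The sharp design with cutoff `x₀`: forcing variables `x i`, potential outcomes `y1 i`, `y0 i`,
density `f` of `x i`, regression functions `gr`, `gl` and conditional variances `sr`, `sl` of
the potential outcomes with and without treatment (relevant to the right and to the left of
the cutoff). -/
structure Model {Ω : Type*} [MeasurableSpace Ω] (P : Measure Ω) [IsProbabilityMeasure P]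
    (p : ℕ) (x₀ : ℝ) (x y1 y0 : ℕ → Ω → ℝ) (f gr gl sr sl : ℝ → ℝ) : Prop where
  meas_x : ∀ i, Measurable (x i)
  meas_y1 : ∀ i, Measurable (y1 i)
  meas_y0 : ∀ i, Measurable (y0 i)
  /-- The observations `(y_i, x_i, d_i)` are i.i.d. -/
  indep : iIndepFun (fun i ω => (observed x₀ x y1 y0 i ω, x i ω, treat x₀ (x i ω))) P
  ident : ∀ i, IdentDistrib (fun ω => (observed x₀ x y1 y0 i ω, x i ω, treat x₀ (x i ω)))
    (fun ω => (observed x₀ x y1 y0 0 ω, x 0 ω, treat x₀ (x 0 ω))) P P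
  /-- `x_i` has bounded support and a density that is continuous on the support. -/
  bounded : Bornology.IsBounded (P.map (x 0)).support
  meas_f : Measurable f
  f_nonneg : ∀ t, 0 ≤ f t
  density : P.map (x 0) = volume.withDensity fun t => ENNReal.ofReal (f t)
  f_cont : ContinuousOn f (P.map (x 0)).support
  cond_right : ∀ i, HasCondMoments P (y1 i) (x i) gr sr
  cond_left : ∀ i, HasCondMoments P (y0 i) (x i) gl sl
  /-- `E[y_i ^ 4 | x_i = t]` is bounded. -/
  fourth : ∃ M : ℝ≥0, ∀ᵐ t ∂(P.map (x 0)),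
    ∫⁻ y, ‖y‖ₑ ^ 4 ∂(condDistrib (observed x₀ x y1 y0 0) (x 0) P t) ≤ M
  /-- Positivity and smoothness in an open neighborhood of the cutoff. -/
  local_smooth : ∃ N : Set ℝ, IsOpen N ∧ x₀ ∈ N ∧ (∀ t ∈ N, 0 < f t) ∧
    ContinuousOn sr N ∧ ContinuousOn sl N ∧
    ContDiffOn ℝ ((p + 1 : ℕ) : WithTop ℕ∞) gr N ∧
    ContDiffOn ℝ ((p + 1 : ℕ) : WithTop ℕ∞) gl N ∧
    ∃ η : ℝ≥0, 0 < η ∧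
      (∃ L : ℝ≥0, HolderOnWith L η (iteratedDeriv (p + 1) gr) N) ∧
      ∃ L : ℝ≥0, HolderOnWith L η (iteratedDeriv (p + 1) gl) N

/-- Bootstrap multipliers: i.i.d. with mean zero and unit variance under the bootstrap law. -/
structure IsMultiplier {Ω' : Type*} [MeasurableSpace Ω'] (P' : Measure Ω')
    (e : ℕ → Ω' → ℝ) : Prop where
  meas : ∀ i, Measurable (e i)
  memLp : ∀ i, MemLp (e i) 2 P'
  indep : iIndepFun e P'
  ident : ∀ i, IdentDistrib (e i) (e 0) P' P'
  mean : ∀ i, ∫ ω', e i ω' ∂P' = 0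
  var : ∀ i, ∫ ω', e i ω' ^ 2 ∂P' = 1

end RDD

end

noncomputable section

namespace RDD

/-! ### Local polynomial functionals of an averaging operation -/

/-! Both corrected statistics are linear in the outcomes. Under the bootstrap expectation the
multipliers average out, so the bootstrap bias on one side is `√(nh)` times the fit at the cutoff to
the fitted values minus the fit itself. After scaling by `Q_n` and subtracting, that side
contributes a sum of outcomes with weights `w - Q_n (w_conv - w)` (`locBoot`). Subtracting the
derivative-based bias estimate gives weights `w - C_n w'`, where `w'` extracts the top coefficient
of a fit of order `p + 1` (`locRBC`).

Bias. A fit of order `p` reproduces polynomials of degree `p`. On `v ^ (p + 1)` the single fit at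
the cutoff errs by `C_n`, and the iterated fit errs by `C_n + C_{LP,n}`. Since `Q_n = C_n /
C_{LP,n}`, the bootstrap-corrected weights reproduce degree `p + 1` exactly in the sample
(`Sample.avg_locBoot_mul_pow`); the RBC weights do so too (`Sample.avg_locRBC_mul_pow`). Only the
Taylor remainder `o(h ^ (p + 1))` is left, and `√(nh) h ^ (p + 1)` is bounded, so the bias is
negligible (`ReproducingWeights.tendsto_bias`).

Weights. All weights are built from an averaging functional `E`: the sample average for the
estimator, and `f(x₀) ∫_0^2` for its limit. Averages of indicators of intervals converge by the law
of large numbers. A Riemann-sum comparison upgrades this to uniform convergence over families of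
piecewise continuous functions (`Approximates.tendstoUniformlyOn_avg`). The limiting Gram matrices
are nonsingular at every evaluation point of `[0, 2]`, so the weights converge uniformly.
Convergence in probability is expressed as convergence along `probFilter`, so the deterministic
arguments apply unchanged.

Noise. By conditional uncorrelatedness and Chebyshev the random weights may be replaced by their
limits (`NoisySample.tendsto_negligible`). What remains is a triangular array with i.i.d. rows,
treated with characteristic functions (`NoisySample.tendstoInDistribution_noise`). The two sides
have disjoint supports, so one array covers both and the variances add.

Variance. The limiting weights are `f(x₀)⁻¹` times the equivalent kernels and the noise contributes
`f(x₀)`. Each variance is therefore `f(x₀)⁻¹ (σ₊² 𝒦₊ + σ₋² 𝒦₋)`, and the density cancels in the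
ratio. The constants `𝒦` are positive because the limiting weights have integral one.

The left side is reflected, so that both sides use the coordinate `v = σ (x_i - x₀) / h` in `[0,
2)`. Since `p` is odd, the reflection leaves the power `p + 1` unchanged. The window has length two
because the kernel has range one and the fit is iterated once. -/

/-- The matrix with entries `E[K(v - s) (v - s) ^ (a + b)]`. -/
def locGram (E : (ℝ → ℝ) → ℝ) (K : ℝ → ℝ) (q : ℕ) (s : ℝ) :
    Matrix (Fin (q + 1)) (Fin (q + 1)) ℝ :=
  Matrix.of fun a b => E fun v => K (v - s) * (v - s) ^ ((a : ℕ) + (b : ℕ))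

/-- The local polynomial weight at `v` for the fit at `s`. -/
def locWeight (E : (ℝ → ℝ) → ℝ) (K : ℝ → ℝ) (q : ℕ) (j : Fin (q + 1)) (s v : ℝ) : ℝ :=
  (Matrix.mulVec (locGram E K q s)⁻¹ (powers q (v - s))) j * K (v - s)

/-- The leading bias constant of the local polynomial fit at `s`. -/
def locBias (E : (ℝ → ℝ) → ℝ) (K : ℝ → ℝ) (p : ℕ) (s : ℝ) : ℝ :=
  E fun v => locWeight E K p 0 s v * (v - s) ^ (p + 1)

/-- The bias constants smoothed by the weights at `0`. -/
def locSmooth (E : (ℝ → ℝ) → ℝ) (K : ℝ → ℝ) (p : ℕ) : ℝ :=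
  E fun s => locWeight E K p 0 0 s * locBias E K p s

/-- The weights of the iterated local polynomial fit. -/
def locConv (E : (ℝ → ℝ) → ℝ) (K : ℝ → ℝ) (p : ℕ) (v : ℝ) : ℝ :=
  E fun s => locWeight E K p 0 0 s * locWeight E K p 0 s v

/-- The weights of the estimator corrected by the scaled bootstrap bias. -/
def locBoot (E : (ℝ → ℝ) → ℝ) (K : ℝ → ℝ) (p : ℕ) (v : ℝ) : ℝ :=
  locWeight E K p 0 0 v -
    locBias E K p 0 / locSmooth E K p * (locConv E K p v - locWeight E K p 0 0 v)

/-- The weights of the estimator corrected by an estimated derivative. -/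
def locRBC (E : (ℝ → ℝ) → ℝ) (K : ℝ → ℝ) (p : ℕ) (v : ℝ) : ℝ :=
  locWeight E K p 0 0 v - locBias E K p 0 * locWeight E K (p + 1) (Fin.last (p + 1)) 0 v

/-- Linearity on the span of the kernel-weighted powers. -/
def LinearOnMoments (E : (ℝ → ℝ) → ℝ) (K : ℝ → ℝ) : Prop :=
  ∀ (q k : ℕ) (s : ℝ) (c : Fin (q + 1) → ℝ),
    E (fun v => ∑ b, c b * (K (v - s) * (v - s) ^ ((b : ℕ) + k))) =
      ∑ b, c b * E (fun v => K (v - s) * (v - s) ^ ((b : ℕ) + k))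

lemma locWeight_mul_pow (E : (ℝ → ℝ) → ℝ) (K : ℝ → ℝ) (q : ℕ) (j : Fin (q + 1)) (s v : ℝ)
    (k : ℕ) : locWeight E K q j s v * (v - s) ^ k =
      ∑ b, (locGram E K q s)⁻¹ j b * (K (v - s) * (v - s) ^ ((b : ℕ) + k)) := by
  simp only [locWeight, Matrix.mulVec, dotProduct, powers, Finset.sum_mul]
  refine Finset.sum_congr rfl fun b _ => ?_
  ring

/-- Expresses moments of the weights through inverse Gram entries and kernel moments. Linearity is
asked only on this span because the limiting functional is an integral, which is additive only on
integrable functions. -/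
lemma LinearOnMoments.apply_locWeight_mul_pow {E : (ℝ → ℝ) → ℝ} {K : ℝ → ℝ}
    (hE : LinearOnMoments E K) (q : ℕ) (j : Fin (q + 1)) (s : ℝ) (k : ℕ) :
    E (fun v => locWeight E K q j s v * (v - s) ^ k) =
      ∑ b, (locGram E K q s)⁻¹ j b * E (fun v => K (v - s) * (v - s) ^ ((b : ℕ) + k)) := by
  simp only [locWeight_mul_pow]
  exact hE q k s _

/-- Local polynomial weights reproduce polynomials. -/
lemma LinearOnMoments.reproducing {E : (ℝ → ℝ) → ℝ} {K : ℝ → ℝ}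
    (hE : LinearOnMoments E K) {q : ℕ} {s : ℝ} (hdet : IsUnit (locGram E K q s).det)
    (j k : Fin (q + 1)) :
    E (fun v => locWeight E K q j s v * (v - s) ^ (k : ℕ)) = if j = k then 1 else 0 := by
  rw [hE.apply_locWeight_mul_pow]
  -- The sum is the `(j, k)` entry of the inverse Gram matrix times the Gram matrix.
  have h := congrFun (congrFun (Matrix.nonsing_inv_mul _ hdet) j) k
  rw [Matrix.mul_apply, Matrix.one_apply] at h
  exact h

/-! ### Finite weighted samples -/

/-- Finitely many points of equal weight. -/
structure Sample where
  idx : Finset ℕ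
  pt : ℕ → ℝ
  wt : ℝ

namespace Sample

variable (c : Sample)

/-- The weighted sum of the values at the sample points. -/
def avg (φ : ℝ → ℝ) : ℝ := c.wt * ∑ j ∈ c.idx, φ (c.pt j)

/-- The linear statistic with weights `A` at the sample points and outcomes `y`. -/
def lin (A : ℝ → ℝ) (y : ℕ → ℝ) : ℝ := c.wt * ∑ j ∈ c.idx, A (c.pt j) * y j

lemma avg_add (φ ψ : ℝ → ℝ) : c.avg (fun v => φ v + ψ v) = c.avg φ + c.avg ψ := by
  simp [avg, Finset.sum_add_distrib, mul_add]

lemma avg_sub (φ ψ : ℝ → ℝ) : c.avg (fun v => φ v - ψ v) = c.avg φ - c.avg ψ := by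
  simp [avg, mul_sub]

lemma avg_const_mul (a : ℝ) (φ : ℝ → ℝ) : c.avg (fun v => a * φ v) = a * c.avg φ := by
  simp only [avg, ← Finset.mul_sum]; ring

lemma avg_mul_const (a : ℝ) (φ : ℝ → ℝ) : c.avg (fun v => φ v * a) = c.avg φ * a := by
  simp only [avg, ← Finset.sum_mul]; ring

lemma avg_sum {ι : Type*} (t : Finset ι) (φ : ι → ℝ → ℝ) :
    c.avg (fun v => ∑ i ∈ t, φ i v) = ∑ i ∈ t, c.avg (φ i) := by
  simp only [avg, ← Finset.mul_sum]
  rw [Finset.sum_comm]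

lemma avg_comm (F : ℝ → ℝ → ℝ) :
    c.avg (fun s => c.avg (fun v => F s v)) = c.avg (fun v => c.avg (fun s => F s v)) := by
  simp only [avg, ← Finset.mul_sum]
  rw [Finset.sum_comm]

lemma avg_congr {φ ψ : ℝ → ℝ} (h : ∀ j ∈ c.idx, φ (c.pt j) = ψ (c.pt j)) :
    c.avg φ = c.avg ψ := by
  simp only [avg]; rw [Finset.sum_congr rfl h]

lemma linearOnMoments (K : ℝ → ℝ) : LinearOnMoments c.avg K := fun q k s b => by
  rw [avg_sum]; simp only [avg_const_mul]

/-- Expand `v ^ k` around `s`: centered moments of orders `1, …, p` vanish and order `0` contributes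
`s ^ k`. A further term survives only for `k = p + 1`, where the top centered moment is the bias
constant. -/
lemma avg_locWeight_mul_id_pow {K : ℝ → ℝ} {p : ℕ} {s : ℝ}
    (hdet : IsUnit (locGram c.avg K p s).det) {k : ℕ} (hk : k ≤ p + 1) :
    c.avg (fun v => locWeight c.avg K p 0 s v * v ^ k) =
      s ^ k + if k = p + 1 then locBias c.avg K p s else 0 := by
  have hexp : ∀ v : ℝ, locWeight c.avg K p 0 s v * v ^ k = ∑ i ∈ Finset.range (k + 1),
      (locWeight c.avg K p 0 s v * (v - s) ^ i) * (s ^ (k - i) * (k.choose i)) := by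
    intro v
    conv_lhs => rw [show v = (v - s) + s by ring, add_pow, Finset.mul_sum]
    refine Finset.sum_congr rfl fun i _ => ?_
    simp only [sub_add_cancel]
    ring
  simp only [hexp]
  rw [avg_sum]
  simp only [avg_mul_const]
  have h0 : ∀ i, i ≤ p → c.avg (fun v => locWeight c.avg K p 0 s v * (v - s) ^ i) =
      if i = 0 then 1 else 0 := by
    intro i hi
    have := (c.linearOnMoments K).reproducing hdet 0 ⟨i, Nat.lt_succ_of_le hi⟩
    simp only [Fin.ext_iff, Fin.val_zero] at this
    rw [this]
    simp [eq_comm]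
  rcases Nat.lt_or_ge p k with hkp | hkp
  · obtain rfl : k = p + 1 := by omega
    rw [Finset.sum_range_succ, Finset.sum_range_succ', Finset.sum_eq_zero]
    · rw [h0 0 (Nat.zero_le _)]
      simp [locBias]
    · intro i hi
      rw [h0 (i + 1) (by simp at hi; omega)]
      simp
  · rw [Finset.sum_range_succ', Finset.sum_eq_zero]
    · rw [h0 0 (Nat.zero_le _)]
      have : k ≠ p + 1 := by omega
      simp [this]
    · intro i hi
      rw [h0 (i + 1) (by simp at hi; omega)]
      simp

/-- The bootstrap-corrected weights reproduce polynomials up to one degree higher. -/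
lemma avg_locBoot_mul_pow {K : ℝ → ℝ} {p : ℕ}
    (h0 : IsUnit (locGram c.avg K p 0).det)
    (hdet : ∀ j ∈ c.idx, IsUnit (locGram c.avg K p (c.pt j)).det)
    (hs : locSmooth c.avg K p ≠ 0) {k : ℕ} (hk : k ≤ p + 1) :
    c.avg (fun v => locBoot c.avg K p v * v ^ k) = if k = 0 then 1 else 0 := by
  -- Averaging over `v` first turns the inner fit at `s` into `s ^ k` plus its bias constant; the
  -- outer fit then acts on both.
  have hconv : c.avg (fun v => locConv c.avg K p v * v ^ k) =
      c.avg (fun s => locWeight c.avg K p 0 0 s *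
        (s ^ k + if k = p + 1 then locBias c.avg K p s else 0)) := by
    calc _ = c.avg (fun v => c.avg (fun s =>
          locWeight c.avg K p 0 0 s * (locWeight c.avg K p 0 s v * v ^ k))) := by
          congr 1; funext v
          rw [locConv, ← avg_mul_const]
          congr 1; funext s; ring
      _ = c.avg (fun s => c.avg (fun v =>
          locWeight c.avg K p 0 0 s * (locWeight c.avg K p 0 s v * v ^ k))) := (c.avg_comm _).symm
      _ = _ := by
          apply c.avg_congr
          intro j hj
          rw [avg_const_mul, c.avg_locWeight_mul_id_pow (hdet j hj) hk]
  have hsplit : c.avg (fun v => locBoot c.avg K p v * v ^ k) =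
      c.avg (fun v => locWeight c.avg K p 0 0 v * v ^ k) -
        locBias c.avg K p 0 / locSmooth c.avg K p *
          (c.avg (fun v => locConv c.avg K p v * v ^ k) -
            c.avg (fun v => locWeight c.avg K p 0 0 v * v ^ k)) := by
    rw [← avg_sub, ← avg_const_mul, ← avg_sub]
    congr 1; funext v; rw [locBoot]; ring
  rw [hsplit, hconv]
  simp only [mul_add]
  rw [avg_add, c.avg_locWeight_mul_id_pow h0 hk]
  -- In degree `p + 1` the single fit gives `C` and the iterated one `C + C_LP`, so the correction
  -- is `(C / C_LP) C_LP = C`. In lower degrees the two fits agree.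
  by_cases hkp : k = p + 1
  · subst hkp
    simp only [if_true]
    rw [show c.avg (fun v => locWeight c.avg K p 0 0 v * locBias c.avg K p v) =
      locSmooth c.avg K p from rfl]
    simp
    field_simp
    ring
  · simp only [hkp, if_false, mul_zero, add_zero]
    have : c.avg (fun _ => (0 : ℝ)) = 0 := by simp [avg]
    rw [this]
    by_cases h : k = 0
    · simp [h]
    · simp [h]

/-- The derivative-corrected weights reproduce polynomials up to one degree higher. -/
lemma avg_locRBC_mul_pow {K : ℝ → ℝ} {p : ℕ}
    (h0 : IsUnit (locGram c.avg K p 0).det) (h1 : IsUnit (locGram c.avg K (p + 1) 0).det)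
    {k : ℕ} (hk : k ≤ p + 1) :
    c.avg (fun v => locRBC c.avg K p v * v ^ k) = if k = 0 then 1 else 0 := by
  have hsplit : c.avg (fun v => locRBC c.avg K p v * v ^ k) =
      c.avg (fun v => locWeight c.avg K p 0 0 v * v ^ k) - locBias c.avg K p 0 *
        c.avg (fun v => locWeight c.avg K (p + 1) (Fin.last (p + 1)) 0 v * v ^ k) := by
    rw [← avg_const_mul, ← avg_sub]
    congr 1; funext v; rw [locRBC]; ring
  -- The top coefficient of the fit of order `p + 1` is dual to `v ^ (p + 1)`: it kills lower powers
  -- and takes the value one there, so `C` times it removes exactly the bias `C`.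
  have h2 := (c.linearOnMoments K).reproducing h1 (Fin.last (p + 1)) ⟨k, by omega⟩
  simp only [sub_zero, Fin.ext_iff, Fin.val_last] at h2
  rw [hsplit, c.avg_locWeight_mul_id_pow h0 hk, h2]
  by_cases hkp : k = p + 1
  · subst hkp
    simp
  · simp only [hkp, Ne.symm hkp, if_false]
    by_cases h : k = 0 <;> simp [h]

end Sample

/-! ### One-sided designs as samples of scaled distances from the cutoff -/

open scoped Classical in
/-- The scaled distances `σ (x_i - x₀) / h` of the observations on the side of the design, up to
distance two. -/
def Design.sample (D : Design) (x₀ σ : ℝ) : Sample where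
  idx := (Finset.range D.size).filter fun i => D.regressor i ∈ D.side ∧ σ * D.scaled x₀ i < 2
  pt i := σ * D.scaled x₀ i
  wt := D.effSize⁻¹

/-- A positive bandwidth and an admissible kernel, with distances measured in the
direction of the sign `σ`. -/
structure Design.Oriented (D : Design) (σ : ℝ) : Prop where
  sign : σ = 1 ∨ σ = -1
  pos : 0 < D.bandwidth
  kernel : IsKernel D.kernel

namespace Design.Oriented

variable {D : Design} {x₀ σ : ℝ} (hD : D.Oriented σ)

include hD

lemma sq : σ * σ = 1 := by
  rcases hD.sign with h | h <;> simp [h]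

lemma scaled_eq (s : ℝ) (i : ℕ) :
    D.scaled (x₀ + σ * D.bandwidth * s) i = σ * ((D.sample x₀ σ).pt i - s) := by
  have h := hD.pos.ne'
  have h2 := hD.sq
  simp only [Design.scaled, Design.sample]
  rw [mul_sub, ← mul_assoc, h2]
  field_simp
  ring

lemma kernel_sign (u : ℝ) : D.kernel (σ * u) = D.kernel u := by
  rcases hD.sign with h | h <;> simp [h, hD.kernel.symm]

/-- For `s ≤ 1`, a point at distance two or more from the cutoff is at least one away from `s`,
where the kernel vanishes. Truncating the sample at two therefore loses nothing. -/
lemma sum_kernelAt {s : ℝ} (hs : s ≤ 1) (G : ℕ → ℝ) :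
    ∑ i ∈ Finset.range D.size, D.kernelAt (x₀ + σ * D.bandwidth * s) i * G i =
      ∑ i ∈ (D.sample x₀ σ).idx, D.kernel ((D.sample x₀ σ).pt i - s) * G i := by
  classical
  have hk : ∀ i, D.regressor i ∈ D.side → D.kernelAt (x₀ + σ * D.bandwidth * s) i =
      D.kernel ((D.sample x₀ σ).pt i - s) := by
    intro i hi
    rw [Design.kernelAt, Set.indicator_of_mem hi]
    have := hD.scaled_eq (x₀ := x₀) s i
    rw [Design.scaled] at this
    rw [this, hD.kernel_sign]
  symm
  have hsub : (D.sample x₀ σ).idx ⊆ Finset.range D.size := by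
    intro i hi
    simp only [Design.sample, Finset.mem_filter] at hi
    exact hi.1
  rw [← Finset.sum_subset hsub (f := fun i => D.kernelAt (x₀ + σ * D.bandwidth * s) i * G i)]
  · refine Finset.sum_congr rfl fun i hi => ?_
    rw [hk i]
    simp only [Design.sample, Finset.mem_filter] at hi
    exact hi.2.1
  · intro i hi hni
    by_cases hside : D.regressor i ∈ D.side
    · rw [hk i hside, hD.kernel.eq_zero, zero_mul]
      have : ¬ σ * D.scaled x₀ i < 2 := by
        intro hlt
        exact hni (by simp only [Design.sample, Finset.mem_filter]; exact ⟨hi, hside, hlt⟩)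
      simp only [Design.sample, Set.mem_Ioo, not_and, not_lt]
      intro _
      linarith
    · rw [Design.kernelAt, Set.indicator_of_notMem hside, zero_mul]

/-- Reflection multiplies the power of degree `a` by `σ ^ a`, so it conjugates the Gram matrix by a
diagonal sign matrix that is its own inverse. In the weights the signs cancel except for a factor `σ
^ j`. -/
lemma gram_eq {s : ℝ} (hs : s ≤ 1) (q : ℕ) :
    D.gram q (x₀ + σ * D.bandwidth * s) =
      Matrix.diagonal (fun a : Fin (q + 1) => σ ^ (a : ℕ)) *
        locGram (D.sample x₀ σ).avg D.kernel q s *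
        Matrix.diagonal (fun a : Fin (q + 1) => σ ^ (a : ℕ)) := by
  ext a b
  rw [Matrix.mul_diagonal, Matrix.diagonal_mul, Design.gram, Matrix.of_apply, hD.sum_kernelAt hs,
    locGram, Matrix.of_apply, Sample.avg]
  simp only [hD.scaled_eq]
  rw [show (D.sample x₀ σ).wt = D.effSize⁻¹ from rfl]
  simp only [mul_pow, pow_add]
  rw [Finset.mul_sum, Finset.mul_sum, Finset.mul_sum, Finset.sum_mul]
  refine Finset.sum_congr rfl fun i _ => ?_
  ring

lemma weight_eq {s : ℝ} (hs : s ≤ 1) (q : ℕ) (j : Fin (q + 1)) (i : ℕ) :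
    D.weight q j (x₀ + σ * D.bandwidth * s) i = D.kernelAt (x₀ + σ * D.bandwidth * s) i *
      (σ ^ (j : ℕ) * ((locGram (D.sample x₀ σ).avg D.kernel q s)⁻¹.mulVec
        (powers q ((D.sample x₀ σ).pt i - s)) j)) := by
  have hS : Matrix.diagonal (fun a : Fin (q + 1) => σ ^ (a : ℕ)) *
      Matrix.diagonal (fun a : Fin (q + 1) => σ ^ (a : ℕ)) = 1 := by
    rw [Matrix.diagonal_mul_diagonal]
    simp only [← mul_pow, hD.sq, one_pow, Matrix.diagonal_one]
  have hSinv := Matrix.inv_eq_right_inv hS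
  have hpow : powers q (D.scaled (x₀ + σ * D.bandwidth * s) i) =
      (Matrix.diagonal (fun a : Fin (q + 1) => σ ^ (a : ℕ))).mulVec
        (powers q ((D.sample x₀ σ).pt i - s)) := by
    ext a
    rw [Matrix.mulVec_diagonal, hD.scaled_eq, powers, powers, mul_pow]
  rw [Design.weight, hD.gram_eq hs, Matrix.mul_inv_rev, Matrix.mul_inv_rev, hSinv, hpow,
    Matrix.mulVec_mulVec, Matrix.mul_assoc, Matrix.mul_assoc, hS, Matrix.mul_one,
    ← Matrix.mulVec_mulVec, Matrix.mulVec_diagonal]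
  ring

lemma sum_weight {s : ℝ} (hs : s ≤ 1) (q : ℕ) (j : Fin (q + 1)) (G : ℕ → ℝ) :
    D.effSize⁻¹ * ∑ i ∈ Finset.range D.size, D.weight q j (x₀ + σ * D.bandwidth * s) i * G i =
      σ ^ (j : ℕ) * (D.sample x₀ σ).lin
        (locWeight (D.sample x₀ σ).avg D.kernel q j s) G := by
  simp only [hD.weight_eq hs]
  simp only [mul_assoc (D.kernelAt _ _)]
  rw [hD.sum_kernelAt hs, Sample.lin, show (D.sample x₀ σ).wt = D.effSize⁻¹ from rfl,
    mul_left_comm]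
  congr 1
  rw [Finset.mul_sum]
  refine Finset.sum_congr rfl fun i _ => ?_
  rw [locWeight]
  ring

lemma fit_eq {s : ℝ} (hs : s ≤ 1) (p : ℕ) (y : ℕ → ℝ) :
    D.fit p (x₀ + σ * D.bandwidth * s) y =
      (D.sample x₀ σ).lin (locWeight (D.sample x₀ σ).avg D.kernel p 0 s) y := by
  rw [Design.fit, Design.coef, hD.sum_weight hs]
  simp

/-- This is where oddness of `p` enters: `p + 1` is even, so reflection does not change the sign of
the power `p + 1`. -/
lemma biasConst_eq {p : ℕ} (hp : Odd p) {s : ℝ} (hs : s ≤ 1) :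
    D.biasConst p (x₀ + σ * D.bandwidth * s) =
      locBias (D.sample x₀ σ).avg D.kernel p s := by
  rw [Design.biasConst, hD.sum_weight hs, locBias, Sample.avg, Sample.lin]
  have : σ ^ (p + 1) = 1 := by
    obtain ⟨m, hm⟩ := (hp.add_odd odd_one)
    rw [hm, pow_add, ← mul_pow, hD.sq, one_pow]
  simp only [hD.scaled_eq, mul_pow, this]
  simp

lemma regressor_eq (i : ℕ) :
    D.regressor i = x₀ + σ * D.bandwidth * (D.sample x₀ σ).pt i := by
  have h := hD.pos.ne'
  have h2 := hD.sq
  simp only [Design.scaled, Design.sample]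
  rw [show σ * D.bandwidth * (σ * ((D.regressor i - x₀) / D.bandwidth)) =
    (σ * σ) * (D.bandwidth * ((D.regressor i - x₀) / D.bandwidth)) by ring, h2]
  field_simp
  ring

/-- Identities for fits at `s` are available only for `s ≤ 1`. That is enough here, because the
weight for the fit at the cutoff vanishes beyond distance one. -/
lemma sum_weight_zero (p : ℕ) (G : ℕ → ℝ) (G' : ℝ → ℝ)
    (hG : ∀ s : ℝ, s ≤ 1 → ∀ i, D.regressor i = x₀ + σ * D.bandwidth * s → G i = G' s) :
    D.effSize⁻¹ * ∑ i ∈ Finset.range D.size, D.weight p 0 x₀ i * G i =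
      (D.sample x₀ σ).avg
        (fun s => locWeight (D.sample x₀ σ).avg D.kernel p 0 0 s * G' s) := by
  have h := hD.sum_weight (x₀ := x₀) (s := 0) zero_le_one p 0 G
  simp only [mul_zero, add_zero, Fin.val_zero, pow_zero, one_mul] at h
  rw [h, Sample.lin, Sample.avg]
  congr 1
  refine Finset.sum_congr rfl fun i _ => ?_
  by_cases hi : (D.sample x₀ σ).pt i ≤ 1
  · rw [hG _ hi i (hD.regressor_eq i)]
  · have : locWeight (D.sample x₀ σ).avg D.kernel p 0 0 ((D.sample x₀ σ).pt i) = 0 := by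
      rw [locWeight, hD.kernel.eq_zero, mul_zero]
      rw [sub_zero]
      exact fun h => hi h.2.le
    rw [this]
    simp

lemma smoothedBiasConst_eq {p : ℕ} (hp : Odd p) :
    D.smoothedBiasConst p x₀ = locSmooth (D.sample x₀ σ).avg D.kernel p := by
  rw [Design.smoothedBiasConst, locSmooth]
  refine hD.sum_weight_zero p _ _ fun s hs i hi => ?_
  rw [hi, hD.biasConst_eq hp hs]

lemma scaling_eq {p : ℕ} (hp : Odd p) :
    D.scaling p x₀ = locBias (D.sample x₀ σ).avg D.kernel p 0 /
      locSmooth (D.sample x₀ σ).avg D.kernel p := by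
  have h := hD.biasConst_eq (x₀ := x₀) hp (s := 0) zero_le_one
  rw [mul_zero, add_zero] at h
  rw [Design.scaling, h, hD.smoothedBiasConst_eq hp]

/-- The fit at the cutoff to the fitted values. -/
lemma iterated_fit_eq (p : ℕ) (y : ℕ → ℝ) :
    D.effSize⁻¹ * ∑ i ∈ Finset.range D.size, D.weight p 0 x₀ i * D.fit p (D.regressor i) y =
      (D.sample x₀ σ).lin (locConv (D.sample x₀ σ).avg D.kernel p) y := by
  rw [hD.sum_weight_zero p _
    (fun s => (D.sample x₀ σ).lin (locWeight (D.sample x₀ σ).avg D.kernel p 0 s) y)]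
  · simp only [Sample.avg, Sample.lin, locConv, Finset.mul_sum, Finset.sum_mul]
    rw [Finset.sum_comm]
    refine Finset.sum_congr rfl fun i _ => Finset.sum_congr rfl fun j _ => ?_
    ring
  · intro s hs i hi
    rw [hi, hD.fit_eq hs]

/-- The fit corrected by the scaled bootstrap bias is linear in the outcomes. -/
lemma fit_sub_scaled_bias {p : ℕ} (hp : Odd p) (y : ℕ → ℝ) :
    D.fit p x₀ y - D.scaling p x₀ * (D.effSize⁻¹ * ∑ i ∈ Finset.range D.size,
        D.weight p 0 x₀ i * D.fit p (D.regressor i) y - D.fit p x₀ y) =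
      (D.sample x₀ σ).lin (locBoot (D.sample x₀ σ).avg D.kernel p) y := by
  have h := hD.fit_eq (x₀ := x₀) (s := 0) zero_le_one p y
  rw [mul_zero, add_zero] at h
  rw [h, hD.iterated_fit_eq, hD.scaling_eq hp]
  simp only [Sample.lin, locBoot, sub_mul, mul_assoc, Finset.sum_sub_distrib, ← Finset.mul_sum]
  ring

lemma rbcBias_eq {p : ℕ} (hp : Odd p) (y : ℕ → ℝ) :
    D.rbcBias p x₀ y = Real.sqrt D.effSize * (locBias (D.sample x₀ σ).avg D.kernel p 0 *
      (D.sample x₀ σ).lin (locWeight (D.sample x₀ σ).avg D.kernel (p + 1)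
        (Fin.last (p + 1)) 0) y) := by
  have h := hD.biasConst_eq (x₀ := x₀) hp (s := 0) zero_le_one
  have h2 := hD.sum_weight (x₀ := x₀) (s := 0) zero_le_one (p + 1) (Fin.last (p + 1)) y
  rw [mul_zero, add_zero] at h h2
  have hσ : σ ^ (p + 1) = 1 := by
    obtain ⟨m, hm⟩ := (hp.add_odd odd_one)
    rw [hm, pow_add, ← mul_pow, hD.sq, one_pow]
  -- The factor `h ^ (p + 1)` split off here cancels the `h ^ (-(p + 1))` of the derivative
  -- estimator.
  have hsq : Real.sqrt ((D.size : ℝ) * D.bandwidth ^ (2 * p + 3)) =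
      Real.sqrt D.effSize * D.bandwidth ^ (p + 1) := by
    rw [show (D.size : ℝ) * D.bandwidth ^ (2 * p + 3) =
      D.effSize * (D.bandwidth ^ (p + 1)) ^ 2 by rw [Design.effSize]; ring,
      Real.sqrt_mul (show 0 ≤ D.effSize from mul_nonneg (Nat.cast_nonneg _) hD.pos.le),
      Real.sqrt_sq (pow_nonneg hD.pos.le _)]
  have hf : ((p + 1).factorial : ℝ) ≠ 0 := by positivity
  have hb : D.bandwidth ^ (p + 1) ≠ 0 := pow_ne_zero _ hD.pos.ne'
  rw [Design.rbcBias, Design.derivEst, Design.coef, h, h2, hsq, Fin.val_last, hσ]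
  field_simp

/-- The fit corrected by the estimated derivative is linear in the outcomes. -/
lemma fit_sub_rbcBias {p : ℕ} (hp : Odd p) (y : ℕ → ℝ) :
    Real.sqrt D.effSize * D.fit p x₀ y - D.rbcBias p x₀ y =
      Real.sqrt D.effSize *
        (D.sample x₀ σ).lin (locRBC (D.sample x₀ σ).avg D.kernel p) y := by
  have h := hD.fit_eq (x₀ := x₀) (s := 0) zero_le_one p y
  rw [mul_zero, add_zero] at h
  rw [h, hD.rbcBias_eq hp]
  simp only [Sample.lin, locRBC, sub_mul, mul_assoc, Finset.sum_sub_distrib, ← Finset.mul_sum]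
  ring

end Design.Oriented

lemma Design.weight_eq_zero {D : Design} {i : ℕ} (hi : D.regressor i ∉ D.side) (q : ℕ)
    (j : Fin (q + 1)) (x : ℝ) : D.weight q j x i = 0 := by
  rw [Design.weight, Design.kernelAt, Set.indicator_of_notMem hi, mul_zero]

/-- The bootstrap expectation of the fit: the bootstrap errors average out. -/
lemma Design.integral_bootStat {Ω' : Type*} [MeasurableSpace Ω'] {P' : Measure Ω'}
    [IsProbabilityMeasure P'] {e : ℕ → Ω' → ℝ} (he : IsMultiplier P' e) (D : Design) (p : ℕ)
    (x : ℝ) (y b r : ℕ → ℝ) :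
    Integrable (fun ω' => D.bootStat p x y (fun i => b i + r i * e i ω')) P' ∧
    ∫ ω', D.bootStat p x y (fun i => b i + r i * e i ω') ∂P' = D.bootStat p x y b := by
  have hint : ∀ i, Integrable (e i) P' := fun i => (he.memLp i).integrable one_le_two
  have hterm : ∀ i, Integrable (fun ω' => D.weight p 0 x i * (b i + r i * e i ω')) P' :=
    fun i => ((integrable_const _).add ((hint i).const_mul _)).const_mul _
  have hsum : Integrable (fun ω' => ∑ i ∈ Finset.range D.size,
      D.weight p 0 x i * (b i + r i * e i ω')) P' :=
    integrable_finsetSum _ fun i _ => hterm i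
  have hval : ∫ ω', ∑ i ∈ Finset.range D.size, D.weight p 0 x i * (b i + r i * e i ω') ∂P' =
      ∑ i ∈ Finset.range D.size, D.weight p 0 x i * b i := by
    rw [integral_finsetSum _ fun i _ => hterm i]
    refine Finset.sum_congr rfl fun i _ => ?_
    rw [integral_const_mul, integral_add (integrable_const _) ((hint i).const_mul _),
      integral_const_mul, he.mean i]
    simp
  have hint2 := ((hsum.const_mul D.effSize⁻¹).const_mul (D.bandwidth ^ 0)⁻¹)
  refine ⟨?_, ?_⟩
  · exact (hint2.sub (integrable_const (D.fit p x y))).const_mul _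
  · simp only [Design.bootStat, Design.fit, Design.coef, Fin.val_zero]
    rw [integral_const_mul, integral_sub hint2 (integrable_const _), integral_const_mul,
      integral_const_mul, hval]
    simp

lemma rightDesign_oriented {K : ℝ → ℝ} (hK : IsKernel K) (x₀ : ℝ) {h : ℝ} (hh : 0 < h) (n : ℕ)
    (xs : ℕ → ℝ) : (rightDesign K x₀ h n xs).Oriented 1 where
  sign := Or.inl rfl
  pos := hh
  kernel := hK

lemma leftDesign_oriented {K : ℝ → ℝ} (hK : IsKernel K) (x₀ : ℝ) {h : ℝ} (hh : 0 < h) (n : ℕ)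
    (xs : ℕ → ℝ) : (leftDesign K x₀ h n xs).Oriented (-1) where
  sign := Or.inr rfl
  pos := hh
  kernel := hK

/-- Only observations on the side of the design carry weight, so the bootstrap centers across the
cutoff do not matter. -/
lemma Design.bootStat_eq {D : Design} {p : ℕ} {x : ℝ} {y b : ℕ → ℝ}
    (hb : ∀ i, D.regressor i ∈ D.side → b i = D.fit p (D.regressor i) y) :
    D.bootStat p x y b = Real.sqrt D.effSize * (D.effSize⁻¹ * ∑ i ∈ Finset.range D.size,
        D.weight p 0 x i * D.fit p (D.regressor i) y - D.fit p x y) := by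
  rw [Design.bootStat]
  congr 2
  rw [Design.fit, Design.coef, Fin.val_zero, pow_zero, inv_one, one_mul]
  congr 1
  refine Finset.sum_congr rfl fun i _ => ?_
  by_cases hi : D.regressor i ∈ D.side
  · rw [hb i hi]
  · rw [Design.weight_eq_zero hi, zero_mul, zero_mul]

variable {Kr Kl : ℝ → ℝ}

/-- The bootstrap-corrected statistic is linear in the outcomes. -/
lemma stat_sub_bootBias {Ω' : Type*} [MeasurableSpace Ω'] {P' : Measure Ω'}
    [IsProbabilityMeasure P'] {e : ℕ → Ω' → ℝ} (he : IsMultiplier P' e)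
    (hKr : IsKernel Kr) (hKl : IsKernel Kl) {p : ℕ} (hp : Odd p) (x₀ : ℝ) {h : ℝ} (hh : 0 < h)
    (τ : ℝ) (n : ℕ) (xs y r : ℕ → ℝ) :
    stat p Kr Kl x₀ h τ n xs y - bootBias P' e p Kr Kl x₀ h n xs y r =
      Real.sqrt (n * h) *
        (((rightDesign Kr x₀ h n xs).sample x₀ 1).lin
            (locBoot ((rightDesign Kr x₀ h n xs).sample x₀ 1).avg Kr p) y -
          ((leftDesign Kl x₀ h n xs).sample x₀ (-1)).lin
            (locBoot ((leftDesign Kl x₀ h n xs).sample x₀ (-1)).avg Kl p) y - τ) := by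
  have hr := (rightDesign_oriented hKr x₀ hh n xs).fit_sub_scaled_bias (x₀ := x₀) hp y
  have hl := (leftDesign_oriented hKl x₀ hh n xs).fit_sub_scaled_bias (x₀ := x₀) hp y
  rw [show (rightDesign Kr x₀ h n xs).kernel = Kr from rfl] at hr
  rw [show (leftDesign Kl x₀ h n xs).kernel = Kl from rfl] at hl
  rw [← hr, ← hl]
  -- The conditional mean of the bootstrap outcomes. At each regressor exactly one of the two
  -- indicators is active.
  set b : ℕ → ℝ := fun i =>
    (Set.Ici x₀).indicator (fun t => (rightDesign Kr x₀ h n xs).fit p t y) (xs i) +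
    (Set.Iio x₀).indicator (fun t => (leftDesign Kl x₀ h n xs).fit p t y) (xs i) with hbdef
  have hbr : ∀ i, (rightDesign Kr x₀ h n xs).regressor i ∈ (rightDesign Kr x₀ h n xs).side →
      b i = (rightDesign Kr x₀ h n xs).fit p ((rightDesign Kr x₀ h n xs).regressor i) y := by
    intro i hi
    have hi' : xs i ∈ Set.Ici x₀ := hi
    have hi2 : xs i ∉ Set.Iio x₀ := fun h' => absurd (Set.mem_Ici.1 hi') (not_le.2 h')
    simp only [hbdef]
    rw [Set.indicator_of_mem hi', Set.indicator_of_notMem hi2, add_zero]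
    rfl
  have hbl : ∀ i, (leftDesign Kl x₀ h n xs).regressor i ∈ (leftDesign Kl x₀ h n xs).side →
      b i = (leftDesign Kl x₀ h n xs).fit p ((leftDesign Kl x₀ h n xs).regressor i) y := by
    intro i hi
    have hi' : xs i ∈ Set.Iio x₀ := hi
    have hi2 : xs i ∉ Set.Ici x₀ := fun h' => absurd (Set.mem_Iio.1 hi') (not_lt.2 h')
    simp only [hbdef]
    rw [Set.indicator_of_mem hi', Set.indicator_of_notMem hi2, zero_add]
    rfl
  have hIr := Design.integral_bootStat he (rightDesign Kr x₀ h n xs) p x₀ y b r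
  have hIl := Design.integral_bootStat he (leftDesign Kl x₀ h n xs) p x₀ y b r
  have hboot : bootBias P' e p Kr Kl x₀ h n xs y r =
      (rightDesign Kr x₀ h n xs).scaling p x₀ * (rightDesign Kr x₀ h n xs).bootStat p x₀ y b -
      (leftDesign Kl x₀ h n xs).scaling p x₀ * (leftDesign Kl x₀ h n xs).bootStat p x₀ y b := by
    rw [← hIr.2, ← hIl.2, ← integral_const_mul, ← integral_const_mul,
      ← integral_sub (hIr.1.const_mul _) (hIl.1.const_mul _)]
    rfl
  rw [hboot, Design.bootStat_eq hbr, Design.bootStat_eq hbl, stat,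
    show (rightDesign Kr x₀ h n xs).effSize = n * h from rfl,
    show (leftDesign Kl x₀ h n xs).effSize = n * h from rfl]
  ring

/-- The statistic corrected by the derivative estimate is linear in the outcomes. -/
lemma stat_sub_rbcBias (hKr : IsKernel Kr) (hKl : IsKernel Kl) {p : ℕ} (hp : Odd p) (x₀ : ℝ)
    {h : ℝ} (hh : 0 < h) (τ : ℝ) (n : ℕ) (xs y : ℕ → ℝ) :
    stat p Kr Kl x₀ h τ n xs y - rbcBias p Kr Kl x₀ h n xs y =
      Real.sqrt (n * h) *
        (((rightDesign Kr x₀ h n xs).sample x₀ 1).lin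
            (locRBC ((rightDesign Kr x₀ h n xs).sample x₀ 1).avg Kr p) y -
          ((leftDesign Kl x₀ h n xs).sample x₀ (-1)).lin
            (locRBC ((leftDesign Kl x₀ h n xs).sample x₀ (-1)).avg Kl p) y - τ) := by
  have hr := (rightDesign_oriented hKr x₀ hh n xs).fit_sub_rbcBias (x₀ := x₀) hp y
  have hl := (leftDesign_oriented hKl x₀ hh n xs).fit_sub_rbcBias (x₀ := x₀) hp y
  rw [show (rightDesign Kr x₀ h n xs).kernel = Kr from rfl,
    show (rightDesign Kr x₀ h n xs).effSize = n * h from rfl] at hr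
  rw [show (leftDesign Kl x₀ h n xs).kernel = Kl from rfl,
    show (leftDesign Kl x₀ h n xs).effSize = n * h from rfl] at hl
  rw [stat, rbcBias]
  linear_combination hr - hl

/-! ### Uniform convergence of averages -/

/-- The limit `f ∫_0^2 φ` of the averages over a sample. -/
def avgLim (f : ℝ) (φ : ℝ → ℝ) : ℝ := f * ∫ v in (0 : ℝ)..2, φ v

/-- The cells of a partition of `[0, 2)`. -/
def cell (m k : ℕ) : Set ℝ := Set.Ico ((k : ℝ) * (2 / m)) (((k + 1 : ℕ) : ℝ) * (2 / m))

lemma cell_unique {m k l : ℕ} (hm : 0 < m) {v : ℝ} (hk : v ∈ cell m k) (hl : v ∈ cell m l) :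
    k = l := by
  have hδ : (0 : ℝ) < 2 / m := by positivity
  have h1 : ∀ {k l : ℕ}, v ∈ cell m k → v ∈ cell m l → k ≤ l := by
    intro k l hk hl
    have : (k : ℝ) * (2 / m) < ((l + 1 : ℕ) : ℝ) * (2 / m) := lt_of_le_of_lt hk.1 hl.2
    have := lt_of_mul_lt_mul_right this hδ.le
    exact Nat.lt_succ_iff.1 (by exact_mod_cast this)
  exact le_antisymm (h1 hk hl) (h1 hl hk)

lemma iUnion_cell {m : ℕ} (hm : 0 < m) :
    (⋃ k ∈ Finset.range m, cell m k) = Set.Ico (0 : ℝ) 2 := by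
  have hδ : (0 : ℝ) < 2 / m := by positivity
  have hm' : (m : ℝ) ≠ 0 := by positivity
  ext v
  simp only [Set.mem_iUnion, Finset.mem_range, exists_prop]
  constructor
  · rintro ⟨k, hk, h1, h2⟩
    refine ⟨le_trans (by positivity) h1, lt_of_lt_of_le h2 ?_⟩
    have : ((k + 1 : ℕ) : ℝ) ≤ m := by exact_mod_cast hk
    calc ((k + 1 : ℕ) : ℝ) * (2 / m) ≤ m * (2 / m) := by gcongr
      _ = 2 := by field_simp
  · rintro ⟨h0, h2⟩
    have hv : 0 ≤ v / (2 / m) := by positivity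
    refine ⟨⌊v / (2 / m)⌋₊, ?_, ?_, ?_⟩
    · rw [Nat.floor_lt hv, div_lt_iff₀ hδ]
      calc v < 2 := h2
        _ = m * (2 / m) := by field_simp
    · have := Nat.floor_le hv
      rwa [le_div_iff₀ hδ] at this
    · have := Nat.lt_floor_add_one (v / (2 / m))
      rw [div_lt_iff₀ hδ] at this
      exact_mod_cast this

lemma cell_subset {m k : ℕ} (hk : k < m) : cell m k ⊆ Set.Ico (0 : ℝ) 2 := by
  rw [← iUnion_cell (by omega : 0 < m)]
  exact Set.subset_biUnion_of_mem (u := fun k => cell m k) (Finset.mem_coe.2 (Finset.mem_range.2 hk))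

/-- A point lies in at most one cell. This bounds the total mass of the cells where an interval
endpoint spoils the oscillation bound. -/
lemma sum_cell_indicator_le {m : ℕ} (hm : 0 < m) (c : ℝ) {x : ℕ → ℝ} {X : ℝ} (hX : 0 ≤ X)
    (hx : ∀ k < m, x k ≤ X) :
    ∑ k ∈ Finset.range m, (cell m k).indicator (fun _ => x k) c ≤ X := by
  by_cases h : ∃ k < m, c ∈ cell m k
  · obtain ⟨k, hk, hc⟩ := h
    rw [Finset.sum_eq_single k]
    · rw [Set.indicator_of_mem hc]; exact hx k hk
    · intro l _ hl
      rw [Set.indicator_of_notMem]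
      exact fun h => hl (cell_unique hm h hc)
    · intro h; exact absurd (Finset.mem_range.2 hk) h
  · push Not at h
    rw [Finset.sum_eq_zero]
    · exact hX
    · intro k hk
      rw [Set.indicator_of_notMem (h k (Finset.mem_range.1 hk))]

/-- Comparison of an integral over `[0, 2)` with a Riemann sum, for an integrand that vanishes off
an interval and oscillates little in it. -/
lemma abs_setIntegral_sub_sum_le (ν : Measure ℝ) [IsFiniteMeasure ν] {m : ℕ} (hm : 0 < m)
    {φ : ℝ → ℝ} (hφ : Measurable φ) {B ε c d : ℝ} (hε : 0 ≤ ε)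
    (hB : ∀ v ∈ Set.Ico (0 : ℝ) 2, |φ v| ≤ B)
    (hzero : ∀ v, v ∉ Set.Ioo c d → φ v = 0)
    (hosc : ∀ v ∈ Set.Ico (0 : ℝ) 2, ∀ w ∈ Set.Ico (0 : ℝ) 2, v ∈ Set.Ioo c d → w ∈ Set.Ioo c d →
      |v - w| ≤ 2 / m → |φ v - φ w| ≤ ε)
    {X : ℝ} (hX : ∀ k < m, ν.real (cell m k) ≤ X) :
    |∫ v in Set.Ico (0 : ℝ) 2, φ v ∂ν -
      ∑ k ∈ Finset.range m, φ (k * (2 / m)) * ν.real (cell m k)| ≤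
      ε * ν.real (Set.Ico (0 : ℝ) 2) + 4 * B * X := by
  have hB0 : 0 ≤ B := le_trans (abs_nonneg _) (hB 0 (by simp))
  have hX0 : 0 ≤ X := le_trans measureReal_nonneg (hX 0 hm)
  have hmeas : ∀ k, MeasurableSet (cell m k) := fun k => measurableSet_Ico
  have hdisj : (↑(Finset.range m) : Set ℕ).PairwiseDisjoint (cell m) := by
    intro k _ l _ hkl
    refine Set.disjoint_left.2 fun v hv hv' => hkl (cell_unique hm hv hv')
  have hint : ∀ k < m, IntegrableOn φ (cell m k) ν := by
    intro k hk
    refine Measure.integrableOn_of_bounded (M := B) (measure_ne_top _ _)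
      hφ.aestronglyMeasurable ?_
    refine (ae_restrict_iff' (hmeas k)).2 (Eventually.of_forall fun v hv => ?_)
    exact hB v (cell_subset hk hv)
  have hsplit : ∫ v in Set.Ico (0 : ℝ) 2, φ v ∂ν =
      ∑ k ∈ Finset.range m, ∫ v in cell m k, φ v ∂ν := by
    rw [← iUnion_cell hm]
    exact integral_biUnion_finset _ (fun k _ => hmeas k) hdisj
      (fun k hk => hint k (Finset.mem_range.1 hk))
  have hmass : ν.real (Set.Ico (0 : ℝ) 2) = ∑ k ∈ Finset.range m, ν.real (cell m k) := by
    rw [← iUnion_cell hm]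
    exact measureReal_biUnion_finset hdisj fun k _ => hmeas k
  have hcell : ∀ k ∈ Finset.range m,
      |∫ v in cell m k, φ v ∂ν - φ (k * (2 / m)) * ν.real (cell m k)| ≤
      ε * ν.real (cell m k) + 2 * B * ((cell m k).indicator (fun _ => ν.real (cell m k)) c +
        (cell m k).indicator (fun _ => ν.real (cell m k)) d) := by
    intro k hk
    have hk := Finset.mem_range.1 hk
    have hleft : (k : ℝ) * (2 / m) ∈ cell m k := by
      refine ⟨le_rfl, ?_⟩
      have hδ : (0 : ℝ) < 2 / m := by positivity
      push_cast; nlinarith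
    set t : ℝ := (k : ℝ) * (2 / m) with ht
    have hdiff : ∫ v in cell m k, φ v ∂ν - φ t * ν.real (cell m k) =
        ∫ v in cell m k, (φ v - φ t) ∂ν := by
      rw [integral_sub (hint k hk) (integrable_const _), setIntegral_const, smul_eq_mul, mul_comm]
    rw [hdiff]
    -- A cell containing an endpoint allows only the crude bound `2B`, but there are at most two
    -- such cells. Every other cell lies wholly inside or wholly outside the interval.
    by_cases hcd : c ∈ cell m k ∨ d ∈ cell m k
    · have h1 : ‖∫ v in cell m k, (φ v - φ t) ∂ν‖ ≤ 2 * B * ν.real (cell m k) := by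
        refine norm_setIntegral_le_of_norm_le_const (measure_lt_top _ _) fun v hv => ?_
        calc ‖φ v - φ t‖ ≤ |φ v| + |φ t| := abs_sub _ _
          _ ≤ 2 * B := by linarith [hB v (cell_subset hk hv), hB t (cell_subset hk hleft)]
      rw [Real.norm_eq_abs] at h1
      have h2 : ν.real (cell m k) ≤ (cell m k).indicator (fun _ => ν.real (cell m k)) c +
          (cell m k).indicator (fun _ => ν.real (cell m k)) d := by
        have hn : ∀ x, 0 ≤ (cell m k).indicator (fun _ => ν.real (cell m k)) x := fun x =>
          Set.indicator_nonneg (fun _ _ => measureReal_nonneg) _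
        rcases hcd with h | h
        · rw [Set.indicator_of_mem h]; linarith [hn d]
        · rw [Set.indicator_of_mem h]; linarith [hn c]
      have h3 : 0 ≤ ε * ν.real (cell m k) := mul_nonneg hε measureReal_nonneg
      have h4 := mul_le_mul_of_nonneg_left h2 (by positivity : (0 : ℝ) ≤ 2 * B)
      linarith
    · push Not at hcd
      have h1 : ‖∫ v in cell m k, (φ v - φ t) ∂ν‖ ≤ ε * ν.real (cell m k) := by
        refine norm_setIntegral_le_of_norm_le_const (measure_lt_top _ _) fun v hv => ?_
        rw [Real.norm_eq_abs]
        have hdist : |v - t| ≤ 2 / m := by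
          rw [abs_le]
          have h1 := hv.1; have h2 := hv.2
          rw [← ht] at h1
          push_cast at h2
          constructor
          · have : (0 : ℝ) ≤ 2 / m := by positivity
            linarith
          · rw [ht]; linarith
        by_cases hvI : v ∈ Set.Ioo c d
        · by_cases htI : t ∈ Set.Ioo c d
          · exact hosc v (cell_subset hk hv) t (cell_subset hk hleft) hvI htI hdist
          · exfalso
            have htc : t ≤ c := by
              by_contra hlt
              exact htI ⟨not_le.1 hlt, lt_of_le_of_lt hv.1 hvI.2⟩
            exact hcd.1 ⟨htc, lt_trans hvI.1 hv.2⟩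
        · by_cases htI : t ∈ Set.Ioo c d
          · exfalso
            have hdv : d ≤ v := by
              by_contra hlt
              exact hvI ⟨lt_of_lt_of_le htI.1 hv.1, not_le.1 hlt⟩
            exact hcd.2 ⟨htI.2.le, lt_of_le_of_lt hdv hv.2⟩
          · rw [hzero v hvI, hzero t htI]; simpa using hε
      rw [Real.norm_eq_abs] at h1
      rw [Set.indicator_of_notMem hcd.1, Set.indicator_of_notMem hcd.2]
      linarith
  rw [hsplit, ← Finset.sum_sub_distrib]
  refine (Finset.abs_sum_le_sum_abs _ _).trans ((Finset.sum_le_sum hcell).trans ?_)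
  rw [Finset.sum_add_distrib, ← Finset.mul_sum, ← Finset.mul_sum, Finset.sum_add_distrib, ← hmass]
  have h1 := sum_cell_indicator_le hm c hX0 hX
  have h2 := sum_cell_indicator_le hm d hX0 hX
  have := mul_le_mul_of_nonneg_left (add_le_add h1 h2) (by positivity : (0 : ℝ) ≤ 2 * B)
  linarith

namespace Sample

/-- The discrete measure of a sample. -/
def meas (c : Sample) : Measure ℝ := ∑ j ∈ c.idx, ENNReal.ofReal c.wt • Measure.dirac (c.pt j)

instance (c : Sample) : IsFiniteMeasure c.meas := by
  refine ⟨?_⟩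
  rw [meas, Measure.finsetSum_apply]
  refine ENNReal.sum_lt_top.2 fun j _ => ?_
  simp

lemma integral_meas {c : Sample} (hc : 0 ≤ c.wt) (φ : ℝ → ℝ) : ∫ v, φ v ∂c.meas = c.avg φ := by
  rw [meas, integral_finsetSum_measure, avg, Finset.mul_sum]
  · refine Finset.sum_congr rfl fun j _ => ?_
    rw [integral_smul_measure, integral_dirac, ENNReal.toReal_ofReal hc, smul_eq_mul]
  · intro j _
    exact (integrable_dirac (by simp)).smul_measure ENNReal.ofReal_ne_top

lemma setIntegral_meas {c : Sample} (hc : 0 ≤ c.wt) {s : Set ℝ} (hs : MeasurableSet s)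
    (hpt : ∀ j ∈ c.idx, c.pt j ∈ s) (φ : ℝ → ℝ) : ∫ v in s, φ v ∂c.meas = c.avg φ := by
  rw [← integral_indicator hs, integral_meas hc]
  exact c.avg_congr fun j hj => Set.indicator_of_mem (hpt j hj) _

lemma measureReal_meas {c : Sample} (hc : 0 ≤ c.wt) {s : Set ℝ} (hs : MeasurableSet s) :
    c.meas.real s = c.avg (s.indicator fun _ => 1) := by
  rw [← integral_meas hc]
  exact (integral_indicator_one hs).symm

lemma abs_avg_le {c : Sample} (hc : 0 ≤ c.wt) {φ ψ : ℝ → ℝ}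
    (h : ∀ j ∈ c.idx, |φ (c.pt j)| ≤ ψ (c.pt j)) : |c.avg φ| ≤ c.avg ψ := by
  rw [avg, avg, abs_mul, abs_of_nonneg hc]
  exact mul_le_mul_of_nonneg_left
    ((Finset.abs_sum_le_sum_abs _ _).trans (Finset.sum_le_sum h)) hc

end Sample

variable {ι : Type*} {l : Filter ι} {c : ι → Sample} {f : ℝ}

/-- The averages over the samples approach `f` times Lebesgue measure on `[0, 2)`. -/
structure Approximates (l : Filter ι) (c : ι → Sample) (f : ℝ) : Prop where
  pos : 0 < f
  wt_nonneg : ∀ i, 0 ≤ (c i).wt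
  pt_mem : ∀ i, ∀ j ∈ (c i).idx, (c i).pt j ∈ Set.Ico (0 : ℝ) 2
  mass : ∀ a b : ℝ, 0 ≤ a → a < b → b ≤ 2 →
    Tendsto (fun i => (c i).avg ((Set.Ico a b).indicator fun _ => 1)) l (𝓝 (f * (b - a)))

namespace Approximates

variable (hc : Approximates l c f)

include hc

lemma tendsto_mass : Tendsto (fun i => (c i).avg fun _ => 1) l (𝓝 (f * 2)) := by
  have h := hc.mass 0 2 le_rfl two_pos le_rfl
  rw [sub_zero] at h
  refine h.congr fun i => (c i).avg_congr fun j hj => ?_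
  rw [Set.indicator_of_mem (hc.pt_mem i j hj)]

/-- Averages converge uniformly over a class of uniformly bounded functions, each of which
vanishes off an interval, that are uniformly equicontinuous on these intervals. -/
theorem tendstoUniformlyOn_avg {T : Type*} {S : Set T} {φ : T → ℝ → ℝ} {a b : T → ℝ} {B : ℝ}
    (hφ : ∀ τ ∈ S, Measurable (φ τ)) (hB : ∀ τ ∈ S, ∀ v ∈ Set.Ico (0 : ℝ) 2, |φ τ v| ≤ B)
    (hzero : ∀ τ ∈ S, ∀ v, v ∉ Set.Ioo (a τ) (b τ) → φ τ v = 0)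
    (huc : ∀ ε > 0, ∃ δ > 0, ∀ τ ∈ S, ∀ v ∈ Set.Ico (0 : ℝ) 2, ∀ w ∈ Set.Ico (0 : ℝ) 2,
      v ∈ Set.Ioo (a τ) (b τ) → w ∈ Set.Ioo (a τ) (b τ) → |v - w| ≤ δ → |φ τ v - φ τ w| ≤ ε) :
    TendstoUniformlyOn (fun i τ => (c i).avg (φ τ)) (fun τ => avgLim f (φ τ)) l S := by
  rw [Metric.tendstoUniformlyOn_iff]
  intro η hη
  rcases S.eq_empty_or_nonempty with rfl | ⟨τ₀, hτ₀⟩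
  · simp
  have hf := hc.pos
  have hB0 : 0 ≤ B := le_trans (abs_nonneg _) (hB τ₀ hτ₀ 0 (by simp))
  -- The oscillation errors of the sample and the limit add up to at most `ε (2f + 1) + ε (2f) = ε
  -- (4f + 1) = η / 2`. The other half of `η` is for the endpoint cells and the cell masses, at most
  -- `B (16f + 5) / m`.
  obtain ⟨δ, hδ, hosc⟩ := huc (η / (2 * (4 * f + 1))) (by positivity)
  set ε := η / (2 * (4 * f + 1)) with hεdef
  have hε : 0 ≤ ε := by positivity
  obtain ⟨m, hm⟩ := exists_nat_gt (max (2 / δ) (2 * (B * (16 * f + 5) + 1) / η))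
  have hm1 : 2 / δ < m := lt_of_le_of_lt (le_max_left _ _) hm
  have hm2 : 2 * (B * (16 * f + 5) + 1) / η < m := lt_of_le_of_lt (le_max_right _ _) hm
  have hmpos : (0 : ℝ) < m := lt_trans (by positivity) hm1
  have hm0 : 0 < m := by exact_mod_cast hmpos
  have hmesh : 2 / (m : ℝ) ≤ δ := by
    rw [div_lt_iff₀ hδ] at hm1
    rw [div_le_iff₀ hmpos]; linarith
  have hm1' : (1 : ℝ) ≤ m := by exact_mod_cast hm0
  -- Accuracy `1 / m²` per cell leaves an error of at most `B / m` after summing over `m` cells.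
  -- With `m` fixed, only finitely many limits are used.
  have hcells : ∀ᶠ i in l, ∀ k ∈ Finset.range m,
      |(c i).meas.real (cell m k) - f * (2 / m)| ≤ 1 / (m : ℝ) ^ 2 := by
    rw [Finset.eventually_all]
    intro k hk
    have hk' := Finset.mem_range.1 hk
    have h1 : ((k + 1 : ℕ) : ℝ) * (2 / m) ≤ 2 := by
      have : ((k + 1 : ℕ) : ℝ) ≤ m := by exact_mod_cast hk'
      calc ((k + 1 : ℕ) : ℝ) * (2 / m) ≤ m * (2 / m) := by gcongr
        _ = 2 := by field_simp
    have h2 := hc.mass ((k : ℝ) * (2 / m)) (((k + 1 : ℕ) : ℝ) * (2 / m)) (by positivity)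
      (by gcongr; simp) h1
    have h3 : f * (((k + 1 : ℕ) : ℝ) * (2 / m) - (k : ℝ) * (2 / m)) = f * (2 / m) := by
      push_cast; ring
    rw [h3] at h2
    have h4 := Metric.tendsto_nhds.1 h2 (1 / (m : ℝ) ^ 2) (by positivity)
    filter_upwards [h4] with i hi
    rw [cell, (c i).measureReal_meas (hc.wt_nonneg i) measurableSet_Ico]
    exact hi.le
  have hmass := (Metric.tendsto_nhds.1 hc.tendsto_mass 1 one_pos)
  filter_upwards [hcells, hmass] with i hi hmi τ hτ
  set ν₀ : Measure ℝ := ENNReal.ofReal f • volume.restrict (Set.Ico 0 2) with hν₀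
  have : IsFiniteMeasure ν₀ := by
    refine ⟨?_⟩
    simp [hν₀, ENNReal.mul_lt_top_iff]
  have hν₀int : ∫ v in Set.Ico (0 : ℝ) 2, φ τ v ∂ν₀ = avgLim f (φ τ) := by
    rw [hν₀, Measure.restrict_smul, Measure.restrict_restrict measurableSet_Ico, Set.inter_self,
      integral_smul_measure, ENNReal.toReal_ofReal hf.le, avgLim, smul_eq_mul,
      intervalIntegral.integral_of_le zero_le_two, integral_Ico_eq_integral_Ioc]
  have hν₀cell : ∀ k < m, ν₀.real (cell m k) = f * (2 / m) := by
    intro k hk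
    have hδ' : (0 : ℝ) ≤ 2 / m := by positivity
    rw [hν₀, measureReal_ennreal_smul_apply, ENNReal.toReal_ofReal hf.le,
      measureReal_restrict_apply (by exact measurableSet_Ico),
      Set.inter_eq_left.2 (cell_subset hk), cell,
      Real.volume_real_Ico_of_le]
    · push_cast; ring
    · push_cast; nlinarith
  have hν₀tot : ν₀.real (Set.Ico (0 : ℝ) 2) = f * 2 := by
    rw [hν₀, measureReal_ennreal_smul_apply, ENNReal.toReal_ofReal hf.le,
      measureReal_restrict_apply measurableSet_Ico, Set.inter_self,
      Real.volume_real_Ico_of_le zero_le_two, sub_zero]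
  have hosc' : ∀ v ∈ Set.Ico (0 : ℝ) 2, ∀ w ∈ Set.Ico (0 : ℝ) 2, v ∈ Set.Ioo (a τ) (b τ) →
      w ∈ Set.Ioo (a τ) (b τ) → |v - w| ≤ 2 / m → |φ τ v - φ τ w| ≤ ε :=
    fun v hv w hw h1 h2 h3 => hosc τ hτ v hv w hw h1 h2 (h3.trans hmesh)
  have hX : ∀ k < m, (c i).meas.real (cell m k) ≤ f * (2 / m) + 1 / (m : ℝ) ^ 2 := by
    intro k hk
    have := (abs_le.1 (hi k (Finset.mem_range.2 hk))).2
    linarith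
  -- The sample measure and `f` times Lebesgue measure are each compared with a Riemann sum at the
  -- same nodes; the two sums differ only in the cell masses.
  have e1 := abs_setIntegral_sub_sum_le (c i).meas hm0 (hφ τ hτ) hε (hB τ hτ) (hzero τ hτ) hosc' hX
  have e2 := abs_setIntegral_sub_sum_le ν₀ hm0 (hφ τ hτ) hε (hB τ hτ) (hzero τ hτ) hosc'
    (X := f * (2 / m)) (fun k hk => (hν₀cell k hk).le)
  rw [Sample.setIntegral_meas (hc.wt_nonneg i) measurableSet_Ico (hc.pt_mem i)] at e1
  rw [hν₀int, hν₀tot] at e2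
  have e3 : (c i).meas.real (Set.Ico (0 : ℝ) 2) ≤ f * 2 + 1 := by
    rw [(c i).measureReal_meas (hc.wt_nonneg i) measurableSet_Ico,
      (c i).avg_congr (ψ := fun _ => 1)
        (fun j hj => Set.indicator_of_mem (hc.pt_mem i j hj) _)]
    have := (abs_lt.1 hmi).2
    linarith
  have e4 : |∑ k ∈ Finset.range m, φ τ (k * (2 / m)) * (c i).meas.real (cell m k) -
      ∑ k ∈ Finset.range m, φ τ (k * (2 / m)) * ν₀.real (cell m k)| ≤ B / m := by
    rw [← Finset.sum_sub_distrib]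
    refine (Finset.abs_sum_le_sum_abs _ _).trans ?_
    have hle : ∀ k ∈ Finset.range m, |φ τ (k * (2 / m)) * (c i).meas.real (cell m k) -
        φ τ (k * (2 / m)) * ν₀.real (cell m k)| ≤ B * (1 / (m : ℝ) ^ 2) := by
      intro k hk
      have hk' := Finset.mem_range.1 hk
      rw [← mul_sub, abs_mul, hν₀cell k hk']
      refine mul_le_mul (hB τ hτ _ (cell_subset hk' ?_)) (hi k hk) (abs_nonneg _) hB0
      refine ⟨le_rfl, ?_⟩
      gcongr; simp
    refine (Finset.sum_le_sum hle).trans (le_of_eq ?_)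
    rw [Finset.sum_const, Finset.card_range, nsmul_eq_mul]
    field_simp
  rw [dist_comm, Real.dist_eq]
  have htri : |(c i).avg (φ τ) - avgLim f (φ τ)| ≤
      (ε * (c i).meas.real (Set.Ico (0 : ℝ) 2) + 4 * B * (f * (2 / m) + 1 / (m : ℝ) ^ 2)) +
      B / m + (ε * (f * 2) + 4 * B * (f * (2 / m))) := by
    rw [abs_le] at *
    constructor <;> linarith [e1.1, e1.2, e2.1, e2.2, e4.1, e4.2]
  have e5 : 1 / (m : ℝ) ^ 2 ≤ 1 / m := by
    apply one_div_le_one_div_of_le hmpos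
    nlinarith
  have e6 : 4 * B * (f * (2 / m) + 1 / (m : ℝ) ^ 2) ≤ 4 * B * (f * (2 / m) + 1 / m) := by gcongr
  have e7 : ε * (c i).meas.real (Set.Ico (0 : ℝ) 2) ≤ ε * (f * 2 + 1) := by gcongr
  have e8 : ε * (4 * f + 1) = η / 2 := by rw [hεdef]; field_simp
  have e9 : B * (16 * f + 5) / m < η / 2 := by
    rw [div_lt_iff₀ hη] at hm2
    rw [div_lt_iff₀ hmpos]
    linarith
  have e10 : 4 * B * (f * (2 / m) + 1 / m) + B / m + 4 * B * (f * (2 / m)) =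
    B * (16 * f + 5) / m := by field_simp; ring
  calc _ ≤ _ := htri
    _ ≤ ε * (4 * f + 1) + B * (16 * f + 5) / m := by rw [← e10]; linarith
    _ < η := by rw [e8]; linarith

/-- Averages converge uniformly over a compact family of functions that are continuous on an
interval and vanish elsewhere. -/
theorem tendstoUniformlyOn_avg_indicator {S : Set ℝ} (hS : IsCompact S) {Ψ : ℝ → ℝ → ℝ}
    {a b : ℝ → ℝ} (hΨ : ContinuousOn (fun q : ℝ × ℝ => Ψ q.1 q.2) (S ×ˢ Set.Icc 0 2))
    (hmeas : ∀ τ ∈ S, Measurable (Ψ τ)) :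
    TendstoUniformlyOn (fun i τ => (c i).avg ((Set.Ioo (a τ) (b τ)).indicator (Ψ τ)))
      (fun τ => avgLim f ((Set.Ioo (a τ) (b τ)).indicator (Ψ τ))) l S := by
  have hK : IsCompact (S ×ˢ Set.Icc (0 : ℝ) 2) := hS.prod isCompact_Icc
  obtain ⟨B, hB⟩ := hK.exists_bound_of_continuousOn hΨ
  have huc := hK.uniformContinuousOn_of_continuous hΨ
  refine hc.tendstoUniformlyOn_avg (a := a) (b := b) (B := |B|)
    (fun τ hτ => (hmeas τ hτ).indicator measurableSet_Ioo) ?_ ?_ ?_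
  · intro τ hτ v hv
    have h := hB (τ, v) ⟨hτ, Set.Ico_subset_Icc_self hv⟩
    rw [Real.norm_eq_abs] at h
    by_cases hvI : v ∈ Set.Ioo (a τ) (b τ)
    · rw [Set.indicator_of_mem hvI]; exact h.trans (le_abs_self _)
    · rw [Set.indicator_of_notMem hvI, abs_zero]; exact abs_nonneg _
  · intro τ _ v hv
    exact Set.indicator_of_notMem hv _
  · intro ε hε
    obtain ⟨δ, hδ, h⟩ := Metric.uniformContinuousOn_iff.1 huc ε hε
    refine ⟨δ / 2, half_pos hδ, fun τ hτ v hv w hw hvI hwI hvw => ?_⟩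
    rw [Set.indicator_of_mem hvI, Set.indicator_of_mem hwI]
    have := h (τ, v) ⟨hτ, Set.Ico_subset_Icc_self hv⟩ (τ, w) ⟨hτ, Set.Ico_subset_Icc_self hw⟩ (by
      rw [Prod.dist_eq, dist_self, Real.dist_eq]
      exact max_lt hδ (by linarith))
    rw [Real.dist_eq] at this
    exact this.le

end Approximates

/-! ### Kernels and their moments -/

namespace IsKernel

variable {K : ℝ → ℝ} (hK : IsKernel K)

include hK

/-- The kernel may jump at `±1`. Written as an indicator times a continuous function, it falls
within the class for which averages converge uniformly. -/
lemma exists_continuous_extension :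
    ∃ k : ℝ → ℝ, Continuous k ∧ K = (Set.Ioo (-1 : ℝ) 1).indicator k := by
  obtain ⟨L, hL⟩ := hK.lipschitz
  obtain ⟨g, hg, hgK⟩ := hL.extend_real
  refine ⟨g, hg.continuous, ?_⟩
  ext u
  by_cases hu : u ∈ Set.Ioo (-1 : ℝ) 1
  · rw [Set.indicator_of_mem hu, hgK hu]
  · rw [Set.indicator_of_notMem hu, hK.eq_zero u hu]

lemma measurable : Measurable K := by
  obtain ⟨k, hk, rfl⟩ := hK.exists_continuous_extension
  exact hk.measurable.indicator measurableSet_Ioo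

lemma nonneg (u : ℝ) : 0 ≤ K u := by
  by_cases hu : u ∈ Set.Ioo (-1 : ℝ) 1
  · exact (hK.pos u hu).le
  · rw [hK.eq_zero u hu]

lemma exists_bound : ∃ B : ℝ, 0 ≤ B ∧ ∀ u, |K u| ≤ B := by
  obtain ⟨k, hk, hKk⟩ := hK.exists_continuous_extension
  obtain ⟨B, hB⟩ := isCompact_Icc.exists_bound_of_continuousOn
    (hk.continuousOn (s := Set.Icc (-1 : ℝ) 1))
  refine ⟨|B|, abs_nonneg _, fun u => ?_⟩
  rw [hKk]
  by_cases hu : u ∈ Set.Ioo (-1 : ℝ) 1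
  · rw [Set.indicator_of_mem hu]
    exact (hB u (Set.Ioo_subset_Icc_self hu)).trans (le_abs_self _)
  · rw [Set.indicator_of_notMem hu, abs_zero]; exact abs_nonneg _

lemma intervalIntegrable_moment (k : ℕ) (a b : ℝ) :
    IntervalIntegrable (fun u => K u * u ^ k) volume a b := by
  obtain ⟨B, hB0, hB⟩ := hK.exists_bound
  have h1 : IntervalIntegrable K volume a b := by
    rw [intervalIntegrable_iff]
    exact Measure.integrableOn_of_bounded (M := B) measure_Ioc_lt_top.ne
      hK.measurable.aestronglyMeasurable (Eventually.of_forall hB)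
  exact h1.mul_continuousOn (by fun_prop)

lemma intervalIntegrable_shifted (s : ℝ) (k : ℕ) (a b : ℝ) :
    IntervalIntegrable (fun v => K (v - s) * (v - s) ^ k) volume a b := by
  have := (hK.intervalIntegrable_moment k (a - s) (b - s)).comp_sub_right s
  simpa using this

omit hK in
lemma avgLim_moment (f s : ℝ) (k : ℕ) :
    avgLim f (fun v => K (v - s) * (v - s) ^ k) = f * ∫ u in (-s)..(2 - s), K u * u ^ k := by
  rw [avgLim, intervalIntegral.integral_comp_sub_right (fun u => K u * u ^ k) s, zero_sub]

/-- After a substitution, `s` enters only through the limits of integration, so jumps of the kernel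
do no harm. -/
lemma continuous_avgLim_moment (f : ℝ) (k : ℕ) :
    Continuous fun s => avgLim f (fun v => K (v - s) * (v - s) ^ k) := by
  simp only [avgLim_moment]
  have h := intervalIntegral.continuous_primitive (fun a b => hK.intervalIntegrable_moment k a b) 0
  have heq : ∀ s : ℝ, ∫ u in (-s)..(2 - s), K u * u ^ k =
      (∫ u in (0 : ℝ)..(2 - s), K u * u ^ k) - ∫ u in (0 : ℝ)..(-s), K u * u ^ k := fun s =>
    (intervalIntegral.integral_interval_sub_left (hK.intervalIntegrable_moment k _ _)
      (hK.intervalIntegrable_moment k _ _)).symm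
  simp only [heq]
  exact continuous_const.mul ((h.comp (by fun_prop)).sub (h.comp (by fun_prop)))

lemma linearOnMoments_avgLim (f : ℝ) : LinearOnMoments (avgLim f) K := by
  intro q k s b
  simp only [avgLim]
  rw [intervalIntegral.integral_finsetSum]
  · rw [Finset.mul_sum]
    refine Finset.sum_congr rfl fun i _ => ?_
    rw [intervalIntegral.integral_const_mul]
    ring
  · intro i _
    exact (hK.intervalIntegrable_shifted s _ 0 2).const_mul _

/-- The limiting Gram matrices are nonsingular. -/
lemma det_locGram_ne_zero {f : ℝ} (hf : 0 < f) (q : ℕ) {s : ℝ} (hs : s ∈ Set.Icc (0 : ℝ) 2) :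
    (locGram (avgLim f) K q s).det ≠ 0 := by
  intro hdet
  obtain ⟨b, hb0, hb⟩ := Matrix.exists_mulVec_eq_zero_iff.2 hdet
  -- A null vector of the Gram matrix gives a nonzero polynomial `P` with `∫ K(v - s) P(v - s)² dv =
  -- 0`. This is impossible, as `P` has finitely many roots and the kernel is positive on an
  -- interval.
  set P : Polynomial ℝ := ∑ a : Fin (q + 1), Polynomial.C (b a) * Polynomial.X ^ (a : ℕ) with hP
  have hPeval : ∀ u, P.eval u = ∑ a : Fin (q + 1), b a * u ^ (a : ℕ) := by
    intro u; simp [hP, Polynomial.eval_finsetSum]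
  have hPne : P ≠ 0 := by
    intro h
    apply hb0
    ext a
    have h1 : P.coeff (a : ℕ) = b a := by
      rw [hP, Polynomial.finsetSum_coeff, Finset.sum_eq_single a]
      · simp
      · intro c _ hca
        rw [Polynomial.coeff_C_mul_X_pow, if_neg]
        exact fun h => hca (Fin.ext h.symm)
      · simp
    rw [← h1, h]; simp
  have hint : IntervalIntegrable (fun v => K (v - s) * P.eval (v - s) ^ 2) volume 0 2 := by
    have h1 := hK.intervalIntegrable_shifted s 0 0 2
    simp only [pow_zero, mul_one] at h1
    exact h1.mul_continuousOn (by fun_prop)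
  have hquad : ∫ v in (0 : ℝ)..2, K (v - s) * P.eval (v - s) ^ 2 = 0 := by
    have h1 : ∀ v, K (v - s) * P.eval (v - s) ^ 2 =
        ∑ a : Fin (q + 1), ∑ c : Fin (q + 1), (b a * b c) *
          (K (v - s) * (v - s) ^ ((a : ℕ) + (c : ℕ))) := by
      intro v
      rw [hPeval, sq, Finset.sum_mul_sum, Finset.mul_sum]
      refine Finset.sum_congr rfl fun a _ => ?_
      rw [Finset.mul_sum]
      refine Finset.sum_congr rfl fun c _ => ?_
      ring
    have h2 : ∀ a c : Fin (q + 1), IntervalIntegrable (fun v => (b a * b c) *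
        (K (v - s) * (v - s) ^ ((a : ℕ) + (c : ℕ)))) volume 0 2 := fun a c =>
      (hK.intervalIntegrable_shifted s _ 0 2).const_mul _
    have h3 : f * ∫ v in (0 : ℝ)..2, K (v - s) * P.eval (v - s) ^ 2 =
        ∑ a : Fin (q + 1), b a * (locGram (avgLim f) K q s).mulVec b a := by
      simp only [h1]
      rw [intervalIntegral.integral_finsetSum, Finset.mul_sum]
      · refine Finset.sum_congr rfl fun a _ => ?_
        rw [intervalIntegral.integral_finsetSum, Matrix.mulVec, dotProduct, Finset.mul_sum,
          Finset.mul_sum]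
        · refine Finset.sum_congr rfl fun c _ => ?_
          rw [intervalIntegral.integral_const_mul, locGram, Matrix.of_apply, avgLim]
          ring
        · intro c _; exact h2 a c
      · intro a _
        have : IntervalIntegrable (∑ c : Fin (q + 1), fun v : ℝ => (b a * b c) *
            (K (v - s) * (v - s) ^ ((a : ℕ) + (c : ℕ)))) volume 0 2 :=
          IntervalIntegrable.sum _ fun c _ => h2 a c
        simpa only [Finset.sum_fn] using this
    rw [hb] at h3
    simpa [hf.ne'] using h3
  rw [intervalIntegral.integral_of_le zero_le_two] at hquad
  rw [intervalIntegrable_iff_integrableOn_Ioc_of_le zero_le_two] at hint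
  have hnn : 0 ≤ᵐ[volume.restrict (Set.Ioc (0 : ℝ) 2)] fun v => K (v - s) * P.eval (v - s) ^ 2 :=
    Eventually.of_forall fun v => mul_nonneg (hK.nonneg _) (sq_nonneg _)
  have hae := (setIntegral_eq_zero_iff_of_nonneg_ae hnn hint).1 hquad
  have hae2 := (ae_restrict_iff' measurableSet_Ioc).1 hae
  have hroots : ∀ᵐ v : ℝ, P.eval (v - s) ≠ 0 := by
    have hfin : (P.roots.toFinset : Set ℝ).Finite := Finset.finite_toSet _
    have hfin2 : ((fun v => v - s) ⁻¹' (P.roots.toFinset : Set ℝ)).Finite :=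
      hfin.preimage (sub_left_injective.injOn)
    rw [ae_iff]
    refine measure_mono_null (fun v hv => ?_) (hfin2.measure_zero volume)
    simp only [ne_eq, Set.mem_ofPred_eq, not_not] at hv
    simp [hPne, hv]
  -- On this interval the kernel at `s` is positive inside the window. It is nonempty because `s`
  -- lies in `[0, 2]`.
  have hnull : volume (Set.Ioo (max 0 (s - 1)) (min 2 (s + 1))) = 0 := by
    refine measure_mono_null (t := {v | ¬ (((v ∈ Set.Ioc (0 : ℝ) 2) →
      K (v - s) * P.eval (v - s) ^ 2 = 0) ∧ P.eval (v - s) ≠ 0)}) (fun v hv => ?_) ?_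
    · simp only [Set.mem_Ioo, max_lt_iff, lt_min_iff] at hv
      simp only [Set.mem_ofPred_eq]
      rintro ⟨h1, h2⟩
      have h3 := h1 ⟨hv.1.1, hv.2.1.le⟩
      have h4 := hK.pos (v - s) ⟨by linarith, by linarith⟩
      exact (mul_pos h4 (by positivity)).ne' h3
    · exact ae_iff.1 (hae2.and hroots)
  rw [Real.volume_Ioo, ENNReal.ofReal_eq_zero] at hnull
  have : max 0 (s - 1) < min 2 (s + 1) := by
    rw [max_lt_iff, lt_min_iff, lt_min_iff]
    refine ⟨⟨two_pos, by linarith [hs.1]⟩, by linarith [hs.2], by linarith⟩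
  linarith

end IsKernel

/-! ### Uniform convergence of Gram matrices and weights -/

/-- Continuity at each point of a compact set is uniform for pairs with one point in the set and the
other merely close to it. Hence `F` need not take values in `C`, and `Φ` may be matrix inversion,
which is continuous only at nonsingular matrices. -/
lemma tendstoUniformlyOn_comp {ι T α β : Type*} [UniformSpace α] [UniformSpace β]
    {l : Filter ι} {F : ι → T → α} {G : T → α} {S : Set T} {C : Set α}
    (h : TendstoUniformlyOn F G l S) (hG : ∀ τ ∈ S, G τ ∈ C) (hC : IsCompact C) {Φ : α → β}
    (hΦ : ∀ a ∈ C, ContinuousAt Φ a) :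
    TendstoUniformlyOn (fun i τ => Φ (F i τ)) (fun τ => Φ (G τ)) l S := by
  intro r hr
  filter_upwards [h _ (hC.uniformContinuousAt_of_continuousAt Φ hΦ hr)] with i hi τ hτ
  exact hi τ hτ (hG τ hτ)

lemma tendstoUniformlyOn_mul {ι T : Type*} {l : Filter ι} {F F' : ι → T → ℝ} {G G' : T → ℝ}
    {S : Set T} {B B' : ℝ} (h : TendstoUniformlyOn F G l S) (h' : TendstoUniformlyOn F' G' l S)
    (hB : ∀ τ ∈ S, |G τ| ≤ B) (hB' : ∀ τ ∈ S, |G' τ| ≤ B') :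
    TendstoUniformlyOn (fun i τ => F i τ * F' i τ) (fun τ => G τ * G' τ) l S := by
  have h2 : TendstoUniformlyOn (fun i τ => (F i τ, F' i τ)) (fun τ => (G τ, G' τ)) l S := by
    rw [tendstoUniformlyOn_iff_tendsto] at *
    have := h.prodMk h'
    rw [uniformity_prod_eq_comap_prod, tendsto_comap_iff]
    exact this
  refine tendstoUniformlyOn_comp (C := Set.Icc (-B) B ×ˢ Set.Icc (-B') B') h2 ?_
    (isCompact_Icc.prod isCompact_Icc) (Φ := fun q : ℝ × ℝ => q.1 * q.2) (fun _ _ => by fun_prop)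
  intro τ hτ
  exact ⟨abs_le.1 (hB τ hτ), abs_le.1 (hB' τ hτ)⟩

lemma tendstoUniformlyOn_refl {ι T : Type*} (l : Filter ι) (G : T → ℝ) (S : Set T) :
    TendstoUniformlyOn (fun _ : ι => G) G l S := fun _ hr =>
  Eventually.of_forall fun _ _ _ => refl_mem_uniformity hr

lemma tendstoUniformlyOn_finsetSum {ι T κ : Type*} {l : Filter ι} {S : Set T} (t : Finset κ)
    {F : κ → ι → T → ℝ} {G : κ → T → ℝ} (h : ∀ k ∈ t, TendstoUniformlyOn (F k) (G k) l S) :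
    TendstoUniformlyOn (fun i τ => ∑ k ∈ t, F k i τ) (fun τ => ∑ k ∈ t, G k τ) l S := by
  classical
  induction t using Finset.induction_on with
  | empty => simpa using tendstoUniformlyOn_refl l (fun _ => (0 : ℝ)) S
  | insert a t ha ih =>
    simp only [Finset.sum_insert ha]
    exact (h a (Finset.mem_insert_self _ _)).add
      (ih fun k hk => h k (Finset.mem_insert_of_mem hk))

lemma tendstoUniformlyOn_matrix {ι T m n : Type*} [Fintype m] [Fintype n] {l : Filter ι}
    {S : Set T} {F : ι → T → Matrix m n ℝ} {G : T → Matrix m n ℝ}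
    (h : ∀ a b, TendstoUniformlyOn (fun i τ => F i τ a b) (fun τ => G τ a b) l S) :
    TendstoUniformlyOn F G l S := by
  rw [tendstoUniformlyOn_iff_tendsto, Matrix.uniformity, tendsto_iInf]
  intro a
  rw [tendsto_iInf]
  intro b
  rw [tendsto_comap_iff]
  exact tendstoUniformlyOn_iff_tendsto.1 (h a b)

/-! ### Measurability of the local polynomial functionals -/

section Measurability

variable {α : Type*} [MeasurableSpace α]

lemma measurable_det {n : Type*} [Fintype n] [DecidableEq n] {M : α → Matrix n n ℝ}
    (hM : ∀ a b, Measurable fun x => M x a b) : Measurable fun x => (M x).det := by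
  simp only [Matrix.det_apply]
  refine Finset.measurable_sum _ fun σ _ => ?_
  exact (Finset.measurable_prod _ fun i _ => hM _ _).const_smul _

/-- Cramer's formula. No invertibility is needed, because the inverse of a real number, with value
zero at zero, is measurable everywhere. -/
lemma measurable_matrix_inv {n : Type*} [Fintype n] [DecidableEq n] {M : α → Matrix n n ℝ}
    (hM : ∀ a b, Measurable fun x => M x a b) (a b : n) : Measurable fun x => (M x)⁻¹ a b := by
  simp only [Matrix.inv_def, Matrix.smul_apply, smul_eq_mul, Ring.inverse_eq_inv',
    Matrix.adjugate_apply]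
  refine (measurable_det hM).inv.mul (measurable_det fun i j => ?_)
  simp only [Matrix.updateRow_apply]
  by_cases h : i = b
  · simp [h]
  · simpa [h] using hM i j

/-- Averages of jointly measurable families are measurable. -/
def MeasurableAvg (E : α → (ℝ → ℝ) → ℝ) : Prop :=
  ∀ F : α × ℝ → ℝ → ℝ, Measurable (fun q : (α × ℝ) × ℝ => F q.1 q.2) →
    Measurable fun q : α × ℝ => E q.1 (F q)

variable {E : α → (ℝ → ℝ) → ℝ} (hE : MeasurableAvg E) {K : ℝ → ℝ} (hK : Measurable K)

include hE hK

lemma MeasurableAvg.locWeight (q : ℕ) (j : Fin (q + 1)) :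
    Measurable fun z : (α × ℝ) × ℝ => locWeight (E z.1.1) K q j z.1.2 z.2 := by
  have hgram : ∀ a b, Measurable fun z : α × ℝ => locGram (E z.1) K q z.2 a b := by
    intro a b
    exact hE (fun z v => K (v - z.2) * (v - z.2) ^ ((a : ℕ) + (b : ℕ)))
      ((hK.comp (by fun_prop)).mul (by fun_prop))
  have hinv := measurable_matrix_inv hgram
  simp only [RDD.locWeight, Matrix.mulVec, dotProduct, powers]
  refine (Finset.measurable_sum _ fun b _ => ?_).mul (hK.comp (by fun_prop))
  exact ((hinv j b).comp measurable_fst).mul (by fun_prop)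

lemma MeasurableAvg.locBias (p : ℕ) :
    Measurable fun z : α × ℝ => locBias (E z.1) K p z.2 :=
  hE (fun z v => RDD.locWeight (E z.1) K p 0 z.2 v * (v - z.2) ^ (p + 1))
    ((hE.locWeight hK p 0).mul (by fun_prop))

lemma MeasurableAvg.locSmooth (p : ℕ) : Measurable fun z : α => locSmooth (E z) K p := by
  have h := hE (fun z s => RDD.locWeight (E z.1) K p 0 0 s * RDD.locBias (E z.1) K p s)
    (((hE.locWeight hK p 0).comp
      (f := fun z : (α × ℝ) × ℝ => ((z.1.1, (0 : ℝ)), z.2)) (by fun_prop)).mul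
      ((hE.locBias hK p).comp (f := fun z : (α × ℝ) × ℝ => (z.1.1, z.2)) (by fun_prop)))
  exact h.comp (f := fun z => (z, (0 : ℝ))) (by fun_prop)

lemma MeasurableAvg.locConv (p : ℕ) :
    Measurable fun z : α × ℝ => locConv (E z.1) K p z.2 :=
  hE (fun z s => RDD.locWeight (E z.1) K p 0 0 s * RDD.locWeight (E z.1) K p 0 s z.2)
    (((hE.locWeight hK p 0).comp
      (f := fun z : (α × ℝ) × ℝ => ((z.1.1, (0 : ℝ)), z.2)) (by fun_prop)).mul
      ((hE.locWeight hK p 0).comp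
        (f := fun z : (α × ℝ) × ℝ => ((z.1.1, z.2), z.1.2)) (by fun_prop)))

lemma MeasurableAvg.locWeight_zero (q : ℕ) (j : Fin (q + 1)) :
    Measurable fun z : α × ℝ => RDD.locWeight (E z.1) K q j 0 z.2 :=
  (hE.locWeight hK q j).comp (f := fun z : α × ℝ => ((z.1, (0 : ℝ)), z.2)) (by fun_prop)

lemma MeasurableAvg.locBias_zero (p : ℕ) :
    Measurable fun z : α × ℝ => RDD.locBias (E z.1) K p 0 :=
  (hE.locBias hK p).comp (f := fun z : α × ℝ => (z.1, (0 : ℝ))) (by fun_prop)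

lemma MeasurableAvg.locBoot (p : ℕ) :
    Measurable fun z : α × ℝ => locBoot (E z.1) K p z.2 :=
  (hE.locWeight_zero hK p 0).sub (((hE.locBias_zero hK p).div
    ((hE.locSmooth hK p).comp measurable_fst)).mul
    ((hE.locConv hK p).sub (hE.locWeight_zero hK p 0)))

lemma MeasurableAvg.locRBC (p : ℕ) :
    Measurable fun z : α × ℝ => locRBC (E z.1) K p z.2 :=
  (hE.locWeight_zero hK p 0).sub
    ((hE.locBias_zero hK p).mul (hE.locWeight_zero hK (p + 1) (Fin.last (p + 1))))

omit hE hK in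
lemma measurableAvg_avgLim (f : ℝ) : MeasurableAvg fun _ : Unit => avgLim f := by
  intro F hF
  simp only [avgLim, intervalIntegral.integral_of_le zero_le_two]
  exact (hF.stronglyMeasurable.integral_prod_right
    (ν := volume.restrict (Set.Ioc (0 : ℝ) 2))).measurable.const_mul f

end Measurability

/-! ### The limiting weights are continuous or bounded -/

namespace IsKernel

variable {K : ℝ → ℝ} (hK : IsKernel K) {f : ℝ} (hf : 0 < f)

include hK

lemma continuous_locGram (f : ℝ) (q : ℕ) : Continuous fun s => locGram (avgLim f) K q s :=
  continuous_matrix fun _ _ => hK.continuous_avgLim_moment f _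

include hf

lemma continuousAt_inv (q : ℕ) {s : ℝ} (hs : s ∈ Set.Icc (0 : ℝ) 2) :
    ContinuousAt (fun M : Matrix (Fin (q + 1)) (Fin (q + 1)) ℝ => M⁻¹)
      (locGram (avgLim f) K q s) := by
  refine continuousAt_matrix_inv _ ?_
  have := hK.det_locGram_ne_zero hf q hs
  rw [Ring.inverse_eq_inv']
  exact continuousAt_inv₀ this

lemma continuousOn_inv (q : ℕ) (a b : Fin (q + 1)) :
    ContinuousOn (fun s => (locGram (avgLim f) K q s)⁻¹ a b) (Set.Icc 0 2) := fun s hs => by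
  have h := (hK.continuousAt_inv hf q hs).comp (f := fun s => locGram (avgLim f) K q s)
    (hK.continuous_locGram f q).continuousAt
  have h2 : ContinuousAt (fun M : Matrix (Fin (q + 1)) (Fin (q + 1)) ℝ => M a b)
    ((locGram (avgLim f) K q s)⁻¹) := (continuous_id.matrix_elem a b).continuousAt
  exact (ContinuousAt.comp (f := fun s => (locGram (avgLim f) K q s)⁻¹)
    (g := fun M : Matrix (Fin (q + 1)) (Fin (q + 1)) ℝ => M a b) h2 h).continuousWithinAt

lemma continuousOn_mulVec (q : ℕ) (j : Fin (q + 1)) :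
    ContinuousOn (fun z : ℝ × ℝ => (locGram (avgLim f) K q z.1)⁻¹.mulVec
      (powers q (z.2 - z.1)) j) (Set.Icc 0 2 ×ˢ Set.univ) := by
  simp only [Matrix.mulVec, dotProduct, powers]
  refine continuousOn_finsetSum _ fun b _ => ContinuousOn.mul ?_ (by fun_prop)
  exact (hK.continuousOn_inv hf q j b).comp continuousOn_fst fun z hz => hz.1

lemma locWeight_bounded (q : ℕ) (j : Fin (q + 1)) : ∃ B : ℝ, 0 ≤ B ∧
    ∀ s ∈ Set.Icc (0 : ℝ) 2, ∀ v ∈ Set.Icc (0 : ℝ) 2, |locWeight (avgLim f) K q j s v| ≤ B := by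
  obtain ⟨B, hB⟩ := (isCompact_Icc.prod (isCompact_Icc (a := (0 : ℝ)) (b := 2))
    ).exists_bound_of_continuousOn ((hK.continuousOn_mulVec hf q j).mono
      (Set.prod_mono le_rfl (Set.subset_univ (Set.Icc (0 : ℝ) 2))))
  obtain ⟨B', hB'0, hB'⟩ := hK.exists_bound
  refine ⟨|B| * B', by positivity, fun s hs v hv => ?_⟩
  rw [locWeight, abs_mul]
  exact mul_le_mul ((hB (s, v) ⟨hs, hv⟩).trans (le_abs_self _)) (hB' _) (abs_nonneg _)
    (abs_nonneg _)

lemma continuousOn_locBias (p : ℕ) :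
    ContinuousOn (fun s => locBias (avgLim f) K p s) (Set.Icc 0 2) := by
  simp only [locBias, (hK.linearOnMoments_avgLim f).apply_locWeight_mul_pow]
  exact continuousOn_finsetSum _ fun b _ =>
    (hK.continuousOn_inv hf p 0 b).mul (hK.continuous_avgLim_moment f _).continuousOn

omit hf in
lemma measurable_locWeight (f : ℝ) (q : ℕ) (j : Fin (q + 1)) :
    Measurable fun z : ℝ × ℝ => locWeight (avgLim f) K q j z.1 z.2 :=
  ((measurableAvg_avgLim f).locWeight hK.measurable q j).comp
    (f := fun z : ℝ × ℝ => (((), z.1), z.2)) (by fun_prop)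

omit hf in
lemma measurable_locBias (f : ℝ) (p : ℕ) : Measurable fun s => locBias (avgLim f) K p s :=
  ((measurableAvg_avgLim f).locBias hK.measurable p).comp (f := fun s => ((), s)) (by fun_prop)

omit hf in
lemma measurable_locBoot (f : ℝ) (p : ℕ) : Measurable fun s => locBoot (avgLim f) K p s :=
  ((measurableAvg_avgLim f).locBoot hK.measurable p).comp (f := fun s => ((), s)) (by fun_prop)

omit hf in
lemma measurable_locRBC (f : ℝ) (p : ℕ) : Measurable fun s => locRBC (avgLim f) K p s :=
  ((measurableAvg_avgLim f).locRBC hK.measurable p).comp (f := fun s => ((), s)) (by fun_prop)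

lemma locConv_bounded (p : ℕ) : ∃ B : ℝ, 0 ≤ B ∧
    ∀ v ∈ Set.Icc (0 : ℝ) 2, |locConv (avgLim f) K p v| ≤ B := by
  obtain ⟨B, hB0, hB⟩ := hK.locWeight_bounded hf p 0
  refine ⟨f * (B * B * 2), by positivity, fun v hv => ?_⟩
  rw [locConv, avgLim, abs_mul, abs_of_pos hf]
  refine mul_le_mul_of_nonneg_left ?_ hf.le
  have := intervalIntegral.norm_integral_le_of_norm_le_const (a := (0 : ℝ)) (b := 2) (C := B * B)
    (f := fun s => locWeight (avgLim f) K p 0 0 s * locWeight (avgLim f) K p 0 s v) (by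
      intro s hs
      rw [Set.uIoc_of_le zero_le_two] at hs
      rw [norm_mul]
      exact mul_le_mul (hB 0 (by simp) s (Set.Ioc_subset_Icc_self hs))
        (hB s (Set.Ioc_subset_Icc_self hs) v hv) (norm_nonneg _) hB0)
  simpa using this

lemma locBoot_bounded (p : ℕ) : ∃ B : ℝ, 0 ≤ B ∧
    ∀ v ∈ Set.Icc (0 : ℝ) 2, |locBoot (avgLim f) K p v| ≤ B := by
  obtain ⟨B, hB0, hB⟩ := hK.locWeight_bounded hf p 0
  obtain ⟨B', hB'0, hB'⟩ := hK.locConv_bounded hf p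
  refine ⟨B + |locBias (avgLim f) K p 0 / locSmooth (avgLim f) K p| * (B' + B), by positivity,
    fun v hv => ?_⟩
  rw [locBoot]
  refine (abs_sub _ _).trans (add_le_add (hB 0 (by simp) v hv) ?_)
  rw [abs_mul]
  exact mul_le_mul_of_nonneg_left ((abs_sub _ _).trans
    (add_le_add (hB' v hv) (hB 0 (by simp) v hv))) (abs_nonneg _)

lemma locRBC_bounded (p : ℕ) : ∃ B : ℝ, 0 ≤ B ∧
    ∀ v ∈ Set.Icc (0 : ℝ) 2, |locRBC (avgLim f) K p v| ≤ B := by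
  obtain ⟨B, hB0, hB⟩ := hK.locWeight_bounded hf p 0
  obtain ⟨B', hB'0, hB'⟩ := hK.locWeight_bounded hf (p + 1) (Fin.last (p + 1))
  refine ⟨B + |locBias (avgLim f) K p 0| * B', by positivity, fun v hv => ?_⟩
  rw [locRBC]
  refine (abs_sub _ _).trans (add_le_add (hB 0 (by simp) v hv) ?_)
  rw [abs_mul]
  exact mul_le_mul_of_nonneg_left (hB' 0 (by simp) v hv) (abs_nonneg _)

end IsKernel

/-! ### Convergence of the weights -/

namespace Approximates

variable {ι : Type*} {l : Filter ι} {c : ι → Sample} {f : ℝ} (hc : Approximates l c f)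
  {K : ℝ → ℝ} (hK : IsKernel K)

include hc

/-- Random weights inside an average may be replaced by their limits: the error is at most their
uniform distance times the total mass, which converges. Only averages of deterministic integrands
then remain. -/
lemma tendstoUniformlyOn_avg_of {T : Type*} {S : Set T} {F : ι → T → ℝ → ℝ} {G : T → ℝ → ℝ}
    {H : T → ℝ}
    (h : TendstoUniformlyOn (fun i (z : T × ℝ) => F i z.1 z.2) (fun z => G z.1 z.2) l
      (S ×ˢ Set.Icc 0 2))
    (hG : TendstoUniformlyOn (fun i τ => (c i).avg (G τ)) H l S) :
    TendstoUniformlyOn (fun i τ => (c i).avg (F i τ)) H l S := by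
  have hf := hc.pos
  rw [Metric.tendstoUniformlyOn_iff] at *
  intro ε hε
  have hmass := Metric.tendsto_nhds.1 hc.tendsto_mass 1 one_pos
  filter_upwards [h (ε / (2 * (f * 2 + 1))) (by positivity), hG (ε / 2) (half_pos hε), hmass]
    with i hi hGi hmi τ hτ
  have h1 : |(c i).avg (G τ) - (c i).avg (F i τ)| ≤ ε / 2 := by
    rw [← Sample.avg_sub]
    refine (Sample.abs_avg_le (hc.wt_nonneg i) (ψ := fun _ => ε / (2 * (f * 2 + 1)) * 1)
      fun j hj => ?_).trans ?_
    · have := hi (τ, (c i).pt j) ⟨hτ, Set.Ico_subset_Icc_self (hc.pt_mem i j hj)⟩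
      rw [Real.dist_eq] at this
      rw [mul_one]; exact this.le
    · rw [Sample.avg_const_mul]
      rw [Real.dist_eq] at hmi
      have h2 : (c i).avg (fun _ => 1) ≤ f * 2 + 1 := by linarith [(abs_lt.1 hmi).2]
      calc ε / (2 * (f * 2 + 1)) * (c i).avg (fun _ => 1)
          ≤ ε / (2 * (f * 2 + 1)) * (f * 2 + 1) := by gcongr
        _ = ε / 2 := by field_simp
  have h3 := hGi τ hτ
  calc dist (H τ) ((c i).avg (F i τ)) ≤ dist (H τ) ((c i).avg (G τ)) +
        dist ((c i).avg (G τ)) ((c i).avg (F i τ)) := dist_triangle _ _ _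
    _ < ε / 2 + ε / 2 := by
        rw [Real.dist_eq ((c i).avg (G τ))]
        exact add_lt_add_of_lt_of_le h3 h1
    _ = ε := by ring

include hK

lemma tendsto_moment (k : ℕ) :
    TendstoUniformlyOn (fun i s => (c i).avg fun v => K (v - s) * (v - s) ^ k)
      (fun s => avgLim f fun v => K (v - s) * (v - s) ^ k) l (Set.Icc 0 2) := by
  obtain ⟨κ, hκ, rfl⟩ := hK.exists_continuous_extension
  have h := hc.tendstoUniformlyOn_avg_indicator (S := Set.Icc 0 2) isCompact_Icc
    (Ψ := fun s v => κ (v - s) * (v - s) ^ k) (a := fun s => s - 1) (b := fun s => s + 1)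
    (by fun_prop) (fun s _ => by fun_prop)
  have heq : ∀ s : ℝ, (fun v => (Set.Ioo (-1 : ℝ) 1).indicator κ (v - s) * (v - s) ^ k) =
      (Set.Ioo (s - 1) (s + 1)).indicator (fun v => κ (v - s) * (v - s) ^ k) := by
    intro s
    ext v
    by_cases hv : v ∈ Set.Ioo (s - 1) (s + 1)
    · rw [Set.indicator_of_mem hv, Set.indicator_of_mem]
      exact ⟨by linarith [hv.1], by linarith [hv.2]⟩
    · rw [Set.indicator_of_notMem hv, Set.indicator_of_notMem, zero_mul]
      exact fun h => hv ⟨by linarith [h.1], by linarith [h.2]⟩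
  simp only [heq]
  exact h

lemma tendsto_locGram (q : ℕ) :
    TendstoUniformlyOn (fun i s => locGram (c i).avg K q s) (fun s => locGram (avgLim f) K q s) l
      (Set.Icc 0 2) :=
  tendstoUniformlyOn_matrix fun _ _ => hc.tendsto_moment hK _

lemma tendsto_inv (q : ℕ) (a b : Fin (q + 1)) :
    TendstoUniformlyOn (fun i s => (locGram (c i).avg K q s)⁻¹ a b)
      (fun s => (locGram (avgLim f) K q s)⁻¹ a b) l (Set.Icc 0 2) := by
  refine tendstoUniformlyOn_comp (hc.tendsto_locGram hK q)
    (C := (fun s => locGram (avgLim f) K q s) '' Set.Icc 0 2)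
    (fun s hs => Set.mem_image_of_mem _ hs)
    (isCompact_Icc.image (hK.continuous_locGram f q))
    (Φ := fun M : Matrix (Fin (q + 1)) (Fin (q + 1)) ℝ => M⁻¹ a b) ?_
  rintro _ ⟨s, hs, rfl⟩
  have h2 : ContinuousAt (fun M : Matrix (Fin (q + 1)) (Fin (q + 1)) ℝ => M a b)
    ((locGram (avgLim f) K q s)⁻¹) := (continuous_id.matrix_elem a b).continuousAt
  exact ContinuousAt.comp (f := fun M : Matrix (Fin (q + 1)) (Fin (q + 1)) ℝ => M⁻¹)
    (g := fun M : Matrix (Fin (q + 1)) (Fin (q + 1)) ℝ => M a b) h2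
    (hK.continuousAt_inv hc.pos q hs)

/-- The limiting determinants are bounded away from zero on the compact set of evaluation points, so
uniform convergence makes all sample Gram matrices invertible simultaneously. -/
lemma eventually_isUnit_det (q : ℕ) :
    ∀ᶠ i in l, ∀ s ∈ Set.Icc (0 : ℝ) 2, IsUnit (locGram (c i).avg K q s).det := by
  have hcont : Continuous fun s => (locGram (avgLim f) K q s).det :=
    (hK.continuous_locGram f q).matrix_det
  have h := tendstoUniformlyOn_comp (hc.tendsto_locGram hK q)
    (C := (fun s => locGram (avgLim f) K q s) '' Set.Icc 0 2)
    (fun s hs => Set.mem_image_of_mem _ hs)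
    (isCompact_Icc.image (hK.continuous_locGram f q))
    (Φ := fun M : Matrix (Fin (q + 1)) (Fin (q + 1)) ℝ => M.det)
    (fun _ _ => (continuous_id.matrix_det).continuousAt)
  obtain ⟨s₀, hs₀, hmin⟩ := isCompact_Icc.exists_isMinOn (Set.nonempty_Icc.2 zero_le_two)
    (hcont.abs.continuousOn (s := Set.Icc (0 : ℝ) 2))
  have hpos : 0 < |(locGram (avgLim f) K q s₀).det| :=
    abs_pos.2 (hK.det_locGram_ne_zero hc.pos q hs₀)
  filter_upwards [Metric.tendstoUniformlyOn_iff.1 h _ hpos] with i hi s hs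
  rw [isUnit_iff_ne_zero]
  intro h0
  have h1 := hi s hs
  rw [h0, Real.dist_eq, sub_zero] at h1
  exact absurd h1 (not_lt.2 (hmin hs))

/-- Only the inverse Gram entries depend on the averaging functional. The remaining factors are
fixed and bounded, so the jumps of the kernel do not affect uniformity. -/
lemma tendsto_locWeight (q : ℕ) (j : Fin (q + 1)) :
    TendstoUniformlyOn (fun i (z : ℝ × ℝ) => locWeight (c i).avg K q j z.1 z.2)
      (fun z => locWeight (avgLim f) K q j z.1 z.2) l (Set.Icc 0 2 ×ˢ Set.Icc 0 2) := by
  have hrw : ∀ (E : (ℝ → ℝ) → ℝ) (z : ℝ × ℝ), locWeight E K q j z.1 z.2 =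
      ∑ b, (locGram E K q z.1)⁻¹ j b * ((z.2 - z.1) ^ (b : ℕ) * K (z.2 - z.1)) := by
    intro E z
    simp only [locWeight, Matrix.mulVec, dotProduct, powers, Finset.sum_mul, mul_assoc]
  simp only [hrw]
  refine tendstoUniformlyOn_finsetSum _ fun b _ => ?_
  obtain ⟨B, hB⟩ := isCompact_Icc.exists_bound_of_continuousOn (hK.continuousOn_inv hc.pos q j b)
  obtain ⟨B', hB'0, hB'⟩ := hK.exists_bound
  refine tendstoUniformlyOn_mul (B := B) (B' := 2 ^ (b : ℕ) * B') ?_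
    (tendstoUniformlyOn_refl l _ _) (fun z hz => hB z.1 hz.1) (fun z hz => ?_)
  · intro r hr
    filter_upwards [hc.tendsto_inv hK q j b r hr] with i hi z hz using hi z.1 hz.1
  · rw [abs_mul, abs_pow]
    have : |z.2 - z.1| ≤ 2 := by
      rw [abs_le]
      constructor <;> linarith [hz.1.1, hz.1.2, hz.2.1, hz.2.2]
    exact mul_le_mul (pow_le_pow_left₀ (abs_nonneg _) this _) (hB' _) (abs_nonneg _) (by positivity)

lemma tendsto_locBias (p : ℕ) :
    TendstoUniformlyOn (fun i s => locBias (c i).avg K p s) (fun s => locBias (avgLim f) K p s) l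
      (Set.Icc 0 2) := by
  simp only [locBias, (hK.linearOnMoments_avgLim f).apply_locWeight_mul_pow,
    ((c _).linearOnMoments K).apply_locWeight_mul_pow]
  refine tendstoUniformlyOn_finsetSum _ fun b _ => ?_
  obtain ⟨B, hB⟩ := isCompact_Icc.exists_bound_of_continuousOn (hK.continuousOn_inv hc.pos p 0 b)
  obtain ⟨B', hB'⟩ := isCompact_Icc.exists_bound_of_continuousOn
    (hK.continuous_avgLim_moment f ((b : ℕ) + (p + 1))).continuousOn
  exact tendstoUniformlyOn_mul (hc.tendsto_inv hK p 0 b) (hc.tendsto_moment hK _) hB hB'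

lemma tendsto_locWeight_zero (q : ℕ) (j : Fin (q + 1)) :
    TendstoUniformlyOn (fun i v => locWeight (c i).avg K q j 0 v)
      (fun v => locWeight (avgLim f) K q j 0 v) l (Set.Icc 0 2) := by
  intro r hr
  filter_upwards [hc.tendsto_locWeight hK q j r hr] with i hi v hv using hi (0, v) ⟨by simp, hv⟩

lemma tendsto_locSmooth (p : ℕ) :
    Tendsto (fun i => locSmooth (c i).avg K p) l (𝓝 (locSmooth (avgLim f) K p)) := by
  -- A number is viewed as a family over one point, so that the uniform lemmas apply.
  suffices h : TendstoUniformlyOn (fun i (_ : ℝ) => locSmooth (c i).avg K p)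
      (fun _ => locSmooth (avgLim f) K p) l {0} from h.tendsto_at (Set.mem_singleton _)
  simp only [locSmooth]
  obtain ⟨B, _, hB⟩ := hK.locWeight_bounded hc.pos p 0
  obtain ⟨B', hB'⟩ := isCompact_Icc.exists_bound_of_continuousOn (hK.continuousOn_locBias hc.pos p)
  refine hc.tendstoUniformlyOn_avg_of
    (F := fun i _ s => locWeight (c i).avg K p 0 0 s * locBias (c i).avg K p s)
    (G := fun _ s => locWeight (avgLim f) K p 0 0 s * locBias (avgLim f) K p s) ?_ ?_
  · have h := tendstoUniformlyOn_mul (hc.tendsto_locWeight_zero hK p 0) (hc.tendsto_locBias hK p)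
      (hB 0 (by simp)) hB'
    intro r hr
    filter_upwards [h r hr] with i hi z hz using hi z.2 hz.2
  · obtain ⟨κ, hκ, hKκ⟩ := hK.exists_continuous_extension
    have heq : (fun s => locWeight (avgLim f) K p 0 0 s * locBias (avgLim f) K p s) =
        (Set.Ioo (-1 : ℝ) 1).indicator (fun s => (locGram (avgLim f) K p 0)⁻¹.mulVec
          (powers p (s - 0)) 0 * κ s * locBias (avgLim f) K p s) := by
      ext s
      rw [locWeight]
      by_cases hs : s ∈ Set.Ioo (-1 : ℝ) 1
      · rw [Set.indicator_of_mem hs]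
        congr 2
        rw [hKκ, sub_zero, Set.indicator_of_mem hs]
      · rw [Set.indicator_of_notMem hs, hK.eq_zero _ (by simpa using hs)]
        simp
    have hcont : ContinuousOn (fun s => (locGram (avgLim f) K p 0)⁻¹.mulVec
        (powers p (s - 0)) 0 * κ s * locBias (avgLim f) K p s) (Set.Icc 0 2) := by
      refine ContinuousOn.mul (ContinuousOn.mul ?_ hκ.continuousOn)
        (hK.continuousOn_locBias hc.pos p)
      simp only [Matrix.mulVec, dotProduct, powers]
      fun_prop
    simp only [heq]
    refine hc.tendstoUniformlyOn_avg_indicator (S := {0}) isCompact_singleton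
      (Ψ := fun _ s => (locGram (avgLim f) K p 0)⁻¹.mulVec
        (powers p (s - 0)) 0 * κ s * locBias (avgLim f) K p s) (a := fun _ => -1) (b := fun _ => 1)
      (hcont.comp continuousOn_snd fun z hz => hz.2) (fun _ _ => ?_)
    refine Measurable.mul (Measurable.mul ?_ hκ.measurable) (hK.measurable_locBias f p)
    simp only [Matrix.mulVec, dotProduct, powers]
    fun_prop

lemma tendsto_locConv (p : ℕ) :
    TendstoUniformlyOn (fun i v => locConv (c i).avg K p v)
      (fun v => locConv (avgLim f) K p v) l (Set.Icc 0 2) := by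
  simp only [locConv]
  obtain ⟨B, _, hB⟩ := hK.locWeight_bounded hc.pos p 0
  refine hc.tendstoUniformlyOn_avg_of
    (F := fun i v s => locWeight (c i).avg K p 0 0 s * locWeight (c i).avg K p 0 s v)
    (G := fun v s => locWeight (avgLim f) K p 0 0 s * locWeight (avgLim f) K p 0 s v) ?_ ?_
  · refine tendstoUniformlyOn_mul (B := B) (B' := B) ?_ ?_
      (fun z hz => hB 0 (by simp) _ hz.2) (fun z hz => hB _ hz.2 _ hz.1)
    · intro r hr
      filter_upwards [hc.tendsto_locWeight_zero hK p 0 r hr] with i hi z hz using hi z.2 hz.2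
    · intro r hr
      filter_upwards [hc.tendsto_locWeight hK p 0 r hr] with i hi z hz using
        hi (z.2, z.1) ⟨hz.2, hz.1⟩
  · obtain ⟨κ, hκ, hKκ⟩ := hK.exists_continuous_extension
    -- The integrand is supported where `|s| < 1` and `|v - s| < 1`, an interval whose ends move
    -- with `v`, and inside it agrees with a function that is jointly continuous on the square.
    have heq : ∀ v : ℝ,
        (fun s => locWeight (avgLim f) K p 0 0 s * locWeight (avgLim f) K p 0 s v) =
        (Set.Ioo (max (-1) (v - 1)) (min 1 (v + 1))).indicator
          (fun s => ((locGram (avgLim f) K p 0)⁻¹.mulVec (powers p (s - 0)) 0 * κ s) *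
            ((locGram (avgLim f) K p s)⁻¹.mulVec (powers p (v - s)) 0 * κ (v - s))) := by
      intro v
      ext s
      rw [locWeight, locWeight]
      by_cases hs : s ∈ Set.Ioo (max (-1) (v - 1)) (min 1 (v + 1))
      · rw [Set.indicator_of_mem hs]
        simp only [Set.mem_Ioo, max_lt_iff, lt_min_iff] at hs
        rw [hKκ, Set.indicator_of_mem (show s - 0 ∈ Set.Ioo (-1 : ℝ) 1 from
            ⟨by linarith, by linarith⟩),
          Set.indicator_of_mem (show v - s ∈ Set.Ioo (-1 : ℝ) 1 from
            ⟨by linarith, by linarith⟩), sub_zero]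
      · rw [Set.indicator_of_notMem hs]
        simp only [Set.mem_Ioo, max_lt_iff, lt_min_iff, not_and_or, not_lt] at hs
        by_cases h1 : s - 0 ∈ Set.Ioo (-1 : ℝ) 1
        · have h2 : v - s ∉ Set.Ioo (-1 : ℝ) 1 := by
            rintro ⟨h3, h4⟩
            have h5 := h1.1
            have h6 := h1.2
            rcases hs with (h | h) | (h | h) <;> linarith
          rw [hK.eq_zero _ h2]
          simp
        · rw [hK.eq_zero _ h1]
          simp
    simp only [heq]
    have hpow : Continuous fun s => (locGram (avgLim f) K p 0)⁻¹.mulVec (powers p (s - 0)) 0 := by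
      simp only [Matrix.mulVec, dotProduct, powers]
      fun_prop
    refine hc.tendstoUniformlyOn_avg_indicator (S := Set.Icc 0 2) isCompact_Icc
      (Ψ := fun v s => ((locGram (avgLim f) K p 0)⁻¹.mulVec (powers p (s - 0)) 0 * κ s) *
            ((locGram (avgLim f) K p s)⁻¹.mulVec (powers p (v - s)) 0 * κ (v - s)))
      (a := fun v => max (-1) (v - 1)) (b := fun v => min 1 (v + 1)) ?_ ?_
    · refine ContinuousOn.mul ((hpow.mul hκ).comp continuous_snd).continuousOn (ContinuousOn.mul ?_
        (hκ.comp (continuous_fst.sub continuous_snd)).continuousOn)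
      exact (hK.continuousOn_mulVec hc.pos p 0).comp
        (f := fun z : ℝ × ℝ => (z.2, z.1)) (by fun_prop) fun z hz => ⟨hz.2, trivial⟩
    · intro v _
      refine (hpow.measurable.mul hκ.measurable).mul (Measurable.mul ?_
        (hκ.measurable.comp (measurable_const.sub measurable_id)))
      simp only [Matrix.mulVec, dotProduct, powers]
      refine Finset.measurable_sum _ fun b _ => Measurable.mul ?_ (by fun_prop)
      exact measurable_matrix_inv (M := fun s => locGram (avgLim f) K p s)
        (fun a b => ((hK.continuous_locGram f p).matrix_elem a b).measurable) 0 b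

lemma tendsto_locBoot {p : ℕ} (hs : locSmooth (avgLim f) K p ≠ 0) :
    TendstoUniformlyOn (fun i v => locBoot (c i).avg K p v)
      (fun v => locBoot (avgLim f) K p v) l (Set.Icc 0 2) := by
  obtain ⟨B, _, hB⟩ := hK.locWeight_bounded hc.pos p 0
  obtain ⟨B', _, hB'⟩ := hK.locConv_bounded hc.pos p
  have hQ : Tendsto (fun i => locBias (c i).avg K p 0 / locSmooth (c i).avg K p) l
      (𝓝 (locBias (avgLim f) K p 0 / locSmooth (avgLim f) K p)) :=
    ((hc.tendsto_locBias hK p).tendsto_at (by simp)).div (hc.tendsto_locSmooth hK p) hs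
  have hQ' : TendstoUniformlyOn (fun i (_ : ℝ) => locBias (c i).avg K p 0 / locSmooth (c i).avg K p)
      (fun _ => locBias (avgLim f) K p 0 / locSmooth (avgLim f) K p) l (Set.Icc 0 2) := by
    intro r hr
    filter_upwards [(Uniform.tendsto_nhds_right.1 hQ) hr] with i hi v _ using hi
  have hw := hc.tendsto_locWeight_zero hK p 0
  exact hw.sub (tendstoUniformlyOn_mul hQ' ((hc.tendsto_locConv hK p).sub hw)
    (fun _ _ => le_rfl) (B' := B' + B) fun v hv => (abs_sub _ _).trans
      (add_le_add (hB' v hv) (hB 0 (by simp) v hv)))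

lemma tendsto_locRBC (p : ℕ) :
    TendstoUniformlyOn (fun i v => locRBC (c i).avg K p v)
      (fun v => locRBC (avgLim f) K p v) l (Set.Icc 0 2) := by
  obtain ⟨B', _, hB'⟩ := hK.locWeight_bounded hc.pos (p + 1) (Fin.last (p + 1))
  have hC : TendstoUniformlyOn (fun i (_ : ℝ) => locBias (c i).avg K p 0)
      (fun _ => locBias (avgLim f) K p 0) l (Set.Icc 0 2) := by
    intro r hr
    filter_upwards [hc.tendsto_locBias hK p r hr] with i hi v _ using hi 0 (by simp)
  exact (hc.tendsto_locWeight_zero hK p 0).sub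
    (tendstoUniformlyOn_mul hC (hc.tendsto_locWeight_zero hK (p + 1) (Fin.last (p + 1)))
      (fun _ _ => le_rfl) (hB' 0 (by simp)))

end Approximates

/-! ### Identification of the limits with the kernel constants -/

lemma intervalIntegral_eq_of_vanish {g : ℝ → ℝ} {a b c : ℝ} (hab : a ≤ b) (hbc : b ≤ c)
    (hg : ∀ u, b < u → g u = 0) : ∫ u in a..c, g u = ∫ u in a..b, g u := by
  rw [intervalIntegral.integral_of_le (hab.trans hbc), intervalIntegral.integral_of_le hab]
  refine setIntegral_eq_of_subset_of_forall_sdiff_eq_zero measurableSet_Ioc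
    (Set.Ioc_subset_Ioc_right hbc) fun u hu => hg u ?_
  by_contra h
  exact hu.2 ⟨hu.1.1, not_lt.1 h⟩

lemma integral_Ici_eq_of_vanish {g : ℝ → ℝ} {b : ℝ} (hb : 0 ≤ b) (hg : ∀ u, b < u → g u = 0) :
    ∫ u in Set.Ici (0 : ℝ), g u = ∫ u in (0 : ℝ)..b, g u := by
  rw [integral_Ici_eq_integral_Ioi, intervalIntegral.integral_of_le hb]
  refine setIntegral_eq_of_subset_of_forall_sdiff_eq_zero measurableSet_Ioi
    Set.Ioc_subset_Ioi_self fun u hu => hg u ?_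
  by_contra h
  exact hu.2 ⟨hu.1, not_lt.1 h⟩

namespace IsKernel

variable {K : ℝ → ℝ} (hK : IsKernel K) {f : ℝ} (hf : 0 < f)

include hK

lemma eq_zero_of_one_lt {u : ℝ} (hu : 1 < u) : K u = 0 :=
  hK.eq_zero u fun h => absurd h.2 (not_lt.2 hu.le)

lemma eqKernelRow_eq_zero {q : ℕ} (j : Fin (q + 1)) {u : ℝ} (s : ℝ) (hu : 1 < u) :
    eqKernelRow K q j u s = 0 := by
  rw [eqKernelRow, hK.eq_zero_of_one_lt hu, mul_zero]

lemma locWeight_eq_zero {E : (ℝ → ℝ) → ℝ} {q : ℕ} (j : Fin (q + 1)) {s v : ℝ} (hu : 1 < v - s) :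
    locWeight E K q j s v = 0 := by
  rw [locWeight, hK.eq_zero_of_one_lt hu, mul_zero]

/-- For `s ≤ 1` the window ends at or beyond `s + 1`, so the kernel is cut off only at the cutoff
itself. -/
lemma locGram_avgLim (f : ℝ) (q : ℕ) {s : ℝ} (hs : s ∈ Set.Icc (0 : ℝ) 1) :
    locGram (avgLim f) K q s = f • moments K q s := by
  ext a b
  rw [locGram, Matrix.of_apply, avgLim_moment, moments, Matrix.smul_apply, Matrix.of_apply,
    smul_eq_mul, intervalIntegral_eq_of_vanish (b := 1) (by linarith [hs.1]) (by linarith [hs.2])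
      (fun u hu => by rw [hK.eq_zero_of_one_lt hu, zero_mul])]
  simp only [mul_comm]

include hf

/-- The Gram matrix carries a factor `f`, hence the weights a factor `f⁻¹`. One more average cancels
it, so the bias constants and `Q` do not depend on the density. -/
lemma locWeight_avgLim (q : ℕ) (j : Fin (q + 1)) {s : ℝ} (hs : s ∈ Set.Icc (0 : ℝ) 1) (v : ℝ) :
    locWeight (avgLim f) K q j s v = f⁻¹ * eqKernelRow K q j (v - s) s := by
  have hdet : IsUnit (moments K q s).det := by
    have h := hK.det_locGram_ne_zero hf q (s := s) ⟨hs.1, hs.2.trans one_le_two⟩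
    rw [hK.locGram_avgLim f q hs, Matrix.det_smul] at h
    exact isUnit_iff_ne_zero.2 (right_ne_zero_of_mul h)
  have hinv : (f • moments K q s)⁻¹ = f⁻¹ • (moments K q s)⁻¹ := by
    have := invertibleOfNonzero hf.ne'
    rw [Matrix.inv_smul _ f hdet, invOf_eq_inv]
  rw [locWeight, hK.locGram_avgLim f q hs, hinv, Matrix.smul_mulVec, Pi.smul_apply, smul_eq_mul,
    eqKernelRow, mul_assoc]

lemma locBias_avgLim (p : ℕ) {s : ℝ} (hs : s ∈ Set.Icc (0 : ℝ) 1) :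
    locBias (avgLim f) K p s = ∫ u in (-s)..1, wBnd K p u s * u ^ (p + 1) := by
  simp only [locBias, hK.locWeight_avgLim hf p 0 hs, avgLim, mul_assoc]
  rw [intervalIntegral.integral_const_mul, mul_inv_cancel_left₀ hf.ne',
    intervalIntegral.integral_comp_sub_right (fun u => eqKernelRow K p 0 u s * u ^ (p + 1)) s,
    zero_sub]
  exact intervalIntegral_eq_of_vanish (by linarith [hs.1]) (by linarith [hs.2])
    fun u hu => by rw [hK.eqKernelRow_eq_zero 0 s hu, zero_mul]

lemma locBias_avgLim_zero (p : ℕ) : locBias (avgLim f) K p 0 = constC K p := by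
  rw [hK.locBias_avgLim hf p (by simp), constC, neg_zero]
  exact (integral_Ici_eq_of_vanish zero_le_one fun u hu => by
    change eqKernelRow K p 0 u 0 * _ = 0
    rw [hK.eqKernelRow_eq_zero 0 0 hu, zero_mul]).symm

lemma locSmooth_avgLim (p : ℕ) : locSmooth (avgLim f) K p = constCLP K p := by
  rw [locSmooth, avgLim, intervalIntegral_eq_of_vanish (b := 1) zero_le_one one_le_two
    (fun s hs => by rw [hK.locWeight_eq_zero 0 (by simpa using hs), zero_mul]), constCLP,
    ← intervalIntegral.integral_const_mul]
  refine intervalIntegral.integral_congr fun s hs => ?_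
  rw [Set.uIcc_of_le zero_le_one] at hs
  rw [hK.locWeight_avgLim hf p 0 (by simp), hK.locBias_avgLim hf p hs, sub_zero, wBnd]
  field_simp

lemma locConv_avgLim (p : ℕ) (v : ℝ) : locConv (avgLim f) K p v = f⁻¹ * wConv K p v := by
  rw [wConv, integral_Ici_eq_of_vanish zero_le_one (fun r hr => by
      rw [wBnd, hK.eqKernelRow_eq_zero 0 0 hr, zero_mul]), locConv, avgLim,
    intervalIntegral_eq_of_vanish (b := 1) zero_le_one one_le_two
      (fun s hs => by rw [hK.locWeight_eq_zero 0 (by simpa using hs), zero_mul]),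
    ← intervalIntegral.integral_const_mul, ← intervalIntegral.integral_const_mul]
  refine intervalIntegral.integral_congr fun s hs => ?_
  rw [Set.uIcc_of_le zero_le_one] at hs
  rw [hK.locWeight_avgLim hf p 0 (by simp), hK.locWeight_avgLim hf p 0 hs, sub_zero, wBnd, wBnd]
  field_simp

lemma locBoot_avgLim (p : ℕ) (v : ℝ) : locBoot (avgLim f) K p v = f⁻¹ * wMPLP K p v := by
  rw [locBoot, hK.locBias_avgLim_zero hf, hK.locSmooth_avgLim hf, hK.locConv_avgLim hf,
    hK.locWeight_avgLim hf p 0 (by simp), sub_zero, wMPLP, constQ, wEq, wBnd]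
  ring

lemma locRBC_avgLim (p : ℕ) (v : ℝ) : locRBC (avgLim f) K p v = f⁻¹ * wRBC K p v := by
  rw [locRBC, hK.locBias_avgLim_zero hf, hK.locWeight_avgLim hf p 0 (by simp),
    hK.locWeight_avgLim hf (p + 1) _ (by simp), sub_zero, wRBC, wEq, wBnd]
  ring

omit hf in
lemma wMPLP_eq_zero (p : ℕ) {v : ℝ} (hv : 2 < v) : wMPLP K p v = 0 := by
  have h1 : wEq K p v = 0 := hK.eqKernelRow_eq_zero 0 0 (by linarith)
  have h2 : wConv K p v = 0 := by
    rw [wConv]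
    have : ∀ r : ℝ, wBnd K p r 0 * wBnd K p (v - r) r = 0 := by
      intro r
      by_cases hr : 1 < r
      · rw [wBnd, hK.eqKernelRow_eq_zero 0 0 hr, zero_mul]
      · rw [wBnd, wBnd, hK.eqKernelRow_eq_zero 0 r (u := v - r) (by linarith), mul_zero]
    simp [this]
  rw [wMPLP, h1, h2]; ring

omit hf in
lemma wRBC_eq_zero (p : ℕ) {v : ℝ} (hv : 2 < v) : wRBC K p v = 0 := by
  rw [wRBC, wEq, wBnd, hK.eqKernelRow_eq_zero 0 0 (by linarith),
    hK.eqKernelRow_eq_zero _ 0 (by linarith)]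
  ring

lemma integral_locBoot_sq (p : ℕ) :
    ∫ v in (0 : ℝ)..2, locBoot (avgLim f) K p v ^ 2 = (f⁻¹) ^ 2 * KmPLP K p := by
  rw [KmPLP, integral_Ici_eq_of_vanish zero_le_two
    (fun u hu => by rw [hK.wMPLP_eq_zero p hu]; simp), ← intervalIntegral.integral_const_mul]
  simp only [hK.locBoot_avgLim hf, mul_pow]

lemma integral_locRBC_sq (p : ℕ) :
    ∫ v in (0 : ℝ)..2, locRBC (avgLim f) K p v ^ 2 = (f⁻¹) ^ 2 * KRBC K p := by
  rw [KRBC, integral_Ici_eq_of_vanish zero_le_two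
    (fun u hu => by rw [hK.wRBC_eq_zero p hu]; simp), ← intervalIntegral.integral_const_mul]
  simp only [hK.locRBC_avgLim hf, mul_pow]

/-! ### Positivity of the variance constants -/

lemma avgLim_locWeight (q : ℕ) (j : Fin (q + 1)) {s : ℝ} (hs : s ∈ Set.Icc (0 : ℝ) 2) :
    avgLim f (fun v => locWeight (avgLim f) K q j s v) = if j = 0 then 1 else 0 := by
  have h := (hK.linearOnMoments_avgLim f).reproducing
    (isUnit_iff_ne_zero.2 (hK.det_locGram_ne_zero hf q hs)) j 0
  simpa using h

omit hf hK in
lemma _root_.RDD.intervalIntegrable_of_bounded {g : ℝ → ℝ} (hg : Measurable g) {B : ℝ}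
    (hB : ∀ v ∈ Set.Icc (0 : ℝ) 2, |g v| ≤ B) : IntervalIntegrable g volume 0 2 := by
  rw [intervalIntegrable_iff_integrableOn_Ioc_of_le zero_le_two]
  refine Measure.integrableOn_of_bounded (M := B) measure_Ioc_lt_top.ne hg.aestronglyMeasurable ?_
  exact (ae_restrict_iff' measurableSet_Ioc).2
    (Eventually.of_forall fun v hv => hB v (Set.Ioc_subset_Icc_self hv))

/-- By Fubini, integrating out `v` first replaces the inner weights by one and leaves the mass of
the outer weights. -/
lemma avgLim_locConv (p : ℕ) : avgLim f (fun v => locConv (avgLim f) K p v) = 1 := by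
  obtain ⟨B, hB0, hB⟩ := hK.locWeight_bounded hf p 0
  have hm := hK.measurable_locWeight f p 0
  have hF : Measurable (Function.uncurry fun v s : ℝ =>
      locWeight (avgLim f) K p 0 0 s * locWeight (avgLim f) K p 0 s v) :=
    (hm.comp (f := fun z : ℝ × ℝ => ((0 : ℝ), z.2)) (by fun_prop)).mul
      (hm.comp (f := fun z : ℝ × ℝ => (z.2, z.1)) (by fun_prop))
  have hswap : ∫ v in (0 : ℝ)..2, ∫ s in (0 : ℝ)..2,
      locWeight (avgLim f) K p 0 0 s * locWeight (avgLim f) K p 0 s v =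
      ∫ s in (0 : ℝ)..2, ∫ v in (0 : ℝ)..2,
      locWeight (avgLim f) K p 0 0 s * locWeight (avgLim f) K p 0 s v := by
    simp only [intervalIntegral.integral_of_le zero_le_two]
    refine integral_integral_swap ?_
    rw [Measure.prod_restrict]
    refine Measure.integrableOn_of_bounded (M := B * B) ?_ hF.aestronglyMeasurable ?_
    · rw [Measure.prod_prod]
      exact ENNReal.mul_ne_top measure_Ioc_lt_top.ne measure_Ioc_lt_top.ne
    · refine (ae_restrict_iff' (measurableSet_Ioc.prod measurableSet_Ioc)).2
        (Eventually.of_forall fun z hz => ?_)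
      have h1 := Set.Ioc_subset_Icc_self hz.1
      have h2 := Set.Ioc_subset_Icc_self hz.2
      rw [Function.uncurry, norm_mul]
      exact mul_le_mul (hB 0 (by simp) _ h2) (hB _ h2 _ h1) (norm_nonneg _) hB0
  change f * ∫ v in (0 : ℝ)..2, f * ∫ s in (0 : ℝ)..2,
    locWeight (avgLim f) K p 0 0 s * locWeight (avgLim f) K p 0 s v = 1
  rw [intervalIntegral.integral_const_mul, hswap, ← intervalIntegral.integral_const_mul]
  have hin : ∀ s ∈ Set.uIcc (0 : ℝ) 2, f * ∫ v in (0 : ℝ)..2,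
      locWeight (avgLim f) K p 0 0 s * locWeight (avgLim f) K p 0 s v =
      locWeight (avgLim f) K p 0 0 s := by
    intro s hs
    rw [Set.uIcc_of_le zero_le_two] at hs
    have h := hK.avgLim_locWeight hf p 0 hs
    rw [avgLim, if_pos rfl] at h
    rw [intervalIntegral.integral_const_mul, mul_left_comm, h, mul_one]
  rw [intervalIntegral.integral_congr hin]
  have h := hK.avgLim_locWeight hf p 0 (s := 0) (by simp)
  rwa [avgLim, if_pos rfl] at h

/-- The single and the iterated fit both reproduce constants, so the correction integrates to zero
whatever the value of the scaling factor. -/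
lemma avgLim_locBoot (p : ℕ) : avgLim f (fun v => locBoot (avgLim f) K p v) = 1 := by
  obtain ⟨B, hB0, hB⟩ := hK.locWeight_bounded hf p 0
  obtain ⟨B', hB'0, hB'⟩ := hK.locConv_bounded hf p
  have hw : IntervalIntegrable (fun v => locWeight (avgLim f) K p 0 0 v) volume 0 2 :=
    intervalIntegrable_of_bounded ((hK.measurable_locWeight f p 0).comp
      (f := fun v : ℝ => ((0 : ℝ), v)) (by fun_prop)) (hB 0 (by simp))
  have hcv : IntervalIntegrable (fun v => locConv (avgLim f) K p v) volume 0 2 :=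
    intervalIntegrable_of_bounded (((measurableAvg_avgLim f).locConv hK.measurable p).comp
      (f := fun v : ℝ => ((), v)) (by fun_prop)) hB'
  have h1 := hK.avgLim_locWeight hf p 0 (s := 0) (by simp)
  have h2 := hK.avgLim_locConv hf p
  rw [avgLim] at h1 h2 ⊢
  simp only [locBoot]
  rw [intervalIntegral.integral_sub hw ((hcv.sub hw).const_mul _),
    intervalIntegral.integral_const_mul, intervalIntegral.integral_sub hcv hw]
  rw [if_pos rfl] at h1
  have h3 : ∫ v in (0 : ℝ)..2, locConv (avgLim f) K p v =
      ∫ v in (0 : ℝ)..2, locWeight (avgLim f) K p 0 0 v :=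
    mul_left_cancel₀ hf.ne' (h2.trans h1.symm)
  rw [h3, sub_self, mul_zero, sub_zero, h1]

/-- The weights of the top coefficient annihilate constants, since the last index of a fit of order
`p + 1` is not zero. -/
lemma avgLim_locRBC (p : ℕ) : avgLim f (fun v => locRBC (avgLim f) K p v) = 1 := by
  obtain ⟨B, hB0, hB⟩ := hK.locWeight_bounded hf p 0
  obtain ⟨B', hB'0, hB'⟩ := hK.locWeight_bounded hf (p + 1) (Fin.last (p + 1))
  have hw : IntervalIntegrable (fun v => locWeight (avgLim f) K p 0 0 v) volume 0 2 :=
    intervalIntegrable_of_bounded ((hK.measurable_locWeight f p 0).comp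
      (f := fun v : ℝ => ((0 : ℝ), v)) (by fun_prop)) (hB 0 (by simp))
  have hd : IntervalIntegrable (fun v => locWeight (avgLim f) K (p + 1) (Fin.last (p + 1)) 0 v)
      volume 0 2 :=
    intervalIntegrable_of_bounded ((hK.measurable_locWeight f (p + 1) _).comp
      (f := fun v : ℝ => ((0 : ℝ), v)) (by fun_prop)) (hB' 0 (by simp))
  have h1 := hK.avgLim_locWeight hf p 0 (s := 0) (by simp)
  have h2 := hK.avgLim_locWeight hf (p + 1) (Fin.last (p + 1)) (s := 0) (by simp)
  rw [avgLim] at h1 h2 ⊢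
  rw [if_pos rfl] at h1
  rw [if_neg (Fin.last_pos.ne')] at h2
  simp only [locRBC]
  rw [intervalIntegral.integral_sub hw (hd.const_mul _), intervalIntegral.integral_const_mul,
    mul_sub, h1, mul_left_comm, h2, mul_zero, sub_zero]

omit hf hK in
lemma _root_.RDD.integral_sq_pos {A : ℝ → ℝ} (hA : Measurable A) {B : ℝ}
    (hB : ∀ v ∈ Set.Icc (0 : ℝ) 2, |A v| ≤ B) (hne : ∫ v in (0 : ℝ)..2, A v ≠ 0) :
    0 < ∫ v in (0 : ℝ)..2, A v ^ 2 := by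
  have hint : IntervalIntegrable (fun v => A v ^ 2) volume 0 2 :=
    intervalIntegrable_of_bounded (hA.pow_const 2) (B := B ^ 2) fun v hv => by
      rw [abs_pow]; exact pow_le_pow_left₀ (abs_nonneg _) (hB v hv) 2
  refine lt_of_le_of_ne (intervalIntegral.integral_nonneg zero_le_two fun v _ => sq_nonneg _) ?_
  intro h
  apply hne
  rw [intervalIntegral.integral_of_le zero_le_two] at h ⊢
  rw [intervalIntegrable_iff_integrableOn_Ioc_of_le zero_le_two] at hint
  have hae := (setIntegral_eq_zero_iff_of_nonneg_ae
    (Eventually.of_forall fun v => sq_nonneg _) hint).1 h.symm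
  refine integral_eq_zero_of_ae ?_
  filter_upwards [hae] with v hv
  simpa using hv

-- A function with integral one is not almost everywhere zero, so its square has positive integral.
-- The constant does not involve the density, so `f = 1` may be taken.
omit hf in
lemma KmPLP_pos (p : ℕ) : 0 < KmPLP K p := by
  obtain ⟨B, _, hB⟩ := hK.locBoot_bounded one_pos p
  have h := hK.avgLim_locBoot one_pos p
  rw [avgLim, one_mul] at h
  have h2 := integral_sq_pos (hK.measurable_locBoot 1 p) hB (by rw [h]; exact one_ne_zero)
  rw [hK.integral_locBoot_sq one_pos] at h2
  simpa using h2

omit hf in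
lemma KRBC_pos (p : ℕ) : 0 < KRBC K p := by
  obtain ⟨B, _, hB⟩ := hK.locRBC_bounded one_pos p
  have h := hK.avgLim_locRBC one_pos p
  rw [avgLim, one_mul] at h
  have h2 := integral_sq_pos (hK.measurable_locRBC 1 p) hB (by rw [h]; exact one_ne_zero)
  rw [hK.integral_locRBC_sq one_pos] at h2
  simpa using h2

end IsKernel

/-! ### Convergence in probability along a filter -/

section ProbFilter

variable {Ω : Type*} [MeasurableSpace Ω]

/-- The sets of pairs `(n, ω)` whose sections have probability tending to one: convergence in
probability is convergence along this filter. -/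
def probFilter (P : Measure Ω) : Filter (ℕ × Ω) where
  sets := {S | Tendsto (fun n => P {ω | (n, ω) ∉ S}) atTop (𝓝 0)}
  univ_sets := by simp
  sets_of_superset {S T} hS hST := by
    refine tendsto_of_tendsto_of_tendsto_of_le_of_le tendsto_const_nhds hS (fun _ => zero_le)
      fun n => measure_mono fun ω hω h => hω (hST h)
  inter_sets {S T} hS hT := by
    have h := Tendsto.add hS hT
    rw [add_zero] at h
    refine tendsto_of_tendsto_of_tendsto_of_le_of_le tendsto_const_nhds h (fun _ => zero_le)
      fun n => ?_
    refine (measure_mono fun ω hω => ?_).trans (measure_union_le _ _)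
    by_cases h1 : (n, ω) ∈ S
    · exact Or.inr fun h2 => hω ⟨h1, h2⟩
    · exact Or.inl h1

variable {P : Measure Ω}

lemma eventually_probFilter {Q : ℕ × Ω → Prop} :
    (∀ᶠ z in probFilter P, Q z) ↔ Tendsto (fun n => P {ω | ¬ Q (n, ω)}) atTop (𝓝 0) := Iff.rfl

lemma tendsto_fst_probFilter : Tendsto Prod.fst (probFilter P) atTop := by
  intro S hS
  refine eventually_probFilter.2 (tendsto_const_nhds.congr' ?_)
  filter_upwards [hS] with n hn
  have : {ω : Ω | n ∉ S} = ∅ := by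
    ext ω; simpa using hn
  exact (by rw [this, measure_empty] : (0 : ℝ≥0∞) = P {ω : Ω | n ∉ S})

/-- Chebyshev's inequality. -/
lemma tendsto_probFilter_of_integral_sq [IsFiniteMeasure P] {Y : ℕ → Ω → ℝ}
    (hint : ∀ᶠ n in atTop, Integrable (fun ω => Y n ω ^ 2) P)
    (hY : Tendsto (fun n => ∫ ω, Y n ω ^ 2 ∂P) atTop (𝓝 0)) :
    Tendsto (fun z : ℕ × Ω => Y z.1 z.2) (probFilter P) (𝓝 0) := by
  rw [Metric.tendsto_nhds]
  intro ε hε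
  rw [eventually_probFilter]
  have h1 : Tendsto (fun n => ENNReal.ofReal ((∫ ω, Y n ω ^ 2 ∂P) / ε ^ 2)) atTop (𝓝 0) := by
    have := ENNReal.tendsto_ofReal (hY.div_const (ε ^ 2))
    simpa using this
  refine tendsto_of_tendsto_of_tendsto_of_le_of_le' tendsto_const_nhds h1
    (Eventually.of_forall fun _ => zero_le) ?_
  filter_upwards [hint] with n hn
  have h2 := mul_meas_ge_le_integral_of_nonneg (μ := P)
    (Eventually.of_forall fun ω => sq_nonneg (Y n ω)) hn (ε ^ 2)
  have hset : {ω | ¬ dist (Y n ω) 0 < ε} ⊆ {ω | ε ^ 2 ≤ Y n ω ^ 2} := by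
    intro ω hω
    simp only [Set.mem_ofPred_eq, not_lt, Real.dist_eq, sub_zero] at hω ⊢
    rw [← sq_abs (Y n ω)]
    exact pow_le_pow_left₀ hε.le hω 2
  refine (measure_mono hset).trans ?_
  rw [← ENNReal.ofReal_toReal (measure_ne_top P {ω | ε ^ 2 ≤ Y n ω ^ 2})]
  refine ENNReal.ofReal_le_ofReal ?_
  rw [le_div_iff₀ (by positivity), mul_comm]
  exact h2

lemma tendstoInMeasure_of_probFilter {Y : ℕ → Ω → ℝ}
    (hY : Tendsto (fun z : ℕ × Ω => Y z.1 z.2) (probFilter P) (𝓝 0)) :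
    TendstoInMeasure P Y atTop fun _ => 0 := by
  rw [tendstoInMeasure_iff_dist]
  intro ε hε
  have := eventually_probFilter.1 (Metric.tendsto_nhds.1 hY ε hε)
  simpa only [not_lt] using this

end ProbFilter

/-! ### Averages over shrinking windows -/

lemma integral_window (F : ℝ → ℝ) (x₀ : ℝ) {h : ℝ} (hh : 0 < h) (G : ℝ → ℝ) :
    ∫ t, F ((t - x₀) / h) * G t = h * ∫ u, F u * G (x₀ + h * u) := by
  have h1 : ∀ t, F ((t - x₀) / h) * G t =
      (fun s => (fun u => F u * G (x₀ + h * u)) (s / h)) (t - x₀) := by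
    intro t
    simp only
    congr 2
    field_simp
    ring
  simp only [h1]
  rw [integral_sub_right_eq_self (fun s => (fun u => F u * G (x₀ + h * u)) (s / h)) x₀,
    Measure.integral_comp_div (fun u => F u * G (x₀ + h * u)) h, abs_of_pos hh, smul_eq_mul]

/-- Kernel smoothing of a function with one-sided limits. -/
lemma tendsto_integral_window {F G : ℝ → ℝ} {x₀ r B B' gr gl : ℝ} (hr : 0 < r)
    (hF : Measurable F) (hB : ∀ u, |F u| ≤ B) (hsupp : ∀ u, 2 < |u| → F u = 0)
    (hG : Measurable G) (hB' : ∀ t, |t - x₀| < r → |G t| ≤ B')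
    (hGr : Tendsto G (𝓝[≥] x₀) (𝓝 gr)) (hGl : Tendsto G (𝓝[<] x₀) (𝓝 gl))
    {h : ℕ → ℝ} (hpos : ∀ n, 0 < h n) (hh : Tendsto h atTop (𝓝 0)) :
    Tendsto (fun n => (h n)⁻¹ * ∫ t, F ((t - x₀) / h n) * G t) atTop
      (𝓝 (∫ u, F u * if 0 ≤ u then gr else gl)) := by
  have hB0 : 0 ≤ B := (abs_nonneg _).trans (hB 0)
  have hB'0 : 0 ≤ B' := (abs_nonneg _).trans (hB' x₀ (by simpa using hr))
  have heq : ∀ n, (h n)⁻¹ * ∫ t, F ((t - x₀) / h n) * G t = ∫ u, F u * G (x₀ + h n * u) := by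
    intro n
    rw [integral_window F x₀ (hpos n), inv_mul_cancel_left₀ (hpos n).ne']
  simp only [heq]
  -- From here on `|u| ≤ 2` keeps `x₀ + h u` in the region where `G` is bounded, which supplies the
  -- dominating function.
  have hsmall : ∀ᶠ n in atTop, h n < r / 2 := hh.eventually (gt_mem_nhds (half_pos hr))
  refine tendsto_integral_filter_of_dominated_convergence
    ((Set.Icc (-2 : ℝ) 2).indicator fun _ => B * B') ?_ ?_ ?_ ?_
  · exact Eventually.of_forall fun n =>
      (hF.mul (hG.comp (by fun_prop))).aestronglyMeasurable
  · filter_upwards [hsmall] with n hn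
    refine Eventually.of_forall fun u => ?_
    by_cases hu : 2 < |u|
    · rw [hsupp u hu, zero_mul, norm_zero]
      exact Set.indicator_nonneg (fun _ _ => by positivity) _
    · rw [not_lt] at hu
      rw [Set.indicator_of_mem (Set.mem_Icc.2 (abs_le.1 hu)), norm_mul]
      refine mul_le_mul (hB u) (hB' _ ?_) (norm_nonneg _) hB0
      rw [add_sub_cancel_left, abs_mul, abs_of_pos (hpos n)]
      calc h n * |u| ≤ h n * 2 := by gcongr; exact (hpos n).le
        _ < r := by linarith
  · exact (integrable_indicator_iff measurableSet_Icc).2 (integrableOn_const (by simp))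
  · refine Eventually.of_forall fun u => ?_
    refine Tendsto.const_mul _ ?_
    have hlim : Tendsto (fun n => x₀ + h n * u) atTop (𝓝 x₀) := by
      simpa using (hh.mul_const u).const_add x₀
    by_cases hu : 0 ≤ u
    · rw [if_pos hu]
      refine hGr.comp (tendsto_nhdsWithin_iff.2 ⟨hlim, Eventually.of_forall fun n => ?_⟩)
      have := mul_nonneg (hpos n).le hu
      exact Set.mem_Ici.2 (by linarith)
    · rw [if_neg hu]
      refine hGl.comp (tendsto_nhdsWithin_iff.2 ⟨hlim, Eventually.of_forall fun n => ?_⟩)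
      have := mul_neg_of_pos_of_neg (hpos n) (not_le.1 hu)
      exact Set.mem_Iio.2 (by linarith)

/-! ### Sampling from a density with heteroskedastic noise -/

/-- Independent copies of a regressor with density `f` and a noise whose conditional mean is zero,
whose conditional variance is `v`, and whose conditional third absolute moment is bounded. -/
structure NoisySample {Ω : Type*} [MeasurableSpace Ω] (P : Measure Ω) (x e : ℕ → Ω → ℝ)
    (x₀ r : ℝ) (f v : ℝ → ℝ) (vr vl : ℝ) : Prop where
  meas_x : ∀ i, Measurable (x i)
  meas_e : ∀ i, Measurable (e i)
  indep : iIndepFun (fun i ω => (x i ω, e i ω)) P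
  ident : ∀ i, IdentDistrib (fun ω => (x i ω, e i ω)) (fun ω => (x 0 ω, e 0 ω)) P P
  r_pos : 0 < r
  meas_f : Measurable f
  f_bound : ∃ B : ℝ, ∀ t, |t - x₀| < r → |f t| ≤ B
  f_cont : ContinuousAt f x₀
  law : ∀ ψ : ℝ → ℝ, Measurable ψ → (∃ B : ℝ, ∀ t, |ψ t| ≤ B) →
    ∫ ω, ψ (x 0 ω) ∂P = ∫ t, ψ t * f t
  memLp : MemLp (e 0) 3 P
  mean : ∀ ψ : ℝ → ℝ, Measurable ψ → (∃ B : ℝ, ∀ t, |ψ t| ≤ B) → ∫ ω, ψ (x 0 ω) * e 0 ω ∂P = 0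
  meas_v : Measurable v
  v_bound : ∃ B : ℝ, ∀ t, |v t| ≤ B
  var : ∀ ψ : ℝ → ℝ, Measurable ψ → (∃ B : ℝ, ∀ t, |ψ t| ≤ B) →
    ∫ ω, ψ (x 0 ω) * e 0 ω ^ 2 ∂P = ∫ ω, ψ (x 0 ω) * v (x 0 ω) ∂P
  third : ∃ M : ℝ, 0 ≤ M ∧ ∀ ψ : ℝ → ℝ, Measurable ψ → (∃ B : ℝ, ∀ t, |ψ t| ≤ B) →
    (∀ t, 0 ≤ ψ t) → ∫ ω, ψ (x 0 ω) * |e 0 ω| ^ 3 ∂P ≤ M * ∫ ω, ψ (x 0 ω) ∂P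
  v_right : Tendsto v (𝓝[≥] x₀) (𝓝 vr)
  v_left : Tendsto v (𝓝[<] x₀) (𝓝 vl)

namespace NoisySample

variable {Ω : Type*} [MeasurableSpace Ω] {P : Measure Ω}
  {x e : ℕ → Ω → ℝ} {x₀ r : ℝ} {f v : ℝ → ℝ} {vr vl : ℝ}
  (S : NoisySample P x e x₀ r f v vr vl)
  {h : ℕ → ℝ} (hpos : ∀ n, 0 < h n) (hh : Tendsto h atTop (𝓝 0))
  (hnh : Tendsto (fun n : ℕ => (n : ℝ) * h n) atTop atTop)

include S

lemma integral_comp_eq {F : ℝ × ℝ → ℝ} (hF : Measurable F) (i : ℕ) :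
    ∫ ω, F (x i ω, e i ω) ∂P = ∫ ω, F (x 0 ω, e 0 ω) ∂P :=
  ((S.ident i).comp hF).integral_eq

omit S in
variable [IsProbabilityMeasure P] in
lemma _root_.RDD.integrable_of_bounded {g : Ω → ℝ} (hg : Measurable g) {B : ℝ}
    (hB : ∀ ω, |g ω| ≤ B) : Integrable g P :=
  Integrable.of_bound hg.aestronglyMeasurable B (Eventually.of_forall hB)

/-! ### Moments and a law of large numbers in the shrinking window -/

section Window

variable {ψ : ℝ → ℝ} {B : ℝ} (hψ : Measurable ψ) (hB : ∀ u, |ψ u| ≤ B)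
  (hsupp : ∀ u, 2 < |u| → ψ u = 0)

include hpos hh hψ hB hsupp

/-- Expectations of functions supported in the shrinking window. -/
lemma tendsto_expectation :
    Tendsto (fun n => (h n)⁻¹ * ∫ ω, ψ ((x 0 ω - x₀) / h n) ∂P) atTop
      (𝓝 (f x₀ * ∫ u, ψ u)) := by
  obtain ⟨B', hB'⟩ := S.f_bound
  have h1 := tendsto_integral_window S.r_pos hψ hB hsupp S.meas_f hB'
    (S.f_cont.mono_left nhdsWithin_le_nhds) (S.f_cont.mono_left nhdsWithin_le_nhds) hpos hh
  have h2 : ∫ u, (ψ u * if 0 ≤ u then f x₀ else f x₀) = f x₀ * ∫ u, ψ u := by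
    simp only [ite_self]
    rw [integral_mul_const, mul_comm]
  rw [h2] at h1
  refine h1.congr fun n => ?_
  rw [S.law (fun t => ψ ((t - x₀) / h n)) (hψ.comp (by fun_prop)) ⟨B, fun t => hB _⟩]

/-- Second moments of the weighted noise in the shrinking window. -/
lemma tendsto_noise_variance :
    Tendsto (fun n => (h n)⁻¹ * ∫ ω, ψ ((x 0 ω - x₀) / h n) * e 0 ω ^ 2 ∂P) atTop
      (𝓝 (∫ u, ψ u * if 0 ≤ u then vr * f x₀ else vl * f x₀)) := by
  obtain ⟨B', hB'⟩ := S.f_bound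
  obtain ⟨Bv, hBv⟩ := S.v_bound
  have hBv0 : 0 ≤ Bv := (abs_nonneg _).trans (hBv 0)
  have hb : ∀ t, |t - x₀| < r → |v t * f t| ≤ Bv * B' := fun t ht => by
    rw [abs_mul]; exact mul_le_mul (hBv t) (hB' t ht) (abs_nonneg _) hBv0
  have h1 := tendsto_integral_window S.r_pos hψ hB hsupp (S.meas_v.mul S.meas_f) hb
    (S.v_right.mul (S.f_cont.mono_left nhdsWithin_le_nhds))
    (S.v_left.mul (S.f_cont.mono_left nhdsWithin_le_nhds)) hpos hh
  refine h1.congr fun n => ?_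
  have hm : Measurable fun t => ψ ((t - x₀) / h n) := hψ.comp (by fun_prop)
  rw [S.var (fun t => ψ ((t - x₀) / h n)) hm ⟨B, fun t => hB _⟩,
    S.law (fun t => ψ ((t - x₀) / h n) * v t) (hm.mul S.meas_v) ⟨B * Bv, fun t => ?_⟩]
  · simp only [Pi.mul_apply, mul_assoc]
  · rw [abs_mul]; exact mul_le_mul (hB _) (hBv t) (abs_nonneg _) ((abs_nonneg _).trans (hB 0))

include hnh

variable [IsProbabilityMeasure P] in
/-- Law of large numbers for averages over the shrinking window. -/
lemma tendsto_average :
    Tendsto (fun z : ℕ × Ω => ((z.1 : ℝ) * h z.1)⁻¹ *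
      ∑ j ∈ Finset.range z.1, ψ ((x j z.2 - x₀) / h z.1)) (probFilter P)
      (𝓝 (f x₀ * ∫ u, ψ u)) := by
  have hm : ∀ n, Measurable fun t => ψ ((t - x₀) / h n) := fun n => hψ.comp (by fun_prop)
  have hmx : ∀ n j, Measurable fun ω => ψ ((x j ω - x₀) / h n) := fun n j =>
    (hm n).comp (S.meas_x j)
  set A : ℕ → Ω → ℝ := fun n ω => ((n : ℝ) * h n)⁻¹ *
      ∑ j ∈ Finset.range n, ψ ((x j ω - x₀) / h n) with hA
  have hAm : ∀ n, Measurable (A n) := fun n =>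
    (Finset.measurable_sum _ fun j _ => hmx n j).const_mul _
  have hLp : ∀ n j, MemLp (fun ω => ψ ((x j ω - x₀) / h n)) 2 P := fun n j =>
    MemLp.of_bound (hmx n j).aestronglyMeasurable B (Eventually.of_forall fun ω => hB _)
  have hALp : ∀ n, MemLp (A n) 2 P := fun n =>
    (memLp_finsetSum _ fun j _ => hLp n j).const_mul _
  have hE : ∀ n, 0 < n → ∫ ω, A n ω ∂P = (h n)⁻¹ * ∫ ω, ψ ((x 0 ω - x₀) / h n) ∂P := by
    intro n hn
    have hn' : (n : ℝ) ≠ 0 := by positivity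
    simp only [hA]
    rw [integral_const_mul, integral_finsetSum _ fun j _ => (hLp n j).integrable one_le_two]
    have : ∀ j ∈ Finset.range n, ∫ ω, ψ ((x j ω - x₀) / h n) ∂P =
        ∫ ω, ψ ((x 0 ω - x₀) / h n) ∂P := fun j _ =>
      S.integral_comp_eq (F := fun z => ψ ((z.1 - x₀) / h n)) (hψ.comp (by fun_prop)) j
    rw [Finset.sum_congr rfl this, Finset.sum_const, Finset.card_range, nsmul_eq_mul]
    field_simp
  -- By independence the variance is at most `n (nh)⁻² E ψ²`. Since `h⁻¹ E ψ²` converges, this is of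
  -- order `(nh)⁻¹`.
  have hVar : ∀ n, 0 < n → Var[A n; P] ≤
      ((n : ℝ) * h n)⁻¹ * ((h n)⁻¹ * ∫ ω, (fun u => ψ u ^ 2) ((x 0 ω - x₀) / h n) ∂P) := by
    intro n hn
    have hn' : (n : ℝ) ≠ 0 := by positivity
    have hindep : iIndepFun (fun j ω => ψ ((x j ω - x₀) / h n)) P :=
      S.indep.comp (fun _ z => ψ ((z.1 - x₀) / h n)) fun _ => hψ.comp (by fun_prop)
    have h1 : Var[∑ j ∈ Finset.range n, fun ω => ψ ((x j ω - x₀) / h n); P] =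
        ∑ j ∈ Finset.range n, Var[fun ω => ψ ((x j ω - x₀) / h n); P] :=
      IndepFun.variance_sum (fun j _ => hLp n j) fun i _ j _ hij => hindep.indepFun hij
    have h2 : A n = fun ω => ((n : ℝ) * h n)⁻¹ *
        (∑ j ∈ Finset.range n, fun ω => ψ ((x j ω - x₀) / h n)) ω := by
      ext ω; simp [hA]
    rw [h2, variance_const_mul, h1]
    have h3 : ∀ j ∈ Finset.range n, Var[fun ω => ψ ((x j ω - x₀) / h n); P] ≤
        ∫ ω, (fun u => ψ u ^ 2) ((x 0 ω - x₀) / h n) ∂P := by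
      intro j _
      refine (variance_le_expectation_sq (hmx n j).aestronglyMeasurable).trans (le_of_eq ?_)
      exact S.integral_comp_eq (F := fun z => ψ ((z.1 - x₀) / h n) ^ 2)
        ((hψ.comp (by fun_prop)).pow_const 2) j
    refine (mul_le_mul_of_nonneg_left (Finset.sum_le_sum h3) (sq_nonneg _)).trans (le_of_eq ?_)
    rw [Finset.sum_const, Finset.card_range, nsmul_eq_mul]
    have := (hpos n).ne'
    field_simp
  have hsq := S.tendsto_expectation hpos hh (hψ.pow_const 2) (B := B ^ 2)
    (fun u => by rw [abs_pow]; exact pow_le_pow_left₀ (abs_nonneg _) (hB u) 2)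
    (fun u hu => by rw [hsupp u hu]; simp)
  have hlim : Tendsto (fun n => Var[A n; P]) atTop (𝓝 0) := by
    have h1 := (tendsto_inv_atTop_zero.comp hnh).mul hsq
    rw [zero_mul] at h1
    refine tendsto_of_tendsto_of_tendsto_of_le_of_le' tendsto_const_nhds h1
      (Eventually.of_forall fun n => variance_nonneg _ _) ?_
    filter_upwards [eventually_gt_atTop 0] with n hn using hVar n hn
  have hcent : Tendsto (fun z : ℕ × Ω => A z.1 z.2 - ∫ ω, A z.1 ω ∂P) (probFilter P) (𝓝 0) := by
    refine tendsto_probFilter_of_integral_sq (Y := fun n ω => A n ω - ∫ ω, A n ω ∂P)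
      (Eventually.of_forall fun n => ?_) ?_
    · exact ((hALp n).sub (memLp_const _)).integrable_sq
    · refine hlim.congr fun n => ?_
      exact variance_eq_integral (hAm n).aemeasurable
  have hmean : Tendsto (fun n => ∫ ω, A n ω ∂P) atTop (𝓝 (f x₀ * ∫ u, ψ u)) := by
    refine (S.tendsto_expectation hpos hh hψ hB hsupp).congr' ?_
    filter_upwards [eventually_gt_atTop 0] with n hn using (hE n hn).symm
  have := hcent.add (hmean.comp tendsto_fst_probFilter)
  rw [zero_add] at this
  refine this.congr fun z => ?_
  simp only [Function.comp_apply, sub_add_cancel, hA]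

end Window

end NoisySample

/-! ### Noise with regressor-dependent weights -/

namespace NoisySample

variable {Ω : Type*} [MeasurableSpace Ω] {P : Measure Ω} [IsProbabilityMeasure P]
  {x e : ℕ → Ω → ℝ} {x₀ r : ℝ} {f v : ℝ → ℝ} {vr vl : ℝ}
  (S : NoisySample P x e x₀ r f v vr vl)
  {h : ℕ → ℝ} (hpos : ∀ n, 0 < h n) (hh : Tendsto h atTop (𝓝 0))
  (hnh : Tendsto (fun n : ℕ => (n : ℝ) * h n) atTop atTop)

include S

omit [IsProbabilityMeasure P] in
lemma memLp_three (i : ℕ) : MemLp (e i) 3 P :=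
  ((S.ident i).comp measurable_snd).memLp_iff.2 S.memLp

lemma memLp_two (i : ℕ) : MemLp (e i) 2 P :=
  (S.memLp_three i).mono_exponent (by norm_num)

lemma integrable_mul_sq {g : Ω → ℝ} (hg : Measurable g) {B : ℝ} (hB : ∀ ω, |g ω| ≤ B) (i : ℕ) :
    Integrable (fun ω => g ω * e i ω ^ 2) P :=
  (S.memLp_two i).integrable_sq.bdd_mul hg.aestronglyMeasurable (Eventually.of_forall hB)

omit [IsProbabilityMeasure P] in
/-- An observation is independent of all the others. -/
lemma indepFun_others (i : ℕ) :
    IndepFun (fun ω => (x i ω, e i ω))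
      (fun ω k => if k = i then (0 : ℝ × ℝ) else (x k ω, e k ω)) P := by
  have hm : ∀ k, Measurable fun ω => (x k ω, e k ω) := fun k => (S.meas_x k).prodMk (S.meas_e k)
  have h := indep_iSup_of_disjoint (fun k => (hm k).comap_le) S.indep.iIndep
    (S := {i}) (T := {i}ᶜ) disjoint_compl_right
  refine indep_of_indep_of_le_left (indep_of_indep_of_le_right h ?_) ?_
  · refine Measurable.comap_le ?_
    refine @measurable_pi_lambda _ _ _ (_) _ _ fun k => ?_
    by_cases hk : k = i
    · simp only [hk, if_true]; exact @measurable_const _ _ _ (_) _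
    · simp only [hk, if_false]
      refine Measurable.mono (comap_measurable fun ω => (x k ω, e k ω)) ?_ le_rfl
      exact le_biSup (fun k => MeasurableSpace.comap (fun ω => (x k ω, e k ω)) inferInstance)
        (Set.mem_compl_singleton_iff.2 hk)
  · exact le_biSup (fun k => MeasurableSpace.comap (fun ω => (x k ω, e k ω)) inferInstance)
      (Set.mem_singleton i)

/-- Noises of different observations are uncorrelated given the regressors. -/
lemma integral_cross_eq_zero {G : (ℕ → ℝ) → ℝ} (hG : Measurable G) {B : ℝ} (hB : ∀ X, |G X| ≤ B)
    {i j : ℕ} (hij : j ≠ i) :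
    ∫ ω, G (fun k => x k ω) * (e i ω * e j ω) ∂P = 0 := by
  have hm : ∀ k, Measurable fun ω => (x k ω, e k ω) := fun k => (S.meas_x k).prodMk (S.meas_e k)
  have hW : Measurable fun ω k => if k = i then (0 : ℝ × ℝ) else (x k ω, e k ω) := by
    refine measurable_pi_lambda _ fun k => ?_
    by_cases hk : k = i
    · simp only [hk, if_true]; exact measurable_const
    · simp only [hk, if_false]; exact hm k
  set μ := P.map fun ω => (x i ω, e i ω) with hμ
  set ν := P.map fun ω k => if k = i then (0 : ℝ × ℝ) else (x k ω, e k ω) with hν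
  have : IsProbabilityMeasure μ := Measure.isProbabilityMeasure_map (hm i).aemeasurable
  have : IsProbabilityMeasure ν := Measure.isProbabilityMeasure_map hW.aemeasurable
  have hprod := (S.indepFun_others i).map_prod_eq_prod_map_map (hm i).aemeasurable hW.aemeasurable
  -- Observation `i` is separated from the rest, so the joint law is a product. With the rest
  -- frozen, `e j` is a constant and the weight a bounded function of `x i` alone, so the inner
  -- integral vanishes by the mean-zero property of `e i`.
  set H : (ℝ × ℝ) × (ℕ → ℝ × ℝ) → ℝ := fun z =>
    G (fun k => if k = i then z.1.1 else (z.2 k).1) * (z.1.2 * (z.2 j).2) with hH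
  have hsub : Measurable fun z : (ℝ × ℝ) × (ℕ → ℝ × ℝ) =>
      (fun k => if k = i then z.1.1 else (z.2 k).1 : ℕ → ℝ) := by
    refine measurable_pi_lambda _ fun k => ?_
    by_cases hk : k = i
    · simp only [hk, if_true]; fun_prop
    · simp only [hk, if_false]; fun_prop
  have hHm : Measurable H := (hG.comp hsub).mul (by fun_prop)
  have hcomp : ∀ ω, G (fun k => x k ω) * (e i ω * e j ω) =
      H ((x i ω, e i ω), fun k => if k = i then (0 : ℝ × ℝ) else (x k ω, e k ω)) := by
    intro ω
    simp only [hH, hij, if_false]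
    congr 2
    ext k
    by_cases hk : k = i
    · simp [hk]
    · simp [hk]
  have hintP : Integrable (fun ω => G (fun k => x k ω) * (e i ω * e j ω)) P :=
    ((S.memLp_two i).integrable_mul (S.memLp_two j)).bdd_mul
      (hG.comp (measurable_pi_lambda _ S.meas_x)).aestronglyMeasurable
      (Eventually.of_forall fun ω => hB _)
  simp only [hcomp] at hintP ⊢
  have hpair : Measurable fun ω => ((x i ω, e i ω),
      fun k => if k = i then (0 : ℝ × ℝ) else (x k ω, e k ω)) := (hm i).prodMk hW
  have hint : Integrable H (μ.prod ν) := by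
    rw [← hprod]
    exact (integrable_map_measure hHm.aestronglyMeasurable hpair.aemeasurable).2 hintP
  rw [← integral_map (φ := fun ω => ((x i ω, e i ω),
      fun k => if k = i then (0 : ℝ × ℝ) else (x k ω, e k ω))) hpair.aemeasurable
      hHm.aestronglyMeasurable, hprod, integral_prod_symm H hint]
  refine integral_eq_zero_of_ae (Eventually.of_forall fun w => ?_)
  have hinner : Measurable fun t : ℝ => G (fun k => if k = i then t else (w k).1) := by
    refine hG.comp (measurable_pi_lambda _ fun k => ?_)
    by_cases hk : k = i
    · simp only [hk, if_true]; exact measurable_id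
    · simp only [hk, if_false]; exact measurable_const
  have h1 : ∀ z : ℝ × ℝ, H (z, w) =
      (G (fun k => if k = i then z.1 else (w k).1) * z.2) * (w j).2 := by
    intro z; simp only [hH]; ring
  have h2 : Measurable fun z : ℝ × ℝ => G (fun k => if k = i then z.1 else (w k).1) * z.2 :=
    (hinner.comp measurable_fst).mul measurable_snd
  simp only [h1, Pi.zero_apply]
  rw [integral_mul_const, hμ, integral_map (hm i).aemeasurable h2.aestronglyMeasurable,
    S.integral_comp_eq h2 i,
    S.mean (fun t => G (fun k => if k = i then t else (w k).1)) hinner ⟨B, fun t => hB _⟩, zero_mul]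

/-- The second moment of a sum of noises weighted by bounded functions of the regressors. -/
lemma integral_sum_sq {D : ℕ → (ℕ → ℝ) → ℝ} (hD : ∀ j, Measurable (D j)) {B : ℝ}
    (hB : ∀ j X, |D j X| ≤ B) (n : ℕ) :
    Integrable (fun ω => (∑ j ∈ Finset.range n, D j (fun k => x k ω) * e j ω) ^ 2) P ∧
    ∫ ω, (∑ j ∈ Finset.range n, D j (fun k => x k ω) * e j ω) ^ 2 ∂P =
      ∑ j ∈ Finset.range n, ∫ ω, D j (fun k => x k ω) ^ 2 * e j ω ^ 2 ∂P := by
  have hX : Measurable fun ω k => x k ω := measurable_pi_lambda _ S.meas_x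
  have hB0 : 0 ≤ B := (abs_nonneg _).trans (hB 0 0)
  have hexp : ∀ ω, (∑ j ∈ Finset.range n, D j (fun k => x k ω) * e j ω) ^ 2 =
      ∑ i ∈ Finset.range n, ∑ j ∈ Finset.range n,
        (D i (fun k => x k ω) * D j (fun k => x k ω)) * (e i ω * e j ω) := by
    intro ω
    rw [sq, Finset.sum_mul_sum]
    refine Finset.sum_congr rfl fun i _ => Finset.sum_congr rfl fun j _ => ?_
    ring
  have hDD : ∀ i j, Measurable fun X => D i X * D j X := fun i j => (hD i).mul (hD j)
  have hDDB : ∀ i j X, |D i X * D j X| ≤ B * B := fun i j X => by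
    rw [abs_mul]; exact mul_le_mul (hB i X) (hB j X) (abs_nonneg _) hB0
  have hint : ∀ i j, Integrable (fun ω => (D i (fun k => x k ω) * D j (fun k => x k ω)) *
      (e i ω * e j ω)) P := fun i j =>
    ((S.memLp_two i).integrable_mul (S.memLp_two j)).bdd_mul
      ((hDD i j).comp hX).aestronglyMeasurable (Eventually.of_forall fun ω => hDDB i j _)
  simp only [hexp]
  refine ⟨integrable_finsetSum _ fun i _ => integrable_finsetSum _ fun j _ => hint i j, ?_⟩
  rw [integral_finsetSum _ fun i _ => integrable_finsetSum _ fun j _ => hint i j]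
  refine Finset.sum_congr rfl fun i hi => ?_
  rw [integral_finsetSum _ fun j _ => hint i j, Finset.sum_eq_single i]
  · congr 1; ext ω; ring
  · intro j _ hji
    exact S.integral_cross_eq_zero (hDD i j) (hDDB i j) hji
  · intro h; exact absurd hi h

include hpos hh

/-- Noise weighted by uniformly negligible functions of the regressors is negligible. -/
lemma tendsto_negligible {D : ℕ → ℕ → (ℕ → ℝ) → ℝ} (hD : ∀ n j, Measurable (D n j))
    (hsupp : ∀ n j X, 2 < |(X j - x₀) / h n| → D n j X = 0)
    (hsmall : ∀ ε > 0, ∀ᶠ z : ℕ × Ω in probFilter P, ∀ j < z.1,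
      |D z.1 j (fun k => x k z.2)| ≤ ε) :
    Tendsto (fun z : ℕ × Ω => (Real.sqrt (z.1 * h z.1))⁻¹ *
      ∑ j ∈ Finset.range z.1, D z.1 j (fun k => x k z.2) * e j z.2) (probFilter P) (𝓝 0) := by
  have hX : Measurable fun ω k => x k ω := measurable_pi_lambda _ S.meas_x
  set ψ : ℝ → ℝ := (Set.Icc (-2 : ℝ) 2).indicator fun _ => 1 with hψdef
  have hψ : Measurable ψ := measurable_const.indicator measurableSet_Icc
  have hψB : ∀ u, |ψ u| ≤ 1 := fun u => by
    rw [hψdef]; by_cases hu : u ∈ Set.Icc (-2 : ℝ) 2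
    · rw [Set.indicator_of_mem hu]; simp
    · rw [Set.indicator_of_notMem hu]; simp
  have hψsupp : ∀ u, 2 < |u| → ψ u = 0 := fun u hu => by
    rw [hψdef, Set.indicator_of_notMem]
    exact fun h => absurd (abs_le.2 h) (not_le.2 hu)
  have hψone : ∀ u, |u| ≤ 2 → ψ u = 1 := fun u hu => by
    rw [hψdef, Set.indicator_of_mem (Set.mem_Icc.2 (abs_le.1 hu))]
  have hvar := S.tendsto_noise_variance hpos hh hψ hψB hψsupp
  set V := ∫ u, ψ u * if 0 ≤ u then vr * f x₀ else vl * f x₀ with hV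
  have hVn : ∀ᶠ n in atTop, (h n)⁻¹ * ∫ ω, ψ ((x 0 ω - x₀) / h n) * e 0 ω ^ 2 ∂P ≤ |V| + 1 :=
    (hvar.eventually (gt_mem_nhds (show V < |V| + 1 by linarith [le_abs_self V]))).mono
      fun _ h => h.le
  rw [Metric.tendsto_nhds]
  intro η hη
  rw [eventually_probFilter, ENNReal.tendsto_nhds_zero]
  intro θ hθ
  obtain ⟨θ', hθ'0, hθ'⟩ : ∃ θ' : ℝ, 0 < θ' ∧ ENNReal.ofReal θ' ≤ θ / 2 := by
    -- The tolerance is an extended nonnegative number; an infinite one has no real counterpart.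
    by_cases hθt : θ = ∞
    · exact ⟨1, one_pos, by simp [hθt, ENNReal.top_div]⟩
    · refine ⟨(θ / 2).toReal, ENNReal.toReal_pos (ENNReal.half_pos hθ.ne').ne'
        (ENNReal.div_ne_top hθt two_ne_zero), ?_⟩
      rw [ENNReal.ofReal_toReal (ENNReal.div_ne_top hθt two_ne_zero)]
  -- Chosen so that `δ² (|V| + 1) = θ' η²`: Chebyshev at level `η` then gives probability at most
  -- `θ'`.
  set δ : ℝ := Real.sqrt (θ' * η ^ 2 / (|V| + 1)) with hδ
  have hδpos : 0 < δ := Real.sqrt_pos.2 (by positivity)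
  have hδsq : δ ^ 2 * (|V| + 1) = θ' * η ^ 2 := by
    rw [hδ, Real.sq_sqrt (by positivity)]; field_simp
  -- The weights are small only with high probability, while moment bounds need them small
  -- everywhere. Setting them to zero where they exceed `δ` changes nothing on the good event.
  set D' : ℕ → ℕ → (ℕ → ℝ) → ℝ := fun n j =>
    (D n j ⁻¹' Set.Icc (-δ) δ).indicator (D n j) with hD'def
  have hD' : ∀ n j, Measurable (D' n j) := fun n j =>
    (hD n j).indicator ((hD n j) measurableSet_Icc)
  have hD'B : ∀ n j X, |D' n j X| ≤ δ := fun n j X => by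
    by_cases hX : X ∈ D n j ⁻¹' Set.Icc (-δ) δ
    · simp only [hD'def]; rw [Set.indicator_of_mem hX]; exact abs_le.2 hX
    · simp only [hD'def]; rw [Set.indicator_of_notMem hX]; simpa using hδpos.le
  have hD'sq : ∀ n j X, D' n j X ^ 2 ≤ δ ^ 2 * ψ ((X j - x₀) / h n) := fun n j X => by
    by_cases hX : 2 < |(X j - x₀) / h n|
    · have : D' n j X = 0 := Set.indicator_apply_eq_zero.2 fun _ => hsupp n j X hX
      rw [this, hψsupp _ hX]; simp
    · rw [hψone _ (not_lt.1 hX), mul_one, ← sq_abs]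
      exact pow_le_pow_left₀ (abs_nonneg _) (hD'B n j X) 2
  have hgood := eventually_probFilter.1 (hsmall δ hδpos)
  have hgood' := (ENNReal.tendsto_nhds_zero.1 hgood) (θ / 2) (ENNReal.half_pos hθ.ne')
  filter_upwards [hgood', hVn, eventually_gt_atTop 0] with n hn1 hn2 hn0
  have hnh0 : 0 < (n : ℝ) * h n := mul_pos (by exact_mod_cast hn0) (hpos n)
  set R : Ω → ℝ := fun ω => ∑ j ∈ Finset.range n, D' n j (fun k => x k ω) * e j ω with hR
  obtain ⟨hRint, hRsq⟩ := S.integral_sum_sq (hD' n) (hD'B n) n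
  have hbound : ∫ ω, R ω ^ 2 ∂P ≤ ((n : ℝ) * h n) * (θ' * η ^ 2) := by
    rw [hRsq]
    have hterm : ∀ j ∈ Finset.range n, ∫ ω, D' n j (fun k => x k ω) ^ 2 * e j ω ^ 2 ∂P ≤
        δ ^ 2 * ∫ ω, ψ ((x 0 ω - x₀) / h n) * e 0 ω ^ 2 ∂P := by
      intro j _
      have hm : Measurable fun z : ℝ × ℝ => ψ ((z.1 - x₀) / h n) * z.2 ^ 2 :=
        (hψ.comp (by fun_prop)).mul (by fun_prop)
      rw [← S.integral_comp_eq hm j, ← integral_const_mul]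
      refine integral_mono (S.integrable_mul_sq (((hD' n j).comp hX).pow_const 2) (B := δ ^ 2)
        (fun ω => ?_) j) ((S.integrable_mul_sq (hψ.comp (((S.meas_x j).sub_const x₀).div_const (h n)))
        (fun ω => hψB ((x j ω - x₀) / h n)) j).const_mul _) fun ω => ?_
      · rw [abs_pow]; exact pow_le_pow_left₀ (abs_nonneg _) (hD'B _ _ _) 2
      · simp only
        rw [← mul_assoc]
        exact mul_le_mul_of_nonneg_right (hD'sq n j fun k => x k ω) (sq_nonneg _)
    refine (Finset.sum_le_sum hterm).trans ?_
    rw [Finset.sum_const, Finset.card_range, nsmul_eq_mul, ← hδsq]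
    have h1 : ∫ ω, ψ ((x 0 ω - x₀) / h n) * e 0 ω ^ 2 ∂P ≤ h n * (|V| + 1) := by
      rwa [inv_mul_le_iff₀ (hpos n)] at hn2
    calc (n : ℝ) * (δ ^ 2 * ∫ ω, ψ ((x 0 ω - x₀) / h n) * e 0 ω ^ 2 ∂P)
        ≤ (n : ℝ) * (δ ^ 2 * (h n * (|V| + 1))) := by gcongr
      _ = _ := by ring
  have hmarkov := mul_meas_ge_le_integral_of_nonneg (μ := P)
    (Eventually.of_forall fun ω => sq_nonneg (R ω)) hRint (((n : ℝ) * h n) * η ^ 2)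
  have hPR : P {ω | ((n : ℝ) * h n) * η ^ 2 ≤ R ω ^ 2} ≤ θ / 2 := by
    refine le_trans ?_ hθ'
    rw [← ENNReal.ofReal_toReal (measure_ne_top P _)]
    refine ENNReal.ofReal_le_ofReal ?_
    have h2 := hmarkov.trans hbound
    have h3 : ((n : ℝ) * h n * η ^ 2) * (P {ω | ((n : ℝ) * h n) * η ^ 2 ≤ R ω ^ 2}).toReal ≤
        ((n : ℝ) * h n * η ^ 2) * θ' := by
      refine le_trans h2 (le_of_eq ?_); ring
    exact le_of_mul_le_mul_left h3 (by positivity)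
  rw [← ENNReal.add_halves θ]
  refine (measure_mono fun ω hω => ?_).trans ((measure_union_le _ _).trans (add_le_add hn1 hPR))
  by_cases hg : ∀ j < n, |D n j (fun k => x k ω)| ≤ δ
  · refine Or.inr ?_
    have hsame : R ω = ∑ j ∈ Finset.range n, D n j (fun k => x k ω) * e j ω := by
      refine Finset.sum_congr rfl fun j hj => ?_
      simp only [hD'def]
      rw [Set.indicator_of_mem]
      exact abs_le.1 (hg j (Finset.mem_range.1 hj))
    simp only [Set.mem_ofPred_eq, not_lt, Real.dist_eq, sub_zero] at hω ⊢
    rw [← hsame] at hω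
    have h4 := pow_le_pow_left₀ hη.le hω 2
    rw [sq_abs, mul_pow, inv_pow, Real.sq_sqrt hnh0.le] at h4
    rwa [le_inv_mul_iff₀ hnh0] at h4
  · exact Or.inl hg

end NoisySample

/-! ### A central limit theorem for noise in a shrinking window -/

/-- For `|y| ≤ 1` this is the Taylor remainder. For `|y| > 1` every term is at most a multiple of
`|y| ^ 3`, with total `1 + 1 + 1 + 1/2 ≤ 4`. -/
lemma norm_exp_mul_I_sub_le (y : ℝ) :
    ‖Complex.exp (y * Complex.I) - (1 + y * Complex.I - (y : ℂ) ^ 2 / 2)‖ ≤ 4 * |y| ^ 3 := by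
  have hnorm : ‖(y : ℂ) * Complex.I‖ = |y| := by simp
  by_cases hy : |y| ≤ 1
  · have h := Complex.exp_bound (x := y * Complex.I) (by rwa [hnorm]) (n := 3) (by norm_num)
    have hs : ∑ m ∈ Finset.range 3, ((y : ℂ) * Complex.I) ^ m / (m.factorial : ℂ) =
        1 + y * Complex.I - (y : ℂ) ^ 2 / 2 := by
      have hI : ((y : ℂ) * Complex.I) ^ 2 = -(y : ℂ) ^ 2 := by
        rw [mul_pow, Complex.I_sq]; ring
      simp only [Finset.sum_range_succ, Finset.sum_range_zero, hI, Nat.factorial]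
      norm_num
      ring
    rw [hs, hnorm] at h
    refine h.trans ?_
    rw [mul_comm]
    refine mul_le_mul_of_nonneg_right ?_ (by positivity)
    norm_num [Nat.factorial]
  · rw [not_le] at hy
    have h1 : ‖Complex.exp (y * Complex.I)‖ = 1 := Complex.norm_exp_ofReal_mul_I y
    have h2 : ‖1 + (y : ℂ) * Complex.I - (y : ℂ) ^ 2 / 2‖ ≤ 1 + |y| + |y| ^ 2 / 2 := by
      refine (norm_sub_le _ _).trans (add_le_add ((norm_add_le _ _).trans ?_) ?_)
      · rw [hnorm, norm_one]
      · rw [norm_div, norm_pow]; simp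
    refine (norm_sub_le _ _).trans ?_
    rw [h1]
    have h3 : 1 ≤ |y| ^ 3 := one_le_pow₀ hy.le
    have h4 : |y| ≤ |y| ^ 3 := by
      calc |y| = |y| ^ 1 := (pow_one _).symm
        _ ≤ |y| ^ 3 := pow_le_pow_right₀ hy.le (by norm_num)
    have h5 : |y| ^ 2 ≤ |y| ^ 3 := pow_le_pow_right₀ hy.le (by norm_num)
    linarith

/-- Second-order expansion of the characteristic function of a centered random variable. -/
lemma norm_charFun_sub_le {Ω : Type*} [MeasurableSpace Ω] {P : Measure Ω} [IsProbabilityMeasure P]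
    {Y : Ω → ℝ} (hY : MemLp Y 3 P) (hmean : ∫ ω, Y ω ∂P = 0) (t : ℝ) :
    ‖charFun (P.map Y) t - (1 - ((t ^ 2 * ∫ ω, Y ω ^ 2 ∂P) / 2 : ℝ))‖ ≤
      4 * |t| ^ 3 * ∫ ω, |Y ω| ^ 3 ∂P := by
  have hY1 : Integrable Y P := hY.integrable (by norm_num)
  have hY2 : Integrable (fun ω => Y ω ^ 2) P := (hY.mono_exponent (by norm_num)).integrable_sq
  have hY3 : Integrable (fun ω => |Y ω| ^ 3) P := by
    simpa using hY.integrable_norm_pow (by norm_num)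
  have hexp : Integrable (fun ω => Complex.exp ((t * Y ω : ℝ) * Complex.I)) P := by
    refine Integrable.of_bound (C := 1) ?_ (Eventually.of_forall fun ω => ?_)
    · have hc : Continuous fun y : ℝ => Complex.exp ((t * y : ℝ) * Complex.I) := by fun_prop
      exact hc.comp_aestronglyMeasurable hY.aestronglyMeasurable
    · rw [Complex.norm_exp_ofReal_mul_I]
  have hchar : charFun (P.map Y) t = ∫ ω, Complex.exp ((t * Y ω : ℝ) * Complex.I) ∂P := by
    rw [charFun_apply_real, integral_map hY.aestronglyMeasurable.aemeasurable]
    · simp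
    · exact (by fun_prop : Continuous fun y : ℝ =>
        Complex.exp ((t : ℂ) * (y : ℂ) * Complex.I)).aestronglyMeasurable
  have hpolyint : Integrable (fun ω => (1 + ((t * Y ω : ℝ) : ℂ) * Complex.I -
      ((t * Y ω : ℝ) : ℂ) ^ 2 / 2)) P := by
    have h1 : Integrable (fun ω => ((t * Y ω : ℝ) : ℂ) * Complex.I) P :=
      ((hY1.const_mul t).ofReal).mul_const _
    have h2 : Integrable (fun ω => ((t * Y ω : ℝ) : ℂ) ^ 2 / 2) P := by
      have : Integrable (fun ω => (((t ^ 2 * Y ω ^ 2 / 2 : ℝ)) : ℂ)) P :=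
        ((hY2.const_mul (t ^ 2)).div_const 2).ofReal
      refine this.congr (Eventually.of_forall fun ω => ?_)
      push_cast; ring
    exact ((integrable_const _).add h1).sub h2
  have hpoly : ∫ ω, (1 + ((t * Y ω : ℝ) : ℂ) * Complex.I - ((t * Y ω : ℝ) : ℂ) ^ 2 / 2) ∂P =
      1 - (((t ^ 2 * ∫ ω, Y ω ^ 2 ∂P) / 2 : ℝ) : ℂ) := by
    have h1 : Integrable (fun ω => ((t * Y ω : ℝ) : ℂ) * Complex.I) P :=
      ((hY1.const_mul t).ofReal).mul_const _
    have h2 : Integrable (fun ω => (((t ^ 2 * Y ω ^ 2 / 2 : ℝ)) : ℂ)) P :=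
      ((hY2.const_mul (t ^ 2)).div_const 2).ofReal
    have heq : ∀ ω, (1 + ((t * Y ω : ℝ) : ℂ) * Complex.I - ((t * Y ω : ℝ) : ℂ) ^ 2 / 2) =
        1 + ((t * Y ω : ℝ) : ℂ) * Complex.I - ((t ^ 2 * Y ω ^ 2 / 2 : ℝ) : ℂ) := by
      intro ω; push_cast; ring
    simp only [heq]
    have h0 : Integrable (fun ω => 1 + ((t * Y ω : ℝ) : ℂ) * Complex.I) P :=
      (integrable_const _).add h1
    rw [integral_sub h0 h2, integral_add (integrable_const _) h1, integral_mul_const,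
      integral_complex_ofReal, integral_complex_ofReal, integral_const_mul,
      hmean, integral_div, integral_const_mul]
    simp
  rw [hchar, ← hpoly, ← integral_sub hexp hpolyint, ← integral_const_mul]
  refine norm_integral_le_of_norm_le (hY3.const_mul _) (Eventually.of_forall fun ω => ?_)
  refine (norm_exp_mul_I_sub_le _).trans (le_of_eq ?_)
  rw [abs_mul, mul_pow]; ring

namespace NoisySample

variable {Ω : Type*} [MeasurableSpace Ω] {P : Measure Ω} [IsProbabilityMeasure P]
  {x e : ℕ → Ω → ℝ} {x₀ r : ℝ} {f v : ℝ → ℝ} {vr vl : ℝ}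
  (S : NoisySample P x e x₀ r f v vr vl)
  {h : ℕ → ℝ} (hpos : ∀ n, 0 < h n) (hh : Tendsto h atTop (𝓝 0))
  (hnh : Tendsto (fun n : ℕ => (n : ℝ) * h n) atTop atTop)

include S hpos hh hnh

/-- A Lyapunov central limit theorem. The rows are i.i.d., so the characteristic function is an
`n`-th power `φ_n ^ n`. A second-order expansion gives `n (φ_n - 1) → -V t² / 2`, and the
exponential limit follows. -/
theorem tendstoInDistribution_noise {b : ℝ → ℝ} (hb : Measurable b) {B : ℝ}
    (hB : ∀ u, |b u| ≤ B) (hsupp : ∀ u, 2 < |u| → b u = 0) {V : ℝ≥0}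
    (hV : ∫ u, b u ^ 2 * (if 0 ≤ u then vr * f x₀ else vl * f x₀) = V) :
    TendstoInDistribution (fun n ω => (Real.sqrt (n * h n))⁻¹ *
      ∑ j ∈ Finset.range n, b ((x j ω - x₀) / h n) * e j ω) atTop (id : ℝ → ℝ) (fun _ => P)
      (gaussianReal 0 V) := by
  have hB0 : 0 ≤ B := (abs_nonneg _).trans (hB 0)
  have hbm : ∀ n, Measurable fun t => b ((t - x₀) / h n) := fun n => hb.comp (by fun_prop)
  set ξ : ℕ → ℕ → Ω → ℝ := fun n j ω => b ((x j ω - x₀) / h n) * e j ω with hξ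
  have hFm : ∀ n, Measurable fun z : ℝ × ℝ => b ((z.1 - x₀) / h n) * z.2 := fun n =>
    (hb.comp (by fun_prop)).mul measurable_snd
  have hξm : ∀ n j, Measurable (ξ n j) := fun n j =>
    (hFm n).comp ((S.meas_x j).prodMk (S.meas_e j))
  have hident : ∀ n j, IdentDistrib (ξ n j) (ξ n 0) P P := fun n j => (S.ident j).comp (hFm n)
  have hindep : ∀ n, iIndepFun (ξ n) P := fun n => S.indep.comp _ fun _ => hFm n
  refine ⟨fun n => ((Finset.measurable_sum _ fun j _ => hξm n j).const_mul _).aemeasurable,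
    aemeasurable_id, ?_⟩
  refine ProbabilityMeasure.tendsto_iff_tendsto_charFun.2 fun t => ?_
  simp only [ProbabilityMeasure.coe_mk, Measure.map_id, charFun_gaussianReal]
  have hchar : ∀ n : ℕ, charFun (P.map fun ω => (Real.sqrt (n * h n))⁻¹ *
      ∑ j ∈ Finset.range n, ξ n j ω) t =
      (charFun (P.map (ξ n 0)) ((Real.sqrt (n * h n))⁻¹ * t)) ^ n := by
    intro n
    rw [charFun_map_mul_comp, ((hindep n).restrict _).charFun_map_fun_finsetSum_eq_prod
      (fun _ _ => (hξm n _).aemeasurable)]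
    · simp [fun i => (hident n i).map_eq]
    · exact (Finset.measurable_sum _ fun j _ => hξm n j).aemeasurable
  have hLp : ∀ n, MemLp (ξ n 0) 3 P := by
    intro n
    refine MemLp.of_le_mul (c := B) S.memLp (hξm n 0).aestronglyMeasurable
      (Eventually.of_forall fun ω => ?_)
    rw [norm_mul]
    exact mul_le_mul_of_nonneg_right (hB _) (norm_nonneg _)
  have hmean : ∀ n, ∫ ω, ξ n 0 ω ∂P = 0 := fun n => S.mean _ (hbm n) ⟨B, fun t => hB _⟩
  have hsq : Tendsto (fun n => (h n)⁻¹ * ∫ ω, ξ n 0 ω ^ 2 ∂P) atTop (𝓝 V) := by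
    have := S.tendsto_noise_variance hpos hh (hb.pow_const 2) (B := B ^ 2)
      (fun u => by rw [abs_pow]; exact pow_le_pow_left₀ (abs_nonneg _) (hB u) 2)
      (fun u hu => by rw [hsupp u hu]; simp)
    rw [hV] at this
    simpa only [hξ, mul_pow] using this
  -- The third absolute moment of one term is of order `h`, because the weight lives on a window of
  -- that width. The sum is therefore of order `n (nh) ^ (-3/2) h = (nh) ^ (-1/2)`.
  have hcube : Tendsto (fun n : ℕ => (n : ℝ) * ((Real.sqrt (n * h n))⁻¹ ^ 3 *
      ∫ ω, |ξ n 0 ω| ^ 3 ∂P)) atTop (𝓝 0) := by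
    obtain ⟨M, hM0, hM⟩ := S.third
    have h1 := S.tendsto_expectation hpos hh ((hb.abs).pow_const 3) (B := B ^ 3)
      (fun u => by rw [abs_pow, abs_abs]; exact pow_le_pow_left₀ (abs_nonneg _) (hB u) 3)
      (fun u hu => by rw [hsupp u hu]; simp)
    have h2 : Tendsto (fun n : ℕ => (Real.sqrt (n * h n))⁻¹) atTop (𝓝 0) :=
      tendsto_inv_atTop_zero.comp (Real.tendsto_sqrt_atTop.comp hnh)
    have h3 := h2.mul (h1.const_mul M)
    rw [zero_mul] at h3
    refine tendsto_of_tendsto_of_tendsto_of_le_of_le' tendsto_const_nhds h3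
      (Eventually.of_forall fun n => ?_) ?_
    · have : 0 ≤ ∫ ω, |ξ n 0 ω| ^ 3 ∂P := integral_nonneg fun ω => by positivity
      positivity
    · filter_upwards [eventually_gt_atTop 0] with n hn
      have hn' : (0 : ℝ) < n := by exact_mod_cast hn
      have hnh0 : 0 < (n : ℝ) * h n := mul_pos hn' (hpos n)
      have h4 := hM (fun t => |b ((t - x₀) / h n)| ^ 3) ((hbm n).abs.pow_const 3)
        ⟨B ^ 3, fun t => by
          rw [abs_pow, abs_abs]; exact pow_le_pow_left₀ (abs_nonneg _) (hB _) 3⟩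
        (fun t => by positivity)
      have h5 : ∫ ω, |ξ n 0 ω| ^ 3 ∂P ≤ M * ∫ ω, |b ((x 0 ω - x₀) / h n)| ^ 3 ∂P := by
        simpa only [hξ, abs_mul, mul_pow] using h4
      have h6 : (n : ℝ) * (Real.sqrt (n * h n))⁻¹ ^ 3 = (Real.sqrt (n * h n))⁻¹ * (h n)⁻¹ := by
        have hs : Real.sqrt (n * h n) ^ 2 = n * h n := Real.sq_sqrt hnh0.le
        have hs0 : 0 < Real.sqrt (n * h n) := Real.sqrt_pos.2 hnh0
        have hs3 : (Real.sqrt (n * h n))⁻¹ ^ 3 = (Real.sqrt (n * h n))⁻¹ * ((n : ℝ) * h n)⁻¹ := by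
          have hs2 : ((n : ℝ) * h n)⁻¹ = (Real.sqrt (n * h n))⁻¹ ^ 2 := by rw [inv_pow, hs]
          rw [hs2]; ring
        rw [hs3]
        field_simp
      calc (n : ℝ) * ((Real.sqrt (n * h n))⁻¹ ^ 3 * ∫ ω, |ξ n 0 ω| ^ 3 ∂P)
          = (Real.sqrt (n * h n))⁻¹ * (h n)⁻¹ * ∫ ω, |ξ n 0 ω| ^ 3 ∂P := by
            rw [← mul_assoc, h6]
        _ ≤ (Real.sqrt (n * h n))⁻¹ * (h n)⁻¹ *
              (M * ∫ ω, |b ((x 0 ω - x₀) / h n)| ^ 3 ∂P) := by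
            refine mul_le_mul_of_nonneg_left h5 ?_
            have := (hpos n).le
            positivity
        _ = _ := by ring
  set φ : ℕ → ℂ := fun n => charFun (P.map (ξ n 0)) ((Real.sqrt (n * h n))⁻¹ * t) with hφ
  have hφlim : Tendsto (fun n : ℕ => (n : ℂ) * (φ n - 1)) atTop (𝓝 (-(V * t ^ 2 / 2 : ℝ))) := by
    have hmain : Tendsto (fun n : ℕ => ((-(t ^ 2 * ((h n)⁻¹ * ∫ ω, ξ n 0 ω ^ 2 ∂P)) / 2 : ℝ) : ℂ))
        atTop (𝓝 (-(V * t ^ 2 / 2 : ℝ))) := by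
      have h1 := ((hsq.const_mul (t ^ 2)).neg.div_const 2)
      have h2 := (Complex.continuous_ofReal.tendsto _).comp h1
      have h3 : ((-(t ^ 2 * (V : ℝ)) / 2 : ℝ) : ℂ) = -((V * t ^ 2 / 2 : ℝ) : ℂ) := by
        push_cast; ring
      rw [h3] at h2
      exact h2
    have herr : Tendsto (fun n : ℕ => (n : ℂ) * (φ n - 1) -
        ((-(t ^ 2 * ((h n)⁻¹ * ∫ ω, ξ n 0 ω ^ 2 ∂P)) / 2 : ℝ) : ℂ)) atTop (𝓝 0) := by
      have hlim := hcube.const_mul (4 * |t| ^ 3)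
      rw [mul_zero] at hlim
      refine squeeze_zero_norm' ?_ hlim
      filter_upwards [eventually_gt_atTop 0] with n hn
      have hn' : (0 : ℝ) < n := by exact_mod_cast hn
      have hnh0 : 0 < (n : ℝ) * h n := mul_pos hn' (hpos n)
      have hb := norm_charFun_sub_le (hLp n) (hmean n) ((Real.sqrt (n * h n))⁻¹ * t)
      have hsq' : ((Real.sqrt (n * h n))⁻¹ * t) ^ 2 = ((n : ℝ) * h n)⁻¹ * t ^ 2 := by
        rw [mul_pow, inv_pow, Real.sq_sqrt hnh0.le]
      have heq : (n : ℂ) * (φ n - 1) -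
          ((-(t ^ 2 * ((h n)⁻¹ * ∫ ω, ξ n 0 ω ^ 2 ∂P)) / 2 : ℝ) : ℂ) =
          (n : ℂ) * (φ n - (1 - (((Real.sqrt (n * h n))⁻¹ * t) ^ 2 *
            (∫ ω, ξ n 0 ω ^ 2 ∂P) / 2 : ℝ))) := by
        have hr : (-(t ^ 2 * ((h n)⁻¹ * ∫ ω, ξ n 0 ω ^ 2 ∂P)) / 2 : ℝ) =
            -((n : ℝ) * (((Real.sqrt (n * h n))⁻¹ * t) ^ 2 *
              (∫ ω, ξ n 0 ω ^ 2 ∂P) / 2)) := by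
          rw [hsq']
          have := (hpos n).ne'
          field_simp
        rw [hr]
        push_cast
        ring
      rw [heq, norm_mul, Complex.norm_natCast]
      refine (mul_le_mul_of_nonneg_left hb hn'.le).trans (le_of_eq ?_)
      rw [abs_mul, abs_of_nonneg (inv_nonneg.2 (Real.sqrt_nonneg _)), mul_pow]
      generalize (Real.sqrt (n * h n))⁻¹ = w
      ring
    have := herr.add hmain
    simpa using this
  have hpow := Complex.tendsto_one_add_pow_exp_of_tendsto hφlim
  have hgoal : Tendsto (fun n => φ n ^ n) atTop
      (𝓝 (Complex.exp (-(V * t ^ 2 / 2 : ℝ)))) := by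
    refine hpow.congr fun n => ?_
    rw [add_sub_cancel]
  have h7 : Complex.exp (t * ((0 : ℝ) : ℂ) * Complex.I - ((V : ℝ) : ℂ) * t ^ 2 / 2) =
      Complex.exp (-(V * t ^ 2 / 2 : ℝ)) := by
    congr 1; push_cast; ring
  rw [h7]
  refine hgoal.congr fun n => ?_
  exact (hchar n).symm

end NoisySample

/-! ### The regression-discontinuity model near the cutoff -/

section CondMoments

variable {Ω : Type*} [MeasurableSpace Ω] {P : Measure Ω} [IsProbabilityMeasure P] {Y X : Ω → ℝ}
  (hY : Measurable Y) (hX : Measurable X)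

include hY hX

lemma integral_eq_integral_condDistrib {F : ℝ × ℝ → ℝ} (hF : Measurable F)
    (hint : Integrable (fun ω => F (X ω, Y ω)) P) :
    ∫ ω, F (X ω, Y ω) ∂P = ∫ t, ∫ y, F (t, y) ∂(condDistrib Y X P t) ∂(P.map X) := by
  have hXY : AEMeasurable (fun ω => (X ω, Y ω)) P := (hX.prodMk hY).aemeasurable
  have h1 : Integrable F ((P.map X) ⊗ₘ condDistrib Y X P) := by
    rw [compProd_map_condDistrib hY.aemeasurable]
    exact (integrable_map_measure hF.aestronglyMeasurable hXY).2 hint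
  rw [← Measure.integral_compProd h1, compProd_map_condDistrib hY.aemeasurable,
    integral_map hXY hF.aestronglyMeasurable]

lemma lintegral_eq_lintegral_condDistrib {F : ℝ × ℝ → ℝ≥0∞} (hF : Measurable F) :
    ∫⁻ ω, F (X ω, Y ω) ∂P = ∫⁻ t, ∫⁻ y, F (t, y) ∂(condDistrib Y X P t) ∂(P.map X) := by
  rw [← Measure.lintegral_compProd hF, compProd_map_condDistrib hY.aemeasurable,
    lintegral_map hF (hX.prodMk hY)]

variable {g s γ v w : ℝ → ℝ} (H : HasCondMoments P Y X g s) (hw : Measurable w)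
  (hγ : Measurable γ) (hγg : ∀ t, w t ≠ 0 → γ t = g t)

include H hw hγ hγg

/-- `γ` is a measurable substitute for `g`, which is not assumed measurable. Agreement where the
test weight is nonzero is enough, so `γ` may be truncated away from the cutoff. -/
lemma HasCondMoments.integral_residual
    (hint : Integrable (fun ω => w (X ω) * (Y ω - γ (X ω))) P) :
    ∫ ω, w (X ω) * (Y ω - γ (X ω)) ∂P = 0 := by
  rw [integral_eq_integral_condDistrib hY hX (F := fun z => w z.1 * (z.2 - γ z.1))
    ((hw.comp measurable_fst).mul (measurable_snd.sub (hγ.comp measurable_fst))) hint]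
  refine integral_eq_zero_of_ae ?_
  filter_upwards [H.memLp, H.mean] with t h1 h2
  have h3 : Integrable (fun y : ℝ => y) (condDistrib Y X P t) := h1.integrable one_le_two
  rw [integral_const_mul, integral_sub h3 (integrable_const _), h2]
  by_cases ht : w t = 0
  · simp [ht]
  · simp [hγg t ht]

lemma HasCondMoments.integral_residual_sq (hv : Measurable v) (hvs : ∀ t, w t ≠ 0 → v t = s t)
    (hint : Integrable (fun ω => w (X ω) * (Y ω - γ (X ω)) ^ 2) P) :
    ∫ ω, w (X ω) * (Y ω - γ (X ω)) ^ 2 ∂P = ∫ ω, w (X ω) * v (X ω) ∂P := by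
  rw [integral_eq_integral_condDistrib hY hX (F := fun z => w z.1 * (z.2 - γ z.1) ^ 2)
    ((hw.comp measurable_fst).mul ((measurable_snd.sub (hγ.comp measurable_fst)).pow_const 2))
    hint, ← integral_map (φ := X) hX.aemeasurable (f := fun t => w t * v t)
    (hw.mul hv).aestronglyMeasurable]
  refine integral_congr_ae ?_
  filter_upwards [H.mean, H.var] with t h2 h3
  rw [integral_const_mul]
  by_cases ht : w t = 0
  · simp [ht]
  · rw [variance_eq_integral measurable_id.aemeasurable] at h3
    simp only [id] at h3
    rw [h2] at h3
    rw [hγg t ht, hvs t ht, h3]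

end CondMoments

/-- The function equal to `a` on `[x₀, x₀ + r)`, to `b` on `(x₀ - r, x₀)`, and to zero elsewhere. -/
def twoSided (x₀ r : ℝ) (a b : ℝ → ℝ) (t : ℝ) : ℝ :=
  (Set.Ico x₀ (x₀ + r)).indicator a t + (Set.Ioo (x₀ - r) x₀).indicator b t

section TwoSided

variable {x₀ r : ℝ} {a b : ℝ → ℝ} {t : ℝ}

lemma twoSided_of_le (ht : |t - x₀| < r) (h0 : x₀ ≤ t) : twoSided x₀ r a b t = a t := by
  rw [abs_lt] at ht
  rw [twoSided, Set.indicator_of_mem (Set.mem_Ico.2 ⟨h0, by linarith⟩),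
    Set.indicator_of_notMem (fun h => absurd h.2 (not_lt.2 h0)), add_zero]

lemma twoSided_of_lt (ht : |t - x₀| < r) (h0 : t < x₀) : twoSided x₀ r a b t = b t := by
  rw [abs_lt] at ht
  rw [twoSided, Set.indicator_of_mem (Set.mem_Ioo.2 ⟨by linarith, h0⟩),
    Set.indicator_of_notMem (fun h => absurd h.1 (not_le.2 h0)), zero_add]

lemma twoSided_of_not (ht : ¬ |t - x₀| < r) : twoSided x₀ r a b t = 0 := by
  by_cases hr : 0 < r
  · rw [twoSided, Set.indicator_of_notMem, Set.indicator_of_notMem, add_zero]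
    · exact fun h => ht (abs_lt.2 ⟨by linarith [h.1], by linarith [h.2]⟩)
    · exact fun h => ht (abs_lt.2 ⟨by linarith [h.1], by linarith [h.2]⟩)
  · rw [twoSided, Set.indicator_of_notMem, Set.indicator_of_notMem, add_zero]
    · exact fun h => by linarith [h.1, h.2]
    · exact fun h => by linarith [h.1, h.2]

lemma measurable_twoSided (ha : ContinuousOn a (Metric.ball x₀ r))
    (hb : ContinuousOn b (Metric.ball x₀ r)) : Measurable (twoSided x₀ r a b) := by
  classical
  have key : ∀ (s : Set ℝ) (c : ℝ → ℝ), MeasurableSet s → s ⊆ Metric.ball x₀ r →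
      ContinuousOn c (Metric.ball x₀ r) → Measurable (s.indicator c) := by
    intro s c hs hsub hc
    rw [← Set.piecewise_eq_indicator]
    exact (hc.mono hsub).measurable_piecewise continuousOn_const hs
  refine (key _ a measurableSet_Ico ?_ ha).add (key _ b measurableSet_Ioo ?_ hb)
  · rw [Real.ball_eq_Ioo]
    exact fun t ht => ⟨by linarith [ht.1, ht.2], ht.2⟩
  · rw [Real.ball_eq_Ioo]
    exact fun t ht => ⟨ht.1, by linarith [ht.1, ht.2]⟩

lemma abs_twoSided_le {B : ℝ} (hB : 0 ≤ B) (ha : ∀ t, |t - x₀| < r → |a t| ≤ B)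
    (hb : ∀ t, |t - x₀| < r → |b t| ≤ B) (t : ℝ) : |twoSided x₀ r a b t| ≤ B := by
  by_cases ht : |t - x₀| < r
  · rcases le_or_gt x₀ t with h0 | h0
    · rw [twoSided_of_le ht h0]; exact ha t ht
    · rw [twoSided_of_lt ht h0]; exact hb t ht
  · rw [twoSided_of_not ht]; simpa

end TwoSided

lemma observed_of_le {Ω : Type*} {x₀ : ℝ} {x y1 y0 : ℕ → Ω → ℝ} {i : ℕ} {ω : Ω}
    (h : x₀ ≤ x i ω) : observed x₀ x y1 y0 i ω = y1 i ω := by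
  rw [observed, treat, Set.indicator_of_mem (Set.mem_Ici.2 h)]; ring

lemma observed_of_lt {Ω : Type*} {x₀ : ℝ} {x y1 y0 : ℕ → Ω → ℝ} {i : ℕ} {ω : Ω}
    (h : x i ω < x₀) : observed x₀ x y1 y0 i ω = y0 i ω := by
  rw [observed, treat, Set.indicator_of_notMem (s := Set.Ici x₀)
    (fun h' => absurd h (not_lt.2 h'))]
  ring

namespace Model

variable {Ω : Type*} [MeasurableSpace Ω] {P : Measure Ω} [IsProbabilityMeasure P]
  {p : ℕ} {x₀ : ℝ} {x y1 y0 : ℕ → Ω → ℝ} {f gr gl sr sl : ℝ → ℝ}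
  (M : Model P p x₀ x y1 y0 f gr gl sr sl)

include M

lemma measurable_observed (i : ℕ) : Measurable (observed x₀ x y1 y0 i) := by
  have ht : Measurable (treat x₀) := measurable_const.indicator measurableSet_Ici
  exact (M.meas_y0 i).add (((M.meas_y1 i).sub (M.meas_y0 i)).mul (ht.comp (M.meas_x i)))

/-- The density is assumed continuous only on the support. Positivity on an open set places that set
in the support, which yields continuity at the cutoff. -/
lemma mem_support {N : Set ℝ} (hN : IsOpen N) (hf : ∀ t ∈ N, 0 < f t) {t : ℝ} (ht : t ∈ N) :
    t ∈ (P.map (x 0)).support := by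
  rw [Measure.mem_support_iff_forall]
  intro U hU
  rw [M.density]
  have hUN : U ∩ N ∈ 𝓝 t := inter_mem hU (hN.mem_nhds ht)
  obtain ⟨V, hVsub, hVo, hVt⟩ := mem_nhds_iff.1 hUN
  refine lt_of_lt_of_le ?_ (measure_mono (hVsub.trans Set.inter_subset_left))
  rw [withDensity_apply _ hVo.measurableSet, setLIntegral_pos_iff M.meas_f.ennreal_ofReal]
  have hsub : V ⊆ Function.support (fun t => ENNReal.ofReal (f t)) ∩ V := fun u hu =>
    ⟨by simpa using hf u (hVsub hu).2, hu⟩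
  exact (hVo.measure_pos volume ⟨t, hVt⟩).trans_le (measure_mono hsub)

lemma density_pos : 0 < f x₀ := by
  obtain ⟨N, -, hxN, hf, -⟩ := M.local_smooth
  exact hf _ hxN

lemma continuousAt_density : ContinuousAt f x₀ := by
  obtain ⟨N, hN, hxN, hf, -⟩ := M.local_smooth
  refine M.f_cont.continuousAt (mem_of_superset (hN.mem_nhds hxN) fun t ht => ?_)
  exact M.mem_support hN hf ht

/-- The conditional variance is pinned down only almost everywhere. A negative value at the cutoff
would persist, by continuity, on a neighborhood, which has positive probability. -/
lemma cond_var_nonneg : 0 ≤ sr x₀ ∧ 0 ≤ sl x₀ := by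
  obtain ⟨N, hN, hxN, hf, hsr, hsl, -⟩ := M.local_smooth
  have key : ∀ {Y : Ω → ℝ} {g s : ℝ → ℝ}, HasCondMoments P Y (x 0) g s → ContinuousOn s N →
      0 ≤ s x₀ := by
    intro Y g s H hs
    by_contra hneg
    rw [not_le] at hneg
    have h1 : {t | s t < 0} ∈ 𝓝 x₀ :=
      (hs.continuousAt (hN.mem_nhds hxN)).eventually (gt_mem_nhds hneg)
    have h2 : 0 < P.map (x 0) {t | s t < 0} :=
      Measure.mem_support_iff_forall _ |>.1 (M.mem_support hN hf hxN) _ h1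
    refine h2.ne' ?_
    have h3 : ∀ᵐ t ∂(P.map (x 0)), ¬ s t < 0 := by
      filter_upwards [H.var] with t ht
      rw [not_lt, ← ht]
      exact variance_nonneg _ _
    simpa [ae_iff] using h3
  exact ⟨key (M.cond_right 0) hsr, key (M.cond_left 0) hsl⟩

lemma memLp_observed : MemLp (observed x₀ x y1 y0 0) 4 P := by
  obtain ⟨C, hC⟩ := M.fourth
  refine ⟨(M.measurable_observed 0).aestronglyMeasurable, ?_⟩
  rw [eLpNorm_lt_top_iff_lintegral_rpow_enorm_lt_top (by norm_num) (by norm_num)]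
  have h1 := lintegral_eq_lintegral_condDistrib (P := P) (M.measurable_observed 0) (M.meas_x 0)
    (F := fun z => ‖z.2‖ₑ ^ 4) (measurable_snd.enorm.pow_const 4)
  have h2 : ∫⁻ ω, ‖observed x₀ x y1 y0 0 ω‖ₑ ^ 4 ∂P ≤ C := by
    rw [h1]
    refine (lintegral_mono_ae hC).trans ?_
    have := Measure.isProbabilityMeasure_map (μ := P) (M.meas_x 0).aemeasurable
    simp
  refine lt_of_le_of_lt ?_ (lt_of_le_of_lt h2 ENNReal.coe_lt_top)
  refine lintegral_mono fun ω => le_of_eq ?_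
  rw [show (4 : ℝ≥0∞).toReal = ((4 : ℕ) : ℝ) by norm_num, ENNReal.rpow_natCast]

/-- The bound on the conditional fourth moment, integrated against a nonnegative test weight. It
later controls the third absolute moment of the noise in the window. -/
lemma integral_mul_observed_pow_le : ∃ C : ℝ, 0 ≤ C ∧ ∀ ψ : ℝ → ℝ, Measurable ψ →
    (∃ B : ℝ, ∀ t, |ψ t| ≤ B) → (∀ t, 0 ≤ ψ t) →
    Integrable (fun ω => ψ (x 0 ω) * observed x₀ x y1 y0 0 ω ^ 4) P ∧
    ∫ ω, ψ (x 0 ω) * observed x₀ x y1 y0 0 ω ^ 4 ∂P ≤ C * ∫ ω, ψ (x 0 ω) ∂P := by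
  obtain ⟨C, hC⟩ := M.fourth
  refine ⟨C, C.2, fun ψ hψ ⟨B, hB⟩ hψ0 => ?_⟩
  have h4 : Integrable (fun ω => observed x₀ x y1 y0 0 ω ^ 4) P := by
    have := M.memLp_observed.integrable_norm_pow (p := 4) (by norm_num)
    refine this.congr (Eventually.of_forall fun ω => ?_)
    simp only [Real.norm_eq_abs]
    exact Even.pow_abs (by decide) _
  have hint : Integrable (fun ω => ψ (x 0 ω) * observed x₀ x y1 y0 0 ω ^ 4) P :=
    h4.bdd_mul (c := B) (hψ.comp (M.meas_x 0)).aestronglyMeasurable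
      (Eventually.of_forall fun ω => hB _)
  refine ⟨hint, ?_⟩
  rw [integral_eq_integral_condDistrib (M.measurable_observed 0) (M.meas_x 0)
    (F := fun z => ψ z.1 * z.2 ^ 4)
    ((hψ.comp measurable_fst).mul (measurable_snd.pow_const 4)) hint, ← integral_const_mul,
    ← integral_map (φ := x 0) (M.meas_x 0).aemeasurable (f := fun t => (C : ℝ) * ψ t)
    (hψ.const_mul _).aestronglyMeasurable]
  have := Measure.isProbabilityMeasure_map (μ := P) (M.meas_x 0).aemeasurable
  refine integral_mono_of_nonneg (Eventually.of_forall fun t => ?_)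
    ((integrable_of_bounded hψ hB).const_mul _) ?_
  · exact integral_nonneg fun y => mul_nonneg (hψ0 t) (by positivity)
  · filter_upwards [hC] with t ht
    rw [integral_const_mul, mul_comm]
    refine mul_le_mul_of_nonneg_right ?_ (hψ0 t)
    rw [integral_eq_lintegral_of_nonneg_ae (Eventually.of_forall fun y => by positivity)
      (by fun_prop)]
    refine ENNReal.toReal_le_of_le_ofReal C.2 ?_
    rw [ENNReal.ofReal_coe_nnreal]
    refine le_trans (lintegral_mono fun y => le_of_eq ?_) ht
    rw [← enorm_pow, Real.enorm_eq_ofReal (by positivity)]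

/-- A window around the cutoff on which everything is continuous and bounded. -/
lemma exists_window : ∃ r > 0, ∃ B : ℝ, 0 ≤ B ∧ (∀ t, |t - x₀| < r →
      |f t| ≤ B ∧ |gr t| ≤ B ∧ |gl t| ≤ B ∧ |sr t| ≤ B ∧ |sl t| ≤ B) ∧
    ContinuousOn gr (Metric.ball x₀ r) ∧ ContinuousOn gl (Metric.ball x₀ r) ∧
    ContinuousOn sr (Metric.ball x₀ r) ∧ ContinuousOn sl (Metric.ball x₀ r) := by
  obtain ⟨N, hN, hxN, hf, hsr, hsl, hgr, hgl, -⟩ := M.local_smooth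
  have hNx := hN.mem_nhds hxN
  have hb : ∀ {c : ℝ → ℝ}, ContinuousAt c x₀ → ∀ᶠ t in 𝓝 x₀, |c t| ≤ |c x₀| + 1 := by
    intro c hc
    exact (hc.abs.eventually (gt_mem_nhds (lt_add_one _))).mono fun t ht => le_of_lt ht
  have hev := (hb M.continuousAt_density).and <| (hb (hgr.continuousOn.continuousAt hNx)).and <|
    (hb (hgl.continuousOn.continuousAt hNx)).and <| (hb (hsr.continuousAt hNx)).and <|
    (hb (hsl.continuousAt hNx)).and hNx
  obtain ⟨r, hr, hball⟩ := Metric.eventually_nhds_iff_ball.1 hev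
  have hsub : Metric.ball x₀ r ⊆ N := fun t ht => (hball t ht).2.2.2.2.2
  refine ⟨r, hr, |f x₀| + |gr x₀| + |gl x₀| + |sr x₀| + |sl x₀| + 1, by positivity,
    fun t ht => ?_, hgr.continuousOn.mono hsub, hgl.continuousOn.mono hsub, hsr.mono hsub,
    hsl.mono hsub⟩
  obtain ⟨h1, h2, h3, h4, h5, -⟩ := hball t (by rwa [Metric.mem_ball, Real.dist_eq])
  have a1 := abs_nonneg (f x₀)
  have a2 := abs_nonneg (gr x₀)
  have a3 := abs_nonneg (gl x₀)
  have a4 := abs_nonneg (sr x₀)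
  have a5 := abs_nonneg (sl x₀)
  refine ⟨?_, ?_, ?_, ?_, ?_⟩ <;> linarith

/-- Near the cutoff the observed outcomes are the regression function plus noise. -/
theorem exists_noisySample : ∃ (r : ℝ) (e : ℕ → Ω → ℝ) (v : ℝ → ℝ),
    NoisySample P x e x₀ r f v (sr x₀) (sl x₀) ∧
    ∀ i ω, |x i ω - x₀| < r →
      observed x₀ x y1 y0 i ω = (if x₀ ≤ x i ω then gr (x i ω) else gl (x i ω)) + e i ω := by
  obtain ⟨r, hr, B, hB0, hB, hcgr, hcgl, hcsr, hcsl⟩ := M.exists_window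
  -- Truncation to the window makes the mean and variance functions globally measurable and bounded.
  set m := twoSided x₀ r gr gl with hm
  set v := twoSided x₀ r sr sl with hv
  have hmm : Measurable m := measurable_twoSided hcgr hcgl
  have hvm : Measurable v := measurable_twoSided hcsr hcsl
  have hmB : ∀ t, |m t| ≤ B :=
    abs_twoSided_le hB0 (fun t ht => (hB t ht).2.1) (fun t ht => (hB t ht).2.2.1)
  have hvB : ∀ t, |v t| ≤ B :=
    abs_twoSided_le hB0 (fun t ht => (hB t ht).2.2.2.1) (fun t ht => (hB t ht).2.2.2.2)
  set R : ℝ → ℝ := (Set.Ico x₀ (x₀ + r)).indicator fun _ => 1 with hR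
  set L : ℝ → ℝ := (Set.Ioo (x₀ - r) x₀).indicator fun _ => 1 with hL
  have hRm : Measurable R := measurable_const.indicator measurableSet_Ico
  have hLm : Measurable L := measurable_const.indicator measurableSet_Ioo
  have hRmem : ∀ t, R t ≠ 0 → x₀ ≤ t ∧ |t - x₀| < r := by
    intro t ht
    have h1 : t ∈ Set.Ico x₀ (x₀ + r) := Set.mem_of_indicator_ne_zero ht
    exact ⟨h1.1, abs_lt.2 ⟨by linarith [h1.1, h1.2], by linarith [h1.2]⟩⟩
  have hLmem : ∀ t, L t ≠ 0 → t < x₀ ∧ |t - x₀| < r := by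
    intro t ht
    have h1 : t ∈ Set.Ioo (x₀ - r) x₀ := Set.mem_of_indicator_ne_zero ht
    exact ⟨h1.2, abs_lt.2 ⟨by linarith [h1.1, h1.2], by linarith [h1.1, h1.2]⟩⟩
  have hRB : ∀ t, |R t| ≤ 1 := fun t => by
    rw [hR]; by_cases h : t ∈ Set.Ico x₀ (x₀ + r)
    · rw [Set.indicator_of_mem h]; simp
    · rw [Set.indicator_of_notMem h]; simp
  have hLB : ∀ t, |L t| ≤ 1 := fun t => by
    rw [hL]; by_cases h : t ∈ Set.Ioo (x₀ - r) x₀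
    · rw [Set.indicator_of_mem h]; simp
    · rw [Set.indicator_of_notMem h]; simp
  have hRLB : ∀ t, |R t + L t| ≤ 1 := fun t => by
    by_cases h : R t = 0
    · rw [h, zero_add]; exact hLB t
    · have : L t = 0 := by
        by_contra h'
        exact absurd (hRmem t h).1 (not_le.2 (hLmem t h').1)
      rw [this, add_zero]; exact hRB t
  set Y := observed x₀ x y1 y0 with hYdef
  -- `R + L` is the indicator of the window. Off the window both the noise and `v` vanish, so the
  -- moment identities hold against every bounded test function.
  set e : ℕ → Ω → ℝ := fun i ω => (R (x i ω) + L (x i ω)) * (Y i ω - m (x i ω)) with he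
  have hmeas : ∀ i, Measurable (e i) := fun i =>
    ((hRm.add hLm).comp (M.meas_x i)).mul ((M.measurable_observed i).sub (hmm.comp (M.meas_x i)))
  have heB : ∀ ω, |e 0 ω| ≤ |Y 0 ω| + B := by
    intro ω
    calc |e 0 ω| ≤ 1 * |Y 0 ω - m (x 0 ω)| := by
          rw [he]; simp only [abs_mul]
          exact mul_le_mul_of_nonneg_right (hRLB _) (abs_nonneg _)
      _ ≤ |Y 0 ω| + B := by
          rw [one_mul]; exact (abs_sub _ _).trans (add_le_add le_rfl (hmB _))
  have hY4 := M.memLp_observed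
  have he4 : MemLp (e 0) 4 P := by
    refine MemLp.mono (hY4.norm.add (memLp_const B)) (hmeas 0).aestronglyMeasurable
      (Eventually.of_forall fun ω => ?_)
    exact (heB ω).trans (le_abs_self _)
  have he3 : MemLp (e 0) 3 P := he4.mono_exponent (by norm_num)
  have he2 : MemLp (e 0) 2 P := he4.mono_exponent (by norm_num)
  -- On each side the observed outcome is a single potential outcome, so powers of the noise split
  -- into two residuals to which the conditional moments apply. Off the window the identity reads `0
  -- ^ k = 0`, hence `k ≠ 0`.
  have hsplit : ∀ (ψ : ℝ → ℝ) (k : ℕ), k ≠ 0 → ∀ ω, ψ (x 0 ω) * e 0 ω ^ k =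
      (ψ (x 0 ω) * R (x 0 ω)) * (y1 0 ω - m (x 0 ω)) ^ k +
        (ψ (x 0 ω) * L (x 0 ω)) * (y0 0 ω - m (x 0 ω)) ^ k ∧
      (ψ (x 0 ω) * R (x 0 ω)) * (y1 0 ω - m (x 0 ω)) ^ k = ψ (x 0 ω) * R (x 0 ω) * e 0 ω ^ k ∧
      (ψ (x 0 ω) * L (x 0 ω)) * (y0 0 ω - m (x 0 ω)) ^ k =
        ψ (x 0 ω) * L (x 0 ω) * e 0 ω ^ k := by
    intro ψ k hk ω
    by_cases hr0 : R (x 0 ω) = 0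
    · by_cases hl0 : L (x 0 ω) = 0
      · simp [he, hr0, hl0, hk]
      · have h1 : L (x 0 ω) = 1 := Set.indicator_eq_one_iff_mem ℝ |>.2
          (Set.mem_of_indicator_ne_zero hl0)
        have h2 : Y 0 ω = y0 0 ω := observed_of_lt (hLmem _ hl0).1
        simp [he, hr0, h1, h2]
    · have h1 : R (x 0 ω) = 1 := Set.indicator_eq_one_iff_mem ℝ |>.2
        (Set.mem_of_indicator_ne_zero hr0)
      have hl0 : L (x 0 ω) = 0 := by
        by_contra h'
        exact absurd (hRmem _ hr0).1 (not_le.2 (hLmem _ h').1)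
      have h2 : Y 0 ω = y1 0 ω := observed_of_le (hRmem _ hr0).1
      simp [he, hl0, h1, h2]
  have hint : ∀ (ψ c : ℝ → ℝ), Measurable ψ → Measurable c → (∃ B' : ℝ, ∀ t, |ψ t| ≤ B') →
      (∀ t, |c t| ≤ 1) → ∀ k, Integrable (fun ω => e 0 ω ^ k) P →
      Integrable (fun ω => ψ (x 0 ω) * c (x 0 ω) * e 0 ω ^ k) P := by
    intro ψ c hψ hc ⟨B', hB'⟩ hc1 k hk
    refine hk.bdd_mul (c := B') ((hψ.mul hc).comp (M.meas_x 0)).aestronglyMeasurable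
      (Eventually.of_forall fun ω => ?_)
    rw [norm_mul]
    calc ‖ψ (x 0 ω)‖ * ‖c (x 0 ω)‖ ≤ ‖ψ (x 0 ω)‖ * 1 :=
          mul_le_mul_of_nonneg_left (hc1 _) (norm_nonneg _)
      _ ≤ B' := by rw [mul_one]; exact hB' _
  have hmR : ∀ ψ : ℝ → ℝ, ∀ t, ψ t * R t ≠ 0 → m t = gr t := fun ψ t ht => by
    have := hRmem t (right_ne_zero_of_mul ht)
    exact twoSided_of_le this.2 this.1
  have hmL : ∀ ψ : ℝ → ℝ, ∀ t, ψ t * L t ≠ 0 → m t = gl t := fun ψ t ht => by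
    have := hLmem t (right_ne_zero_of_mul ht)
    exact twoSided_of_lt this.2 this.1
  have hvR : ∀ ψ : ℝ → ℝ, ∀ t, ψ t * R t ≠ 0 → v t = sr t := fun ψ t ht => by
    have := hRmem t (right_ne_zero_of_mul ht)
    exact twoSided_of_le this.2 this.1
  have hvL : ∀ ψ : ℝ → ℝ, ∀ t, ψ t * L t ≠ 0 → v t = sl t := fun ψ t ht => by
    have := hLmem t (right_ne_zero_of_mul ht)
    exact twoSided_of_lt this.2 this.1
  refine ⟨r, e, v, ?_, ?_⟩
  -- The pair of regressor and noise is a fixed measurable function of the observed triple, and so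
  -- inherits the i.i.d. property.
  · have hF : Measurable fun z : ℝ × ℝ × ℝ => (z.2.1, (R z.2.1 + L z.2.1) * (z.1 - m z.2.1)) := by
      have h1 : Measurable fun z : ℝ × ℝ × ℝ => z.2.1 := measurable_fst.comp measurable_snd
      exact h1.prodMk (((hRm.add hLm).comp h1).mul (measurable_fst.sub (hmm.comp h1)))
    refine
      { meas_x := M.meas_x
        meas_e := hmeas
        indep := M.indep.comp (fun _ => _) fun _ => hF
        ident := fun i => (M.ident i).comp hF
        r_pos := hr
        meas_f := M.meas_f
        f_bound := ⟨B, fun t ht => (hB t ht).1⟩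
        f_cont := M.continuousAt_density
        law := fun ψ hψ _ => ?_
        memLp := he3
        mean := fun ψ hψ hψB => ?_
        meas_v := hvm
        v_bound := ⟨B, hvB⟩
        var := fun ψ hψ hψB => ?_
        third := ?_
        v_right := ?_
        v_left := ?_ }
    · rw [← integral_map (φ := x 0) (M.meas_x 0).aemeasurable hψ.aestronglyMeasurable, M.density,
        integral_withDensity_eq_integral_toReal_smul M.meas_f.ennreal_ofReal
          (Eventually.of_forall fun _ => ENNReal.ofReal_lt_top)]
      refine integral_congr_ae (Eventually.of_forall fun t => ?_)
      simp only [smul_eq_mul]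
      rw [ENNReal.toReal_ofReal (M.f_nonneg t), mul_comm]
    · have hk : Integrable (fun ω => e 0 ω ^ 1) P := by
        simpa using he2.integrable one_le_two
      have i1 := hint ψ R hψ hRm hψB hRB 1 hk
      have i2 := hint ψ L hψ hLm hψB hLB 1 hk
      have s1 : (fun ω => ψ (x 0 ω) * R (x 0 ω) * (y1 0 ω - m (x 0 ω))) =
          fun ω => ψ (x 0 ω) * R (x 0 ω) * e 0 ω ^ 1 := by
        ext ω; simpa using (hsplit ψ 1 one_ne_zero ω).2.1
      have s2 : (fun ω => ψ (x 0 ω) * L (x 0 ω) * (y0 0 ω - m (x 0 ω))) =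
          fun ω => ψ (x 0 ω) * L (x 0 ω) * e 0 ω ^ 1 := by
        ext ω; simpa using (hsplit ψ 1 one_ne_zero ω).2.2
      rw [← s1] at i1
      rw [← s2] at i2
      have z1 := (M.cond_right 0).integral_residual (M.meas_y1 0) (M.meas_x 0) (hψ.mul hRm) hmm
        (hmR ψ) i1
      have z2 := (M.cond_left 0).integral_residual (M.meas_y0 0) (M.meas_x 0) (hψ.mul hLm) hmm
        (hmL ψ) i2
      have heq : (fun ω => ψ (x 0 ω) * e 0 ω) = fun ω =>
          ψ (x 0 ω) * R (x 0 ω) * (y1 0 ω - m (x 0 ω)) +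
            ψ (x 0 ω) * L (x 0 ω) * (y0 0 ω - m (x 0 ω)) := by
        ext ω; simpa using (hsplit ψ 1 one_ne_zero ω).1
      rw [heq, integral_add i1 i2]
      simp only [Pi.mul_apply] at z1 z2
      rw [z1, z2, add_zero]
    · have hk : Integrable (fun ω => e 0 ω ^ 2) P := he2.integrable_sq
      have i1 := hint ψ R hψ hRm hψB hRB 2 hk
      have i2 := hint ψ L hψ hLm hψB hLB 2 hk
      rw [← funext fun ω => (hsplit ψ 2 two_ne_zero ω).2.1] at i1
      rw [← funext fun ω => (hsplit ψ 2 two_ne_zero ω).2.2] at i2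
      have z1 := (M.cond_right 0).integral_residual_sq (M.meas_y1 0) (M.meas_x 0) (hψ.mul hRm) hmm
        (hmR ψ) hvm (hvR ψ) i1
      have z2 := (M.cond_left 0).integral_residual_sq (M.meas_y0 0) (M.meas_x 0) (hψ.mul hLm) hmm
        (hmL ψ) hvm (hvL ψ) i2
      simp only [Pi.mul_apply] at z1 z2
      rw [funext fun ω => (hsplit ψ 2 two_ne_zero ω).1, integral_add i1 i2, z1, z2]
      obtain ⟨B', hB'⟩ := hψB
      have hb : ∀ c : ℝ → ℝ, Measurable c → (∀ t, |c t| ≤ 1) →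
          Integrable (fun ω => ψ (x 0 ω) * c (x 0 ω) * v (x 0 ω)) P := by
        intro c hc hc1
        refine integrable_of_bounded (B := B' * 1 * B)
          (((hψ.mul hc).mul hvm).comp (M.meas_x 0)) fun ω => ?_
        rw [abs_mul, abs_mul]
        have hB'0 : 0 ≤ B' := (abs_nonneg _).trans (hB' 0)
        gcongr
        · exact hB' _
        · exact hc1 _
        · exact hvB _
      rw [← integral_add (hb R hRm hRB) (hb L hLm hLB)]
      refine integral_congr_ae (Eventually.of_forall fun ω => ?_)
      show ψ (x 0 ω) * R (x 0 ω) * v (x 0 ω) + ψ (x 0 ω) * L (x 0 ω) * v (x 0 ω) =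
        ψ (x 0 ω) * v (x 0 ω)
      by_cases hw : |x 0 ω - x₀| < r
      · have hRL : R (x 0 ω) + L (x 0 ω) = 1 := by
          have h1 : R (x 0 ω) + L (x 0 ω) = twoSided x₀ r (fun _ => 1) (fun _ => 1) (x 0 ω) := rfl
          rw [h1]
          rcases le_or_gt x₀ (x 0 ω) with h0 | h0
          · exact twoSided_of_le hw h0
          · exact twoSided_of_lt hw h0
        linear_combination ψ (x 0 ω) * v (x 0 ω) * hRL
      · have : v (x 0 ω) = 0 := twoSided_of_not hw
        rw [this]; ring
    · obtain ⟨C, hC0, hC⟩ := M.integral_mul_observed_pow_le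
      -- From `|e|³ ≤ 1 + |e|⁴` and `(|Y| + B)⁴ ≤ 8 (|Y|⁴ + B⁴)`.
      refine ⟨1 + 8 * B ^ 4 + 8 * C, by positivity, fun ψ hψ hψB hψ0 => ?_⟩
      obtain ⟨i1, h1⟩ := hC ψ hψ hψB hψ0
      obtain ⟨B', hB'⟩ := hψB
      have i0 : Integrable (fun ω => ψ (x 0 ω)) P :=
        integrable_of_bounded (hψ.comp (M.meas_x 0)) fun ω => hB' _
      have hle : ∀ ω, ψ (x 0 ω) * |e 0 ω| ^ 3 ≤
          (1 + 8 * B ^ 4) * ψ (x 0 ω) + 8 * (ψ (x 0 ω) * Y 0 ω ^ 4) := by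
        intro ω
        have ha := abs_nonneg (e 0 ω)
        have hb := heB ω
        have hc : |e 0 ω| ^ 3 ≤ 1 + |e 0 ω| ^ 4 := by
          rcases le_or_gt |e 0 ω| 1 with h | h
          · have := pow_le_one₀ (n := 3) ha h
            have : 0 ≤ |e 0 ω| ^ 4 := by positivity
            linarith
          · have := pow_le_pow_right₀ h.le (show 3 ≤ 4 by norm_num)
            linarith
        have hd : |e 0 ω| ^ 4 ≤ (|Y 0 ω| + B) ^ 4 := pow_le_pow_left₀ ha hb 4
        have hf : (|Y 0 ω| + B) ^ 4 ≤ 2 ^ 3 * (|Y 0 ω| ^ 4 + B ^ 4) :=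
          add_pow_le (abs_nonneg _) hB0 4
        have hg : |Y 0 ω| ^ 4 = Y 0 ω ^ 4 := Even.pow_abs (by decide) _
        rw [hg] at hf
        have := mul_le_mul_of_nonneg_left (hc.trans (add_le_add le_rfl (hd.trans hf)))
          (hψ0 (x 0 ω))
        linarith
      refine (integral_mono_of_nonneg (Eventually.of_forall fun ω => ?_)
        ((i0.const_mul _).add (i1.const_mul _)) (Eventually.of_forall hle)).trans ?_
      · exact mul_nonneg (hψ0 _) (by positivity)
      · simp only [Pi.add_apply]
        rw [integral_add (i0.const_mul _) (i1.const_mul _), integral_const_mul,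
          integral_const_mul]
        linarith
    · have hc : Tendsto sr (𝓝[≥] x₀) (𝓝 (sr x₀)) :=
        ((hcsr.continuousAt (Metric.ball_mem_nhds _ hr)).tendsto).mono_left nhdsWithin_le_nhds
      refine hc.congr' ?_
      filter_upwards [self_mem_nhdsWithin, nhdsWithin_le_nhds (Metric.ball_mem_nhds x₀ hr)]
        with t h1 h2
      exact (twoSided_of_le (by rwa [Metric.mem_ball, Real.dist_eq] at h2) h1).symm
    · have hc : Tendsto sl (𝓝[<] x₀) (𝓝 (sl x₀)) :=
        ((hcsl.continuousAt (Metric.ball_mem_nhds _ hr)).tendsto).mono_left nhdsWithin_le_nhds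
      refine hc.congr' ?_
      filter_upwards [self_mem_nhdsWithin, nhdsWithin_le_nhds (Metric.ball_mem_nhds x₀ hr)]
        with t h1 h2
      exact (twoSided_of_lt (by rwa [Metric.mem_ball, Real.dist_eq] at h2) h1).symm
  · intro i ω hw
    have h1 : R (x i ω) + L (x i ω) = twoSided x₀ r (fun _ => 1) (fun _ => 1) (x i ω) := rfl
    simp only [he]
    rw [h1]
    rcases le_or_gt x₀ (x i ω) with h0 | h0
    · rw [twoSided_of_le hw h0, hm, twoSided_of_le hw h0, if_pos h0]; ring
    · rw [twoSided_of_lt hw h0, hm, twoSided_of_lt hw h0, if_neg (not_le.2 h0)]; ring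

end Model

/-! ### One-sided samples -/

/-- The scaled distances `u` from the cutoff in `I` are those with `0 ≤ σ u < 2`, up to the
treatment of `u = 0`. -/
structure IsSide (σ : ℝ) (I : Set ℝ) : Prop where
  sign : σ = 1 ∨ σ = -1
  meas : MeasurableSet I
  sub : ∀ u ∈ I, σ * u ∈ Set.Ico (0 : ℝ) 2
  mem : ∀ u, σ * u ∈ Set.Ioo (0 : ℝ) 2 → u ∈ I

lemma isSide_right : IsSide 1 (Set.Ico (0 : ℝ) 2) where
  sign := Or.inl rfl
  meas := measurableSet_Ico
  sub u hu := by simpa using hu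
  mem u hu := by rw [one_mul] at hu; exact ⟨hu.1.le, hu.2⟩

lemma isSide_left : IsSide (-1) (Set.Ioo (-2 : ℝ) 0) where
  sign := Or.inr rfl
  meas := measurableSet_Ioo
  sub u hu := ⟨by linarith [hu.2], by linarith [hu.1]⟩
  mem u hu := ⟨by linarith [hu.2], by linarith [hu.1]⟩

open scoped Classical in
/-- The observations whose scaled distance from the cutoff lies in `I`. -/
def sideSample (x₀ σ : ℝ) (I : Set ℝ) (h : ℝ) (n : ℕ) (X : ℕ → ℝ) : Sample where
  idx := (Finset.range n).filter fun j => (X j - x₀) / h ∈ I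
  pt j := σ * ((X j - x₀) / h)
  wt := ((n : ℝ) * h)⁻¹

lemma rightDesign_sample (K : ℝ → ℝ) (x₀ : ℝ) {h : ℝ} (hh : 0 < h) (n : ℕ) (X : ℕ → ℝ) :
    (rightDesign K x₀ h n X).sample x₀ 1 = sideSample x₀ 1 (Set.Ico 0 2) h n X := by
  classical
  have hidx : ∀ j, (X j ∈ Set.Ici x₀ ∧ 1 * ((X j - x₀) / h) < 2) ↔
      (X j - x₀) / h ∈ Set.Ico (0 : ℝ) 2 := by
    intro j
    rw [one_mul, Set.mem_Ici, Set.mem_Ico, le_div_iff₀ hh, zero_mul, sub_nonneg]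
  simp only [Design.sample, sideSample, rightDesign, Design.scaled, Design.effSize]
  congr 1
  ext j
  simp only [Finset.mem_filter, hidx]

lemma leftDesign_sample (K : ℝ → ℝ) (x₀ : ℝ) {h : ℝ} (hh : 0 < h) (n : ℕ) (X : ℕ → ℝ) :
    (leftDesign K x₀ h n X).sample x₀ (-1) = sideSample x₀ (-1) (Set.Ioo (-2) 0) h n X := by
  classical
  have hidx : ∀ j, (X j ∈ Set.Iio x₀ ∧ -1 * ((X j - x₀) / h) < 2) ↔
      (X j - x₀) / h ∈ Set.Ioo (-2 : ℝ) 0 := by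
    intro j
    rw [neg_one_mul, Set.mem_Iio, Set.mem_Ioo, div_lt_iff₀ hh, zero_mul, sub_neg,
      neg_lt, and_comm]
  simp only [Design.sample, sideSample, leftDesign, Design.scaled, Design.effSize]
  congr 1
  ext j
  simp only [Finset.mem_filter, hidx]

section SideSample

variable {x₀ σ : ℝ} {I : Set ℝ} (hI : IsSide σ I)

lemma sideSample_lin (h : ℝ) (n : ℕ) (X : ℕ → ℝ) (A : ℝ → ℝ) (y : ℕ → ℝ) :
    (sideSample x₀ σ I h n X).lin A y = ((n : ℝ) * h)⁻¹ * ∑ j ∈ Finset.range n,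
      I.indicator (fun u => A (σ * u)) ((X j - x₀) / h) * y j := by
  classical
  rw [Sample.lin, sideSample]
  congr 1
  rw [Finset.sum_filter]
  refine Finset.sum_congr rfl fun j _ => ?_
  by_cases hj : (X j - x₀) / h ∈ I
  · rw [Set.indicator_of_mem hj, if_pos hj]
  · rw [Set.indicator_of_notMem hj, if_neg hj, zero_mul]

lemma sideSample_avg (h : ℝ) (n : ℕ) (X : ℕ → ℝ) (A : ℝ → ℝ) :
    (sideSample x₀ σ I h n X).avg A = ((n : ℝ) * h)⁻¹ * ∑ j ∈ Finset.range n,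
      I.indicator (fun u => A (σ * u)) ((X j - x₀) / h) := by
  have := sideSample_lin (x₀ := x₀) (σ := σ) (I := I) h n X A fun _ => 1
  simpa [Sample.lin, Sample.avg] using this

include hI

lemma measurableAvg_sideSample (h : ℝ) (n : ℕ) :
    MeasurableAvg fun X : ℕ → ℝ => (sideSample x₀ σ I h n X).avg := by
  intro F hF
  simp only [sideSample_avg]
  refine (Finset.measurable_sum _ fun j _ => ?_).const_mul _
  have hu : Measurable fun q : (ℕ → ℝ) × ℝ => (q.1 j - x₀) / h :=
    ((((measurable_pi_apply j).comp measurable_fst).sub_const _).div_const _)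
  have hs : MeasurableSet {q : (ℕ → ℝ) × ℝ | (q.1 j - x₀) / h ∈ I} := hu hI.meas
  have hG : Measurable fun q : (ℕ → ℝ) × ℝ => F q (σ * ((q.1 j - x₀) / h)) :=
    hF.comp (measurable_id.prodMk (hu.const_mul _))
  exact hG.indicator hs

lemma measurable_sideSample_lin (h : ℝ) (n : ℕ) {Ω : Type*} [MeasurableSpace Ω]
    {x y : ℕ → Ω → ℝ} (hx : ∀ j, Measurable (x j)) (hy : ∀ j, Measurable (y j))
    {A : (ℕ → ℝ) → ℝ → ℝ} (hA : Measurable fun q : (ℕ → ℝ) × ℝ => A q.1 q.2) :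
    Measurable fun ω => (sideSample x₀ σ I h n fun j => x j ω).lin (A fun j => x j ω)
      fun j => y j ω := by
  simp only [sideSample_lin]
  have hX : Measurable fun ω j => x j ω := measurable_pi_lambda _ hx
  refine (Finset.measurable_sum _ fun j _ => Measurable.mul ?_ (hy j)).const_mul _
  have hu : Measurable fun ω => (x j ω - x₀) / h := ((hx j).sub_const _).div_const _
  have hG : Measurable fun ω => A (fun j => x j ω) (σ * ((x j ω - x₀) / h)) :=
    hA.comp (hX.prodMk (hu.const_mul _))
  exact hG.indicator (hu hI.meas)

lemma IsSide.abs_lt_two {u : ℝ} (hu : u ∈ I) : |u| < 2 := by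
  have h := hI.sub u hu
  rcases hI.sign with rfl | rfl
  · rw [one_mul] at h; rw [abs_of_nonneg h.1]; exact h.2
  · rw [neg_one_mul] at h; rw [← abs_neg, abs_of_nonneg h.1]; exact h.2

lemma IsSide.integral_indicator (g : ℝ → ℝ) :
    ∫ u, I.indicator (fun u => g (σ * u)) u = ∫ v in (0 : ℝ)..2, g v := by
  have hσ : σ * σ = 1 := by rcases hI.sign with rfl | rfl <;> norm_num
  have h1 : ∀ φ : ℝ → ℝ, ∫ u, φ u = ∫ u, φ (σ * u) := by
    intro φ
    rcases hI.sign with rfl | rfl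
    · simp
    · simpa using (integral_neg_eq_self φ volume).symm
  rw [h1, intervalIntegral.integral_of_le zero_le_two, integral_Ioc_eq_integral_Ioo,
    ← MeasureTheory.integral_indicator measurableSet_Ioo]
  refine integral_congr_ae ?_
  -- The side may or may not contain zero; a single point has measure zero.
  have h0 : ∀ᵐ u : ℝ, u ≠ 0 := by simp [ae_iff]
  filter_upwards [h0] with u hu
  by_cases h : σ * u ∈ I
  · have h2 := hI.sub _ h
    rw [← mul_assoc, hσ, one_mul] at h2
    rw [Set.indicator_of_mem h, Set.indicator_of_mem (Set.mem_Ioo.2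
      ⟨lt_of_le_of_ne h2.1 (Ne.symm hu), h2.2⟩), ← mul_assoc, hσ, one_mul]
  · rw [Set.indicator_of_notMem h, Set.indicator_of_notMem]
    intro h3
    exact h (hI.mem _ (by rwa [← mul_assoc, hσ, one_mul]))

omit hI in
lemma abs_indicator_le {A : ℝ → ℝ} {B : ℝ} (hB : 0 ≤ B) (hA : ∀ u ∈ I, |A (σ * u)| ≤ B)
    (u : ℝ) : |I.indicator (fun u => A (σ * u)) u| ≤ B := by
  by_cases hu : u ∈ I
  · rw [Set.indicator_of_mem hu]; exact hA u hu
  · rw [Set.indicator_of_notMem hu]; simpa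

end SideSample

section Noisy

variable {Ω : Type*} [MeasurableSpace Ω] {P : Measure Ω} [IsProbabilityMeasure P]
  {x e : ℕ → Ω → ℝ} {x₀ r : ℝ} {f v : ℝ → ℝ} {vr vl : ℝ}
  (S : NoisySample P x e x₀ r f v vr vl)
  {h : ℕ → ℝ} (hpos : ∀ n, 0 < h n) (hh : Tendsto h atTop (𝓝 0))
  (hnh : Tendsto (fun n : ℕ => (n : ℝ) * h n) atTop atTop)
  {σ : ℝ} {I : Set ℝ} (hI : IsSide σ I)

include S hpos hh hnh hI

/-- The law of large numbers for each interval separately. This is the only probabilistic input to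
the uniform convergence of the weights. -/
theorem NoisySample.approximates (hf : 0 < f x₀) :
    Approximates (probFilter P)
      (fun z : ℕ × Ω => sideSample x₀ σ I (h z.1) z.1 fun j => x j z.2) (f x₀) where
  pos := hf
  wt_nonneg z := inv_nonneg.2 (mul_nonneg (Nat.cast_nonneg _) (hpos _).le)
  pt_mem z j hj := by
    classical
    simp only [sideSample, Finset.mem_filter] at hj ⊢
    exact hI.sub _ hj.2
  mass a b ha hab hb := by
    set g : ℝ → ℝ := (Set.Ico a b).indicator fun _ => 1 with hg
    have hgm : Measurable g := measurable_const.indicator measurableSet_Ico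
    have hgB : ∀ u, |g u| ≤ 1 := fun u => by
      rw [hg]; by_cases hu : u ∈ Set.Ico a b
      · rw [Set.indicator_of_mem hu]; simp
      · rw [Set.indicator_of_notMem hu]; simp
    have h1 := S.tendsto_average hpos hh hnh (ψ := I.indicator fun u => g (σ * u)) (B := 1)
      ((hgm.comp (measurable_const_mul σ)).indicator hI.meas)
      (abs_indicator_le zero_le_one fun u _ => hgB _)
      (fun u hu => Set.indicator_of_notMem (fun h' => absurd (hI.abs_lt_two h') (not_lt.2 hu.le)) _)
    have h2 : ∫ v in (0 : ℝ)..2, g v = b - a := by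
      rw [intervalIntegral.integral_of_le zero_le_two, integral_Ioc_eq_integral_Ioo,
        ← integral_Ico_eq_integral_Ioo, hg, setIntegral_indicator measurableSet_Ico,
        Set.inter_eq_self_of_subset_right (Set.Ico_subset_Ico ha hb)]
      simp [hab.le]
    rw [hI.integral_indicator, h2] at h1
    simpa only [sideSample_avg] using h1

end Noisy

/-! ### Reproducing weights: bias and linearization on one side of the cutoff -/

/-- Since the weights send a polynomial of degree at most `p + 1` to its value at zero, such a
polynomial may be subtracted from the regression function at the price of its constant term. With
the Taylor polynomial, only the remainder and the noise are left. -/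
lemma Sample.lin_sub_eq {c : Sample} {A : ℝ → ℝ} {p : ℕ}
    (hrep : ∀ k ≤ p + 1, c.avg (fun v => A v * v ^ k) = if k = 0 then 1 else 0)
    {y ε : ℕ → ℝ} {G : ℝ → ℝ} (hy : ∀ j ∈ c.idx, y j = G (c.pt j) + ε j) (b : ℕ → ℝ) :
    c.lin A y - b 0 =
      c.avg (fun v => A v * (G v - ∑ k ∈ Finset.range (p + 2), b k * v ^ k)) + c.lin A ε := by
  have h1 : c.lin A y = c.avg (fun v => A v * G v) + c.lin A ε := by
    rw [lin, avg, lin, ← mul_add, ← Finset.sum_add_distrib]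
    congr 1
    refine Finset.sum_congr rfl fun j hj => ?_
    rw [hy j hj]; ring
  have h2 : c.avg (fun v => A v * ∑ k ∈ Finset.range (p + 2), b k * v ^ k) = b 0 := by
    have h3 : ∀ v, A v * ∑ k ∈ Finset.range (p + 2), b k * v ^ k =
        ∑ k ∈ Finset.range (p + 2), b k * (A v * v ^ k) := fun v => by
      rw [Finset.mul_sum]
      exact Finset.sum_congr rfl fun k _ => by ring
    simp only [h3]
    rw [avg_sum]
    simp only [avg_const_mul]
    rw [Finset.sum_congr rfl fun k hk => by
      rw [hrep k (Nat.lt_succ_iff.1 (Finset.mem_range.1 hk))]]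
    simp
  simp only [mul_sub]
  rw [avg_sub, h1, h2]
  ring

/-- Random weights that reproduce polynomials of degree `p + 1` at the cutoff and converge
uniformly in probability. -/
structure ReproducingWeights {Ω : Type*} [MeasurableSpace Ω] (P : Measure Ω) (x : ℕ → Ω → ℝ)
    (h : ℕ → ℝ) (x₀ σ : ℝ) (I : Set ℝ) (p : ℕ) (A : ℕ → (ℕ → ℝ) → ℝ → ℝ) (a : ℝ → ℝ) : Prop where
  meas : ∀ n, Measurable fun q : (ℕ → ℝ) × ℝ => A n q.1 q.2
  meas_lim : Measurable a
  bound : ∃ B : ℝ, 0 ≤ B ∧ ∀ v ∈ Set.Icc (0 : ℝ) 2, |a v| ≤ B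
  unif : TendstoUniformlyOn (fun z : ℕ × Ω => A z.1 fun j => x j z.2) a (probFilter P)
    (Set.Icc 0 2)
  rep : ∀ᶠ z : ℕ × Ω in probFilter P, ∀ k ≤ p + 1,
    (sideSample x₀ σ I (h z.1) z.1 fun j => x j z.2).avg
      (fun v => A z.1 (fun j => x j z.2) v * v ^ k) = if k = 0 then 1 else 0

/-- A Taylor expansion of order `m` at `x₀`. -/
def HasTaylor (g : ℝ → ℝ) (x₀ : ℝ) (m : ℕ) : Prop :=
  ∃ c : ℕ → ℝ, c 0 = g x₀ ∧ (fun t => g t - ∑ k ∈ Finset.range (m + 1), c k * (t - x₀) ^ k)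
    =o[𝓝 x₀] fun t => (t - x₀) ^ m

lemma hasTaylor_of_contDiffOn {g : ℝ → ℝ} {x₀ : ℝ} {m : ℕ} {N : Set ℝ} (hN : IsOpen N)
    (hx : x₀ ∈ N) (hg : ContDiffOn ℝ m g N) : HasTaylor g x₀ m := by
  obtain ⟨r, hr, hsub⟩ := Metric.isOpen_iff.1 hN x₀ hx
  have h := taylor_isLittleO (convex_ball x₀ r) (Metric.mem_ball_self hr) (hg.mono hsub)
  rw [nhdsWithin_eq_nhds.2 (Metric.ball_mem_nhds x₀ hr)] at h
  refine ⟨fun k => (k.factorial : ℝ)⁻¹ * iteratedDerivWithin k g (Metric.ball x₀ r) x₀,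
    by simp, h.congr_left fun t => ?_⟩
  rw [taylor_within_apply]
  congr 1
  refine Finset.sum_congr rfl fun k _ => ?_
  rw [smul_eq_mul]; ring

lemma sqrt_mul_inv_self (t : ℝ) : Real.sqrt t * t⁻¹ = (Real.sqrt t)⁻¹ := by
  rw [← div_eq_mul_inv, Real.sqrt_div_self]

section OneSide

variable {Ω : Type*} [MeasurableSpace Ω] {P : Measure Ω} [IsProbabilityMeasure P]
  {x e y : ℕ → Ω → ℝ} {x₀ r : ℝ} {f v g : ℝ → ℝ} {vr vl : ℝ}
  (S : NoisySample P x e x₀ r f v vr vl)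
  {h : ℕ → ℝ} (hpos : ∀ n, 0 < h n) (hh : Tendsto h atTop (𝓝 0))
  (hnh : Tendsto (fun n : ℕ => (n : ℝ) * h n) atTop atTop)
  {σ : ℝ} {I : Set ℝ} (hI : IsSide σ I) {p : ℕ} {A : ℕ → (ℕ → ℝ) → ℝ → ℝ} {a : ℝ → ℝ}
  (W : ReproducingWeights P x h x₀ σ I p A a)

include hI W

omit [IsProbabilityMeasure P] in
/-- The smoothing bias is negligible. -/
lemma ReproducingWeights.tendsto_bias {fx : ℝ} (happ : Approximates (probFilter P)
      (fun z : ℕ × Ω => sideSample x₀ σ I (h z.1) z.1 fun j => x j z.2) fx)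
    (hpos : ∀ n, 0 < h n) (hh : Tendsto h atTop (𝓝 0))
    {C : ℝ} (hrate : ∀ᶠ n : ℕ in atTop, Real.sqrt (n * h n) * h n ^ (p + 1) ≤ C)
    {ρ : ℝ → ℝ} (hρ : ρ =o[𝓝 x₀] fun t => (t - x₀) ^ (p + 1)) :
    Tendsto (fun z : ℕ × Ω => Real.sqrt (z.1 * h z.1) *
      (sideSample x₀ σ I (h z.1) z.1 fun j => x j z.2).avg
        fun v => A z.1 (fun j => x j z.2) v * ρ (x₀ + σ * h z.1 * v)) (probFilter P) (𝓝 0) := by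
  obtain ⟨B, hB0, hB⟩ := W.bound
  have hC0 : 0 ≤ C := by
    obtain ⟨n, hn⟩ := hrate.exists
    have := (hpos n).le
    exact le_trans (by positivity) hn
  have hf := happ.pos
  -- The product of the bounds on the weights, on `|v| ^ (p + 1)`, on the rate `√(nh) h ^ (p + 1)`
  -- and on the total mass. A remainder of relative size `ε = δ / (K + 1)` then contributes less
  -- than `δ`.
  set K := (B + 1) * 2 ^ (p + 1) * C * (fx * 2 + 1) with hK
  have hK0 : 0 ≤ K := by positivity
  rw [Metric.tendsto_nhds]
  intro δ hδ
  set ε := δ / (K + 1) with hε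
  have hε0 : 0 < ε := by positivity
  obtain ⟨η, hη, hball⟩ := Metric.eventually_nhds_iff.1 (hρ.bound hε0)
  have h2h : Tendsto (fun n => 2 * h n) atTop (𝓝 0) := by simpa using hh.const_mul 2
  have hsmall : ∀ᶠ z : ℕ × Ω in probFilter P, 2 * h z.1 < η :=
    tendsto_fst_probFilter.eventually (h2h.eventually (gt_mem_nhds hη))
  have hmass := (happ.mass 0 2 le_rfl two_pos le_rfl).eventually
    (gt_mem_nhds (show fx * (2 - 0) < fx * 2 + 1 by linarith))
  have hAB := Metric.tendstoUniformlyOn_iff.1 W.unif 1 one_pos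
  filter_upwards [hsmall, hmass, hAB, tendsto_fst_probFilter.eventually hrate] with z hz hm hA hr
  set c := sideSample x₀ σ I (h z.1) z.1 fun j => x j z.2 with hc
  have hhz := hpos z.1
  have hle : |c.avg fun v => A z.1 (fun j => x j z.2) v * ρ (x₀ + σ * h z.1 * v)| ≤
      c.avg fun v => ((B + 1) * (ε * (2 * h z.1) ^ (p + 1))) *
        (Set.Ico (0 : ℝ) 2).indicator (fun _ => 1) v := by
    refine Sample.abs_avg_le (happ.wt_nonneg z) fun j hj => ?_
    have hv := happ.pt_mem z j hj
    change c.pt j ∈ _ at hv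
    rw [Set.indicator_of_mem hv, mul_one, abs_mul]
    have h1 : |A z.1 (fun j => x j z.2) (c.pt j)| ≤ B + 1 := by
      have h3 := hA (c.pt j) ⟨hv.1, hv.2.le⟩
      rw [Real.dist_eq, abs_sub_comm] at h3
      have h4 := hB (c.pt j) ⟨hv.1, hv.2.le⟩
      have h5 := abs_sub_abs_le_abs_sub (A z.1 (fun j => x j z.2) (c.pt j)) (a (c.pt j))
      linarith
    have habs : |σ * h z.1 * c.pt j| ≤ 2 * h z.1 := by
      have hσ : |σ| = 1 := by rcases hI.sign with rfl | rfl <;> simp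
      rw [abs_mul, abs_mul, hσ, one_mul, abs_of_pos hhz, abs_of_nonneg hv.1, mul_comm]
      exact mul_le_mul_of_nonneg_right hv.2.le hhz.le
    have h2 : |ρ (x₀ + σ * h z.1 * c.pt j)| ≤ ε * (2 * h z.1) ^ (p + 1) := by
      have h3 := hball (y := x₀ + σ * h z.1 * c.pt j) (by
        rw [Real.dist_eq, add_sub_cancel_left]; exact lt_of_le_of_lt habs hz)
      rw [Real.norm_eq_abs, add_sub_cancel_left, norm_pow, Real.norm_eq_abs] at h3
      exact h3.trans (mul_le_mul_of_nonneg_left (pow_le_pow_left₀ (abs_nonneg _) habs _) hε0.le)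
    exact mul_le_mul h1 h2 (abs_nonneg _) (by linarith)
  rw [Sample.avg_const_mul] at hle
  rw [Real.dist_eq, sub_zero, abs_mul, abs_of_nonneg (Real.sqrt_nonneg _)]
  have hs := Real.sqrt_nonneg ((z.1 : ℝ) * h z.1)
  calc Real.sqrt (z.1 * h z.1) * |c.avg fun v => A z.1 (fun j => x j z.2) v *
        ρ (x₀ + σ * h z.1 * v)|
      ≤ Real.sqrt (z.1 * h z.1) * (((B + 1) * (ε * (2 * h z.1) ^ (p + 1))) * (fx * 2 + 1)) := by
        refine mul_le_mul_of_nonneg_left (hle.trans ?_) hs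
        exact mul_le_mul_of_nonneg_left hm.le (by positivity)
    _ = ((B + 1) * 2 ^ (p + 1) * (fx * 2 + 1) * ε) *
          (Real.sqrt (z.1 * h z.1) * h z.1 ^ (p + 1)) := by rw [mul_pow]; ring
    _ ≤ ((B + 1) * 2 ^ (p + 1) * (fx * 2 + 1) * ε) * C :=
        mul_le_mul_of_nonneg_left hr (by positivity)
    _ = K * ε := by rw [hK]; ring
    _ < δ := by
        rw [hε, mul_div_assoc', div_lt_iff₀ (by positivity)]
        nlinarith

include S hpos hh

/-- The noise may be weighted by the limits of the weights. -/
lemma ReproducingWeights.tendsto_noise_sub :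
    Tendsto (fun z : ℕ × Ω => (Real.sqrt (z.1 * h z.1))⁻¹ *
      ∑ j ∈ Finset.range z.1, I.indicator (fun u => A z.1 (fun j => x j z.2) (σ * u) - a (σ * u))
        ((x j z.2 - x₀) / h z.1) * e j z.2) (probFilter P) (𝓝 0) := by
  refine S.tendsto_negligible hpos hh (D := fun n j X =>
    I.indicator (fun u => A n X (σ * u) - a (σ * u)) ((X j - x₀) / h n)) ?_ ?_ ?_
  · intro n j
    have hu : Measurable fun X : ℕ → ℝ => (X j - x₀) / h n :=
      ((measurable_pi_apply j).sub_const _).div_const _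
    have hG : Measurable fun X : ℕ → ℝ => A n X (σ * ((X j - x₀) / h n)) -
        a (σ * ((X j - x₀) / h n)) :=
      ((W.meas n).comp (measurable_id.prodMk (hu.const_mul _))).sub
        (W.meas_lim.comp (hu.const_mul _))
    exact hG.indicator (hu hI.meas)
  · intro n j X hX
    exact Set.indicator_of_notMem (fun h' => absurd (hI.abs_lt_two h') (not_lt.2 hX.le)) _
  · intro ε hε
    filter_upwards [Metric.tendstoUniformlyOn_iff.1 W.unif ε hε] with z hz j _
    refine abs_indicator_le (σ := σ) (A := fun v => A z.1 (fun k => x k z.2) v - a v) hε.le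
      (fun u hu => ?_) _
    have hv := hI.sub u hu
    have := hz _ ⟨hv.1, hv.2.le⟩
    rw [Real.dist_eq, abs_sub_comm] at this
    exact this.le

include hnh

/-- The centered one-sided estimator is a weighted sum of noise, up to negligible terms. -/
theorem ReproducingWeights.tendsto_linearization (hf : 0 < f x₀)
    (hg : HasTaylor g x₀ (p + 1)) {C : ℝ}
    (hrate : ∀ᶠ n : ℕ in atTop, Real.sqrt (n * h n) * h n ^ (p + 1) ≤ C)
    (hy : ∀ n j ω, |x j ω - x₀| < r → (x j ω - x₀) / h n ∈ I → y j ω = g (x j ω) + e j ω) :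
    Tendsto (fun z : ℕ × Ω => Real.sqrt (z.1 * h z.1) *
        ((sideSample x₀ σ I (h z.1) z.1 fun j => x j z.2).lin (A z.1 fun j => x j z.2)
          (fun j => y j z.2) - g x₀) -
      (Real.sqrt (z.1 * h z.1))⁻¹ * ∑ j ∈ Finset.range z.1,
        I.indicator (fun u => a (σ * u)) ((x j z.2 - x₀) / h z.1) * e j z.2)
      (probFilter P) (𝓝 0) := by
  obtain ⟨b, hb0, hρ⟩ := hg
  have hbias := W.tendsto_bias hI (S.approximates hpos hh hnh hI hf) hpos hh hrate hρ
  have hnoise := W.tendsto_noise_sub S hpos hh hI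
  have hsum := hbias.add hnoise
  rw [add_zero] at hsum
  have h2h : Tendsto (fun n => 2 * h n) atTop (𝓝 0) := by simpa using hh.const_mul 2
  have hsmall : ∀ᶠ z : ℕ × Ω in probFilter P, 2 * h z.1 < r :=
    tendsto_fst_probFilter.eventually (h2h.eventually (gt_mem_nhds S.r_pos))
  refine hsum.congr' ?_
  filter_upwards [hsmall, W.rep] with z hz hrep
  classical
  have hhz := hpos z.1
  have hσ : σ * σ = 1 := by rcases hI.sign with rfl | rfl <;> norm_num
  have hx : ∀ j, x j z.2 = x₀ + σ * h z.1 *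
      (sideSample x₀ σ I (h z.1) z.1 fun j => x j z.2).pt j := by
    intro j
    have h0 := hhz.ne'
    simp only [sideSample]
    rw [show σ * h z.1 * (σ * ((x j z.2 - x₀) / h z.1)) =
      (σ * σ) * (h z.1 * ((x j z.2 - x₀) / h z.1)) by ring, hσ, mul_div_cancel₀ _ h0]
    ring
  have hyj : ∀ j ∈ (sideSample x₀ σ I (h z.1) z.1 fun j => x j z.2).idx, y j z.2 =
      (fun v => g (x₀ + σ * h z.1 * v))
        ((sideSample x₀ σ I (h z.1) z.1 fun j => x j z.2).pt j) + e j z.2 := by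
    intro j hj
    simp only [sideSample, Finset.mem_filter] at hj
    have hw : |x j z.2 - x₀| < r := by
      have h1 := hI.abs_lt_two hj.2
      rw [abs_div, abs_of_pos hhz, div_lt_iff₀ hhz] at h1
      linarith
    simp only [← hx j]
    exact hy z.1 j z.2 hw hj.2
  -- Since `t - x₀ = σ h v`, the Taylor coefficient of order `k` is rescaled by `(σ h) ^ k`.
  have hdec := Sample.lin_sub_eq (y := fun j => y j z.2) (ε := fun j => e j z.2)
    (G := fun v => g (x₀ + σ * h z.1 * v)) hrep hyj fun k => b k * (σ * h z.1) ^ k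
  have hpoly : ∀ t : ℝ, ∑ k ∈ Finset.range (p + 2), b k * (σ * h z.1) ^ k * t ^ k =
      ∑ k ∈ Finset.range (p + 1 + 1), b k * (x₀ + σ * h z.1 * t - x₀) ^ k := fun t =>
    Finset.sum_congr rfl fun k _ => by rw [add_sub_cancel_left, mul_pow]; ring
  simp only [hpoly, pow_zero, mul_one, hb0] at hdec
  rw [hdec, mul_add, sideSample_lin, ← mul_assoc (Real.sqrt _) (_⁻¹), sqrt_mul_inv_self,
    add_sub_assoc, ← mul_sub, ← Finset.sum_sub_distrib]
  congr 2
  refine Finset.sum_congr rfl fun j _ => ?_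
  rw [← sub_mul]
  congr 1
  by_cases hj : (x j z.2 - x₀) / h z.1 ∈ I
  · simp only [Set.indicator_of_mem hj]
  · simp only [Set.indicator_of_notMem hj, sub_zero]

end OneSide

/-! ### Asymptotic normality of the difference of the one-sided estimators -/

lemma IsSide.integrable_indicator {σ : ℝ} {I : Set ℝ} (hI : IsSide σ I) {g : ℝ → ℝ}
    (hg : Measurable g) {B : ℝ} (hB : ∀ v ∈ Set.Icc (0 : ℝ) 2, |g v| ≤ B) :
    Integrable (I.indicator fun u => g (σ * u)) := by
  rw [integrable_indicator_iff hI.meas]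
  have hfin : volume I < ⊤ := by
    refine lt_of_le_of_lt (measure_mono fun u hu => ?_)
      (measure_Icc_lt_top (a := (-2 : ℝ)) (b := 2) (μ := volume))
    exact abs_le.1 (hI.abs_lt_two hu).le
  refine Measure.integrableOn_of_bounded (M := B) hfin.ne
    (hg.comp (measurable_const_mul σ)).aestronglyMeasurable ?_
  filter_upwards [ae_restrict_mem hI.meas] with u hu
  have hv := hI.sub u hu
  exact hB _ ⟨hv.1, hv.2.le⟩

section TwoSides

variable {Ω : Type*} [MeasurableSpace Ω] {P : Measure Ω} [IsProbabilityMeasure P]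
  {x e y : ℕ → Ω → ℝ} {x₀ r : ℝ} {f v gr gl : ℝ → ℝ} {vr vl : ℝ}
  (S : NoisySample P x e x₀ r f v vr vl)
  {h : ℕ → ℝ} (hpos : ∀ n, 0 < h n) (hh : Tendsto h atTop (𝓝 0))
  (hnh : Tendsto (fun n : ℕ => (n : ℝ) * h n) atTop atTop)
  {p : ℕ} {Ar Al : ℕ → (ℕ → ℝ) → ℝ → ℝ} {ar al : ℝ → ℝ}
  (Wr : ReproducingWeights P x h x₀ 1 (Set.Ico 0 2) p Ar ar)
  (Wl : ReproducingWeights P x h x₀ (-1) (Set.Ioo (-2) 0) p Al al)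

include S hpos hh hnh Wr Wl

/-- Both sides enter one noise sum with weight `br - bl`. The supports are disjoint, so the square
has no cross term and the variances add without a joint limit theorem. -/
theorem tendstoInDistribution_difference (hf : 0 < f x₀) (hgr : HasTaylor gr x₀ (p + 1))
    (hgl : HasTaylor gl x₀ (p + 1)) {C : ℝ}
    (hrate : ∀ᶠ n : ℕ in atTop, Real.sqrt (n * h n) * h n ^ (p + 1) ≤ C)
    (hym : ∀ j, Measurable (y j))
    (hy : ∀ j ω, |x j ω - x₀| < r →
      y j ω = (if x₀ ≤ x j ω then gr (x j ω) else gl (x j ω)) + e j ω) {V : ℝ≥0}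
    (hV : vr * f x₀ * (∫ v in (0 : ℝ)..2, ar v ^ 2) + vl * f x₀ * (∫ v in (0 : ℝ)..2, al v ^ 2)
      = V) :
    TendstoInDistribution (fun n ω => Real.sqrt (n * h n) *
      ((sideSample x₀ 1 (Set.Ico 0 2) (h n) n fun j => x j ω).lin (Ar n fun j => x j ω)
          (fun j => y j ω) -
        (sideSample x₀ (-1) (Set.Ioo (-2) 0) (h n) n fun j => x j ω).lin (Al n fun j => x j ω)
          (fun j => y j ω) - (gr x₀ - gl x₀))) atTop (id : ℝ → ℝ) (fun _ => P)
      (gaussianReal 0 V) := by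
  have hR := isSide_right
  have hL := isSide_left
  have hlinr := Wr.tendsto_linearization (g := gr) (y := y) S hpos hh hnh hR hf hgr hrate
    fun n j ω hw hj => by
      rw [hy j ω hw, if_pos]
      have h1 := hj.1
      rwa [le_div_iff₀ (hpos n), zero_mul, sub_nonneg] at h1
  have hlinl := Wl.tendsto_linearization (g := gl) (y := y) S hpos hh hnh hL hf hgl hrate
    fun n j ω hw hj => by
      rw [hy j ω hw, if_neg]
      have h1 := hj.2
      rwa [div_lt_iff₀ (hpos n), zero_mul, sub_neg, ← not_le] at h1
  obtain ⟨Br, hBr0, hBr⟩ := Wr.bound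
  obtain ⟨Bl, hBl0, hBl⟩ := Wl.bound
  set br : ℝ → ℝ := (Set.Ico (0 : ℝ) 2).indicator fun u => ar (1 * u) with hbr
  set bl : ℝ → ℝ := (Set.Ioo (-2 : ℝ) 0).indicator fun u => al (-1 * u) with hbl
  have hbrm : Measurable br :=
    (Wr.meas_lim.comp (measurable_const_mul 1)).indicator measurableSet_Ico
  have hblm : Measurable bl :=
    (Wl.meas_lim.comp (measurable_const_mul (-1))).indicator measurableSet_Ioo
  have hbrB : ∀ u, |br u| ≤ Br := abs_indicator_le hBr0 fun u hu =>
    hBr _ (Set.Ico_subset_Icc_self (hR.sub u hu))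
  have hblB : ∀ u, |bl u| ≤ Bl := abs_indicator_le hBl0 fun u hu =>
    hBl _ (Set.Ico_subset_Icc_self (hL.sub u hu))
  have hvar : ∫ u, (br u - bl u) ^ 2 * (if 0 ≤ u then vr * f x₀ else vl * f x₀) = V := by
    have hpt : ∀ u, (br u - bl u) ^ 2 * (if 0 ≤ u then vr * f x₀ else vl * f x₀) =
        (Set.Ico (0 : ℝ) 2).indicator (fun u => vr * f x₀ * ar (1 * u) ^ 2) u +
          (Set.Ioo (-2 : ℝ) 0).indicator (fun u => vl * f x₀ * al (-1 * u) ^ 2) u := by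
      intro u
      by_cases hu : 0 ≤ u
      · have h1 : u ∉ Set.Ioo (-2 : ℝ) 0 := fun h => absurd h.2 (not_lt.2 hu)
        rw [if_pos hu, hbl, Set.indicator_of_notMem h1, Set.indicator_of_notMem h1, hbr]
        by_cases h2 : u ∈ Set.Ico (0 : ℝ) 2
        · rw [Set.indicator_of_mem h2, Set.indicator_of_mem h2]; ring
        · rw [Set.indicator_of_notMem h2, Set.indicator_of_notMem h2]; ring
      · have h1 : u ∉ Set.Ico (0 : ℝ) 2 := fun h => hu h.1
        rw [if_neg hu, hbr, Set.indicator_of_notMem h1, Set.indicator_of_notMem h1, hbl]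
        by_cases h2 : u ∈ Set.Ioo (-2 : ℝ) 0
        · rw [Set.indicator_of_mem h2, Set.indicator_of_mem h2]; ring
        · rw [Set.indicator_of_notMem h2, Set.indicator_of_notMem h2]; ring
    have hsqB : ∀ {a : ℝ → ℝ} {B c : ℝ}, (∀ v ∈ Set.Icc (0 : ℝ) 2, |a v| ≤ B) →
        ∀ v ∈ Set.Icc (0 : ℝ) 2, |c * a v ^ 2| ≤ |c| * B ^ 2 := by
      intro a B c hB v hv
      rw [abs_mul, abs_pow]
      exact mul_le_mul_of_nonneg_left (pow_le_pow_left₀ (abs_nonneg _) (hB v hv) 2) (abs_nonneg _)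
    have i1 := hR.integrable_indicator ((Wr.meas_lim.pow_const 2).const_mul (vr * f x₀))
      (hsqB hBr)
    have i2 := hL.integrable_indicator ((Wl.meas_lim.pow_const 2).const_mul (vl * f x₀))
      (hsqB hBl)
    have e1 := hR.integral_indicator fun v => vr * f x₀ * ar v ^ 2
    have e2 := hL.integral_indicator fun v => vl * f x₀ * al v ^ 2
    simp only [hpt]
    rw [integral_add i1 i2, e1, e2, intervalIntegral.integral_const_mul,
      intervalIntegral.integral_const_mul, hV]
  have hclt := S.tendstoInDistribution_noise hpos hh hnh (b := fun u => br u - bl u)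
    (hbrm.sub hblm) (B := Br + Bl)
    (fun u => (abs_sub _ _).trans (add_le_add (hbrB u) (hblB u)))
    (fun u hu => by
      have h1 : u ∉ Set.Ico (0 : ℝ) 2 := fun h' => absurd (hR.abs_lt_two h') (not_lt.2 hu.le)
      have h2 : u ∉ Set.Ioo (-2 : ℝ) 0 := fun h' => absurd (hL.abs_lt_two h') (not_lt.2 hu.le)
      simp only [hbr, hbl, Set.indicator_of_notMem h1, Set.indicator_of_notMem h2, sub_zero])
    hvar
  refine tendstoInDistribution_of_tendstoInMeasure_sub _ _ hclt ?_ fun n => ?_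
  · refine tendstoInMeasure_of_probFilter ?_
    have hdiff := hlinr.sub hlinl
    rw [sub_zero] at hdiff
    refine hdiff.congr fun z => ?_
    simp only [Pi.sub_apply, sub_mul, Finset.sum_sub_distrib]
    ring
  · refine Measurable.aemeasurable (Measurable.const_mul ?_ _)
    exact ((measurable_sideSample_lin hR _ _ S.meas_x hym (Wr.meas n)).sub
      (measurable_sideSample_lin hL _ _ S.meas_x hym (Wl.meas n))).sub_const _

end TwoSides

/-! ### The bootstrap and robust-bias-correction weights -/

section Weights

variable {Ω : Type*} [MeasurableSpace Ω] {P : Measure Ω} [IsProbabilityMeasure P]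
  {x e : ℕ → Ω → ℝ} {x₀ r : ℝ} {f v : ℝ → ℝ} {vr vl : ℝ}
  (S : NoisySample P x e x₀ r f v vr vl)
  {h : ℕ → ℝ} (hpos : ∀ n, 0 < h n) (hh : Tendsto h atTop (𝓝 0))
  (hnh : Tendsto (fun n : ℕ => (n : ℝ) * h n) atTop atTop)
  {σ : ℝ} {I : Set ℝ} (hI : IsSide σ I) {K : ℝ → ℝ} (hK : IsKernel K) (p : ℕ) (hf : 0 < f x₀)

include S hpos hh hnh hI hK hf

/-- The condition `C_LP ≠ 0` makes the scaling factor continuous at the limit. It also makes the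
sample denominator nonzero with probability tending to one, as exact reproduction of degree `p + 1`
requires. -/
theorem reproducingWeights_locBoot (hC : constCLP K p ≠ 0) :
    ReproducingWeights P x h x₀ σ I p
      (fun n X => locBoot (sideSample x₀ σ I (h n) n X).avg K p)
      (locBoot (avgLim (f x₀)) K p) := by
  have happ := S.approximates hpos hh hnh hI hf
  have hs : locSmooth (avgLim (f x₀)) K p ≠ 0 := by rwa [hK.locSmooth_avgLim hf]
  refine ⟨fun n => (measurableAvg_sideSample hI _ _).locBoot hK.measurable p,
    hK.measurable_locBoot _ _, hK.locBoot_bounded hf p, happ.tendsto_locBoot hK hs, ?_⟩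
  filter_upwards [happ.eventually_isUnit_det hK p,
    (happ.tendsto_locSmooth hK p).eventually_ne hs] with z h1 h2 k hk
  exact Sample.avg_locBoot_mul_pow _ (h1 0 (by simp))
    (fun j hj => h1 _ (Set.Ico_subset_Icc_self (happ.pt_mem z j hj))) h2 hk

theorem reproducingWeights_locRBC :
    ReproducingWeights P x h x₀ σ I p
      (fun n X => locRBC (sideSample x₀ σ I (h n) n X).avg K p)
      (locRBC (avgLim (f x₀)) K p) := by
  have happ := S.approximates hpos hh hnh hI hf
  refine ⟨fun n => (measurableAvg_sideSample hI _ _).locRBC hK.measurable p,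
    hK.measurable_locRBC _ _, hK.locRBC_bounded hf p, happ.tendsto_locRBC hK p, ?_⟩
  filter_upwards [happ.eventually_isUnit_det hK p, happ.eventually_isUnit_det hK (p + 1)]
    with z h1 h2 k hk
  exact Sample.avg_locRBC_mul_pow _ (h1 0 (by simp)) (h2 0 (by simp)) hk

end Weights

/-! ### Bandwidths -/

namespace IsBandwidth

variable {p : ℕ} {h : ℕ → ℝ} (hh : IsBandwidth p h)

include hh

lemma tendsto_zero : Tendsto h atTop (𝓝 0) := by
  refine tendsto_of_tendsto_of_tendsto_of_le_of_le tendsto_const_nhds hh.tendsto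
    (fun n => (hh.pos n).le) fun n => ?_
  have h1 : 0 ≤ Real.log n := Real.log_natCast_nonneg n
  have h2 := (hh.pos n).le
  have : 0 ≤ ((n : ℝ) * h n)⁻¹ * Real.log n := by positivity
  simpa using this

lemma tendsto_effSize : Tendsto (fun n : ℕ => (n : ℝ) * h n) atTop atTop := by
  have hinv : Tendsto (fun n : ℕ => ((n : ℝ) * h n)⁻¹) atTop (𝓝 0) := by
    refine tendsto_of_tendsto_of_tendsto_of_le_of_le' tendsto_const_nhds hh.tendsto
      (Eventually.of_forall fun n => inv_nonneg.2 (mul_nonneg n.cast_nonneg (hh.pos n).le)) ?_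
    -- For `n ≥ 3 > e` the logarithm is at least one, so `(nh)⁻¹` is dominated by the quantity
    -- assumed to vanish.
    filter_upwards [eventually_ge_atTop 3] with n hn
    have hn' : (3 : ℝ) ≤ n := by exact_mod_cast hn
    have h1 : 1 ≤ Real.log n := by
      rw [Real.le_log_iff_exp_le (by linarith)]
      exact (Real.exp_one_lt_d9.le.trans (by norm_num)).trans hn'
    have h2 : 0 ≤ ((n : ℝ) * h n)⁻¹ := inv_nonneg.2 (mul_nonneg n.cast_nonneg (hh.pos n).le)
    have h3 := hh.pos n
    nlinarith
  have hpos : ∀ᶠ n : ℕ in atTop, ((n : ℝ) * h n)⁻¹ ∈ Set.Ioi (0 : ℝ) := by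
    filter_upwards [eventually_gt_atTop 0] with n hn
    exact inv_pos.2 (mul_pos (by exact_mod_cast hn) (hh.pos n))
  have := (tendsto_nhdsWithin_iff.2 ⟨hinv, hpos⟩).inv_tendsto_nhdsGT_zero
  exact this.congr fun n => by simp [Pi.inv_apply]

/-- The expression equals `√(n h ^ (2p + 3))`, whose argument converges to `κ`. -/
lemma eventually_rate_le : ∃ C : ℝ, ∀ᶠ n : ℕ in atTop,
    Real.sqrt (n * h n) * h n ^ (p + 1) ≤ C := by
  obtain ⟨κ, -, hκ⟩ := hh.rate
  refine ⟨Real.sqrt (κ + 1), (hκ.eventually (gt_mem_nhds (lt_add_one κ))).mono fun n hn => ?_⟩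
  have h0 := (hh.pos n).le
  rw [← Real.sqrt_sq (pow_nonneg h0 (p + 1)), ← Real.sqrt_mul (mul_nonneg n.cast_nonneg h0)]
  refine Real.sqrt_le_sqrt (le_trans (le_of_eq ?_) hn.le)
  ring

end IsBandwidth

end RDD

end

/-! ### Assembly of the two limits and the variance ratio -/

theorem corollary3 {Ω Ω' : Type*} [MeasurableSpace Ω] [MeasurableSpace Ω']
    (P : Measure Ω) [IsProbabilityMeasure P] (P' : Measure Ω') [IsProbabilityMeasure P']
    (p : ℕ) (hp : Odd p) (x₀ : ℝ)
    -- forcing variables, potential outcomes with and without treatment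
    (x y1 y0 : ℕ → Ω → ℝ)
    -- density, regression functions and conditional variances (right, left)
    (f gr gl sr sl : ℝ → ℝ)
    (model : RDD.Model P p x₀ x y1 y0 f gr gl sr sl)
    (hs : 0 < sr x₀ + sl x₀)
    -- kernels to the right and to the left of the cutoff, and bandwidth
    (Kr Kl : ℝ → ℝ) (hKr : RDD.IsKernel Kr) (hKl : RDD.IsKernel Kl)
    (h : ℕ → ℝ) (hh : RDD.IsBandwidth p h)
    -- the limits `Q = C / C_LP` of the scaling factors are well defined
    (hQr : RDD.constCLP Kr p ≠ 0) (hQl : RDD.constCLP Kl p ≠ 0)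
    -- bootstrap errors `resid * e`, with arbitrary residuals computed from the data
    (resid : ℕ → ℕ → Ω → ℝ) (e : ℕ → Ω' → ℝ) (he : RDD.IsMultiplier P' e) :
    ∃ v_rd v_RBC : ℝ≥0, 0 < v_rd ∧ 0 < v_RBC ∧
      RDD.HasAsymptoticVariance P
        (fun n ω =>
          RDD.stat p Kr Kl x₀ (h n) (gr x₀ - gl x₀) n (fun i => x i ω)
              (fun i => RDD.observed x₀ x y1 y0 i ω) -
            RDD.bootBias P' e p Kr Kl x₀ (h n) n (fun i => x i ω)
              (fun i => RDD.observed x₀ x y1 y0 i ω) (fun i => resid n i ω))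
        v_rd ∧
      RDD.HasAsymptoticVariance P
        (fun n ω =>
          RDD.stat p Kr Kl x₀ (h n) (gr x₀ - gl x₀) n (fun i => x i ω)
              (fun i => RDD.observed x₀ x y1 y0 i ω) -
            RDD.rbcBias p Kr Kl x₀ (h n) n (fun i => x i ω)
              (fun i => RDD.observed x₀ x y1 y0 i ω))
        v_RBC ∧
      (v_rd : ℝ) / (v_RBC : ℝ) =
        (sr x₀ * RDD.KmPLP Kr p + sl x₀ * RDD.KmPLP Kl p) /
          (sr x₀ * RDD.KRBC Kr p + sl x₀ * RDD.KRBC Kl p) := by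
  obtain ⟨r, ε, v, S, hy⟩ := model.exists_noisySample
  obtain ⟨N, hN, hxN, -, -, -, hgr, hgl, -⟩ := model.local_smooth
  obtain ⟨C, hrate⟩ := hh.eventually_rate_le
  obtain ⟨hsr, hsl⟩ := model.cond_var_nonneg
  have hf := model.density_pos
  have h0 := hh.tendsto_zero
  have hnh := hh.tendsto_effSize
  have hTr := RDD.hasTaylor_of_contDiffOn hN hxN hgr
  have hTl := RDD.hasTaylor_of_contDiffOn hN hxN hgl
  -- One conditional variance may vanish at the cutoff. Both are nonnegative with positive sum,
  -- which suffices because the kernel constants on both sides are positive.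
  have hVpos : ∀ a b : ℝ, 0 < a → 0 < b → 0 < (f x₀)⁻¹ * (sr x₀ * a + sl x₀ * b) := by
    intro a b ha hb
    refine mul_pos (inv_pos.2 hf) ?_
    rcases hsr.eq_or_lt with h | h
    · rw [← h] at hs ⊢
      rw [zero_add] at hs
      simpa using mul_pos hs hb
    · exact add_pos_of_pos_of_nonneg (mul_pos h ha) (mul_nonneg hsl hb.le)
  have hv1 := hVpos _ _ (hKr.KmPLP_pos p) (hKl.KmPLP_pos p)
  have hv2 := hVpos _ _ (hKr.KRBC_pos p) (hKl.KRBC_pos p)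
  -- The squared weights bring `f(x₀)⁻²` and the noise `f(x₀)`. The remaining factor `f(x₀)⁻¹` is
  -- common to both procedures and cancels in the ratio.
  have hcancel : ∀ a b : ℝ, sr x₀ * f x₀ * (((f x₀)⁻¹) ^ 2 * a) +
      sl x₀ * f x₀ * (((f x₀)⁻¹) ^ 2 * b) = (f x₀)⁻¹ * (sr x₀ * a + sl x₀ * b) := by
    intro a b
    have := hf.ne'
    field_simp
  refine ⟨⟨_, hv1.le⟩, ⟨_, hv2.le⟩, hv1, hv2, ?_, ?_, ?_⟩
  · have h1 := RDD.tendstoInDistribution_difference (V := ⟨_, hv1.le⟩) S hh.pos h0 hnh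
      (RDD.reproducingWeights_locBoot S hh.pos h0 hnh RDD.isSide_right hKr p hf hQr)
      (RDD.reproducingWeights_locBoot S hh.pos h0 hnh RDD.isSide_left hKl p hf hQl)
      hf hTr hTl hrate model.measurable_observed hy
      (by rw [hKr.integral_locBoot_sq hf, hKl.integral_locBoot_sq hf, hcancel]; rfl)
    unfold RDD.HasAsymptoticVariance
    convert h1 using 3 with n ω
    rw [RDD.stat_sub_bootBias he hKr hKl hp x₀ (hh.pos n), RDD.rightDesign_sample _ _ (hh.pos n),
      RDD.leftDesign_sample _ _ (hh.pos n)]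
  · have h1 := RDD.tendstoInDistribution_difference (V := ⟨_, hv2.le⟩) S hh.pos h0 hnh
      (RDD.reproducingWeights_locRBC S hh.pos h0 hnh RDD.isSide_right hKr p hf)
      (RDD.reproducingWeights_locRBC S hh.pos h0 hnh RDD.isSide_left hKl p hf)
      hf hTr hTl hrate model.measurable_observed hy
      (by rw [hKr.integral_locRBC_sq hf, hKl.integral_locRBC_sq hf, hcancel]; rfl)
    unfold RDD.HasAsymptoticVariance
    convert h1 using 3 with n ω
    rw [RDD.stat_sub_rbcBias hKr hKl hp x₀ (hh.pos n), RDD.rightDesign_sample _ _ (hh.pos n),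
      RDD.leftDesign_sample _ _ (hh.pos n)]
  · exact mul_div_mul_left _ _ (inv_pos.2 hf).ne'
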